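/- **The calculus.** Fix a set of physical locations with a metric $d$ with values in $\mathbb N$, and $\delta\in\mathbb N$. Every channel $c$ has a range $\mathrm{rng}(c)\in\mathbb N\cup\{-1,\infty\}$, with infinitely many channels of each range. Every sensor has a domain of values and is either location-dependent or node-dependent. *Processes* are $$P::=\mathrm{nil}\mid\sigma.P\mid @(x).P\mid s?(x).P\mid a!v.P\mid P|P\mid\lfloor\bar c\langle v\rangle.P\rfloor P\mid\lfloor c(x).P\rfloor P\mid[b]P;P\mid X\mid\mathrm{fix}X.P$$ (sleep one time unit; get the location; read a sensor $s$; write on an actuator $a$; output and input on $c$ with a timeout continuation; conditional; time-guarded recursion). *Networks* are $M::=\mathbf 0\mid n[\mathcal I\bowtie P]^{\mu}_h\mid M|M\mid(\nu c)M$, where the device $n$ is at location $h$, is stationary ($\mu=\mathtt s$) or mobile ($\mu=\mathtt m$), and its interface $\mathcal I$ is a partial map from sensors and actuators to values. Networks are closed and well-formed: node names are distinct; no actuator and no node-dependent sensor belongs to two nodes; each process uses only sensors and actuators on which its interface is defined; location-dependent sensors occur only in stationary nodes. Communication on $c$ is instantaneous; it happens inside a node if $\mathrm{rng}(c)=-1$,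 and between nodes at $h,k$ if $d(h,k)\le\mathrm{rng}(c)$. Position detection, sensor reading and actuator writing are instantaneous too. One time unit passes (a $\sigma$-step) only when all components can let time pass and no $\tau$-step is possible; sleeping prefixes are then consumed, pending communications time out, and a mobile node at $h$ moves to any $k$ with $d(h,k)\le\delta$. An instantaneous step is labelled $a$ if it changes the value of the actuator $a$, and $\tau$ otherwise. The barb $M\downarrow_{a@h!v}$ holds if $M$ has a node at $h$ with $\mathcal I(a)=v$. The environment's update $M[s@h\mapsto v]$ sets to $v$ the sensor $s$ in every node at $h$ that has it. *Weak bisimilarity* $\approx$ is the largest symmetric relation $\mathcal R$ over networks such that $M\,\mathcal R\,N$ and $M\xrightarrow{\alpha}M'$ imply $N\stackrel{\hat\alpha}{\Longrightarrow}N'$ with $M'\,\mathcal R\,N'$, for the extensional actions $\alpha$: $\tau$; $\sigma$; $a$; output and input of $v$ on $c$ with $\mathrm{rng}(c)\ge0$, observed at any location $k$ within range of the communicating node; sensor updates $M\to M[s@h\mapsto v]$ with $v$ in the domain of $s$; barbs $M\to M$. Here $\stackrel{\hat\tau}{\Longrightarrow}$ is $\xrightarrow{\tau}{}^{*}$, and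 $\stackrel{\hat\alpha}{\Longrightarrow}$ is $\xrightarrow{\tau}{}^{*}\xrightarrow{\alpha}\xrightarrow{\tau}{}^{*}$ for $\alpha\ne\tau$. *Reduction barbed congruence* $\cong$ is the largest symmetric relation over networks that (i) is closed under reduction in the reduction semantics: with $\to\ =\ \to_\tau\cup\to_\sigma$, if $M\,\mathcal R\,N$ and $M\to M'$ (resp. $M\to_a M'$) then $N\to^*N'$ (resp. $N\to^*\to_a\to^*N'$) with $M'\,\mathcal R\,N'$; (ii) preserves barbs: $M\,\mathcal R\,N$ and $M\downarrow_{a@h!v}$ imply $N\to^*N'\downarrow_{a@h!v}$ for some $N'$; (iii) is preserved by parallel composition with any network that keeps both sides well-formed, by channel restriction, and by sensor updates within the domain of the sensor. **The smart home.** Let $loc_1,\dots,loc_4$ be locations with $d(loc_i,loc_j)=|i-j|$ and $d(l,loc_i)\ge i$ for every other location $l$, and let $out\notin\{loc_1,\dots,loc_4\}$. Let $$Sys=Phone\mid LM_1(c_1)\mid LM_2(c_2)\mid BM,\qquad \overline{Sys}=\overline{Phone}\mid LM_1(e_1)\mid LM_2(e_2)\mid BM\mid CLM,$$ with - $Phone=n_P[\mathcal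 I_P\bowtie BC\,|\,LC_1\,|\,LC_2]^{\mathtt m}_{out}$ and $\overline{Phone}=n_P[\mathcal I_P\bowtie BC\,|\,\overline{LC}]^{\mathtt m}_{out}$, where $BC=\mathrm{fix}X.\,mode?(z).\lfloor\bar b\langle z\rangle.\sigma.X\rfloor X$, $LC_j=\mathrm{fix}X.\lfloor\bar c_j\langle\rangle.\sigma.X\rfloor X$, $\overline{LC}=\mathrm{fix}X.@(x).\lfloor\bar g\langle x\rangle.\sigma.X\rfloor X$; - $LM_j(c)=n_j[\mathcal I_j\bowtie \mathrm{fix}X.\lfloor c().\,light_j!\mathsf{on}.\sigma.X\rfloor\, light_j!\mathsf{off}.X]^{\mathtt s}_{h_j}$ with $h_1=loc_1$, $h_2=loc_4$; - $BM=n_B[\mathcal I_B\bowtie Auto]^{\mathtt s}_{loc_2}$, where $Auto=\mathrm{fix}X.\lfloor b(x).[x=\mathsf{man}]\,boiler!\mathsf{on}.\sigma.Man;\,TC\rfloor TC$, $Man=\mathrm{fix}Y.\,\mathrm{fix}Z.\lfloor b(y).[y=\mathsf{auto}]X;\sigma.Y\rfloor Z$, $TC=temp?(t).[t<\Theta]\,boiler!\mathsf{on}.\sigma.X;\,boiler!\mathsf{off}.\sigma.X$;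 - $CLM=n_{LM}[\emptyset\bowtie \mathrm{fix}X.\lfloor g(y).[y=loc_1]\lfloor\bar e_1\langle\rangle.\sigma.X\rfloor X;\,[y=loc_4]\lfloor\bar e_2\langle\rangle.\sigma.X\rfloor X;\,\sigma.X\rfloor X]^{\mathtt s}_{loc_3}$. The node names are distinct, and so are the actuators; $mode$ is a node-dependent sensor with domain $\{\mathsf{man},\mathsf{auto}\}$ and $temp$ a location-dependent one with domain $\mathbb N$; $\Theta\in\mathbb N$. The interfaces are defined exactly by $\mathcal I_P(mode)=\mathsf{auto}$, $\mathcal I_j(light_j)=\mathsf{off}$, $\mathcal I_B(temp)=\Theta$, $\mathcal I_B(boiler)=\mathsf{off}$. The channels $b\neq g$ and $c_1\ne c_2$ and $e_1,e_2$ have the ranges $\mathrm{rng}(b)=\mathrm{rng}(g)=\infty$, $\mathrm{rng}(c_1)=\mathrm{rng}(c_2)=0$, $\mathrm{rng}(e_1)=2$, $\mathrm{rng}(e_2)=1$. **Proposition.** If $\delta=1$, then $$(\nu c_1)(\nu c_2)Sys\ \approx\ (\nu e_1)(\nu e_2)(\nu g)\overline{Sys}\qquad\text{and}\qquad(\nu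 c_1)(\nu c_2)Sys\ \cong\ (\nu e_1)(\nu e_2)(\nu g)\overline{Sys}.$$ -/

import Mathlib

/-! A timed process calculus of networked devices: syntax, reduction semantics, labelled semantics,
bisimilarity, reduction barbed congruence; and a smart home in two variants. -/

namespace IoT

/-- Transmission ranges, that is the elements of `ℕ ∪ {-1, ∞}`: `intra` is `-1`,
`short r` is `r`, and `internet` is `∞`. -/
inductive Range where
  | intra
  | short (r : ℕ)
  | internet

/-- `Covers r d` is the relation `d ≤ r` between a distance and a range. -/
def Range.Covers : Range → ℕ → Prop
  | .intra, _ => False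
  | .short r, d => d ≤ r
  | .internet, _ => True

/-- Channels. Every channel has a range, and there are infinitely many channels of each range. -/
@[ext] structure Chan where
  rng : Range
  id : ℕ

/-- Node names. -/
abbrev NodeName := ℕ

/-- Actuator names. -/
abbrev Act := ℕ

/-- Sensor names; a sensor is either location-dependent or node-dependent. -/
structure Sens where
  locDep : Bool
  id : ℕ
  deriving DecidableEq

/-- Values; `unit` is the content of an empty message. -/
inductive Val (Loc : Type) where
  | unit
  | bool (b : Bool)
  | int (z : ℤ)
  | loc (l : Loc)
  | on
  | off
  | man
  | auto

/-- The global parameters of the calculus: the physical locations with a discrete distance, the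
mobility bound `δ`, and the domains of the sensors. -/
structure World where
  Loc : Type
  dist : Loc → Loc → ℕ
  dist_eq_zero : ∀ h k, dist h k = 0 ↔ h = k
  dist_comm : ∀ h k, dist h k = dist k h
  dist_triangle : ∀ h k l, dist h l ≤ dist h k + dist k l
  δ : ℕ
  dom : Sens → Set (Val Loc)

abbrev World.V (W : World) : Type := Val W.Loc

/-! ### Syntax

Value variables and process variables are represented by two independent families of
de Bruijn indices. -/

/-- Value expressions. -/
inductive Exp (W : World) where
  | val (v : W.V)
  | var (i : ℕ)

/-- Guards: a decidable predicate applied to a list of value expressions. -/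
structure Guard (W : World) where
  args : List (Exp W)
  test : List W.V → Bool

/-- The guard is closed and its truth value is `b`. -/
def Guard.Eval {W : World} (g : Guard W) (b : Bool) : Prop :=
  ∃ vs : List W.V, g.args = vs.map Exp.val ∧ g.test vs = b

/-- Processes. -/
inductive Proc (W : World) where
  /-- termination -/
  | nil
  /-- `σ.P` -/
  | sigma (P : Proc W)
  /-- `@(x).P`; binds the value variable 0 in `P` -/
  | pos (P : Proc W)
  /-- `s?(x).P`; binds the value variable 0 in `P` -/
  | sens (s : Sens) (P : Proc W)
  /-- `a!e.P` -/
  | act (a : Act) (e : Exp W) (P : Proc W)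
  /-- `P | Q` -/
  | par (P Q : Proc W)
  /-- `⌊c⟨e⟩.P⌋Q`, output with timeout -/
  | snd (c : Chan) (e : Exp W) (P Q : Proc W)
  /-- `⌊c(x).P⌋Q`, input with timeout; binds the value variable 0 in `P` -/
  | rcv (c : Chan) (P Q : Proc W)
  /-- `[g]P;Q` -/
  | cond (g : Guard W) (P Q : Proc W)
  /-- process variable -/
  | pvar (i : ℕ)
  /-- `fix X.P`; binds the process variable 0 in `P` -/
  | fix (P : Proc W)

variable {W : World}

/-- Increase by one the value variables with index at least `k`. -/
def Exp.lift (k : ℕ) : Exp W → Exp W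
  | .val v => .val v
  | .var i => .var (if i < k then i else i + 1)

/-- Substitute the value `v` for the variable with index `k`. -/
def Exp.subst (k : ℕ) (v : W.V) : Exp W → Exp W
  | .val w => .val w
  | .var i => if i < k then .var i else if i = k then .val v else .var (i - 1)

/-- All variables have an index below `n`. -/
def Exp.Scoped (n : ℕ) : Exp W → Prop
  | .val _ => True
  | .var i => i < n

def Guard.lift (k : ℕ) (g : Guard W) : Guard W := ⟨g.args.map (Exp.lift k), g.test⟩

def Guard.subst (k : ℕ) (v : W.V) (g : Guard W) : Guard W := ⟨g.args.map (Exp.subst k v), g.test⟩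

def Guard.Scoped (n : ℕ) (g : Guard W) : Prop := ∀ e ∈ g.args, e.Scoped n

namespace Proc

/-- Increase by one the free value variables with index at least `k`. -/
def liftV : ℕ → Proc W → Proc W
  | _, nil => nil
  | k, sigma P => sigma (liftV k P)
  | k, pos P => pos (liftV (k + 1) P)
  | k, sens s P => sens s (liftV (k + 1) P)
  | k, act a e P => act a (e.lift k) (liftV k P)
  | k, par P Q => par (liftV k P) (liftV k Q)
  | k, snd c e P Q => snd c (e.lift k) (liftV k P) (liftV k Q)
  | k, rcv c P Q => rcv c (liftV (k + 1) P) (liftV k Q)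
  | k, cond g P Q => cond (g.lift k) (liftV k P) (liftV k Q)
  | _, pvar i => pvar i
  | k, fix P => fix (liftV k P)

/-- Increase by one the free process variables with index at least `k`. -/
def liftP : ℕ → Proc W → Proc W
  | _, nil => nil
  | k, sigma P => sigma (liftP k P)
  | k, pos P => pos (liftP k P)
  | k, sens s P => sens s (liftP k P)
  | k, act a e P => act a e (liftP k P)
  | k, par P Q => par (liftP k P) (liftP k Q)
  | k, snd c e P Q => snd c e (liftP k P) (liftP k Q)
  | k, rcv c P Q => rcv c (liftP k P) (liftP k Q)
  | k, cond g P Q => cond g (liftP k P) (liftP k Q)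
  | k, pvar i => pvar (if i < k then i else i + 1)
  | k, fix P => fix (liftP (k + 1) P)

/-- Substitute the value `v` for the value variable with index `k`. -/
def substV : ℕ → W.V → Proc W → Proc W
  | _, _, nil => nil
  | k, v, sigma P => sigma (substV k v P)
  | k, v, pos P => pos (substV (k + 1) v P)
  | k, v, sens s P => sens s (substV (k + 1) v P)
  | k, v, act a e P => act a (e.subst k v) (substV k v P)
  | k, v, par P Q => par (substV k v P) (substV k v Q)
  | k, v, snd c e P Q => snd c (e.subst k v) (substV k v P) (substV k v Q)
  | k, v, rcv c P Q => rcv c (substV (k + 1) v P) (substV k v Q)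
  | k, v, cond g P Q => cond (g.subst k v) (substV k v P) (substV k v Q)
  | _, _, pvar i => pvar i
  | k, v, fix P => fix (substV k v P)

/-- Substitute (without capture) the process `R` for the process variable with index `k`. -/
def substP : ℕ → Proc W → Proc W → Proc W
  | _, _, nil => nil
  | k, R, sigma P => sigma (substP k R P)
  | k, R, pos P => pos (substP k (liftV 0 R) P)
  | k, R, sens s P => sens s (substP k (liftV 0 R) P)
  | k, R, act a e P => act a e (substP k R P)
  | k, R, par P Q => par (substP k R P) (substP k R Q)
  | k, R, snd c e P Q => snd c e (substP k R P) (substP k R Q)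
  | k, R, rcv c P Q => rcv c (substP k (liftV 0 R) P) (substP k R Q)
  | k, R, cond g P Q => cond g (substP k R P) (substP k R Q)
  | k, R, pvar i => if i < k then pvar i else if i = k then R else pvar (i - 1)
  | k, R, fix P => fix (substP (k + 1) (liftP 0 R) P)

/-- `P{v/x}`, where `x` is the outermost value variable. -/
def inst (P : Proc W) (v : W.V) : Proc W := substV 0 v P

/-- `P{fix X.P / X}`. -/
def unfold (P : Proc W) : Proc W := substP 0 (fix P) P

/-- Free value variables are below `n` and free process variables are below `m`. -/
def Scoped : ℕ → ℕ → Proc W → Prop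
  | _, _, nil => True
  | n, m, sigma P => Scoped n m P
  | n, m, pos P => Scoped (n + 1) m P
  | n, m, sens _ P => Scoped (n + 1) m P
  | n, m, act _ e P => e.Scoped n ∧ Scoped n m P
  | n, m, par P Q => Scoped n m P ∧ Scoped n m Q
  | n, m, snd _ e P Q => e.Scoped n ∧ Scoped n m P ∧ Scoped n m Q
  | n, m, rcv _ P Q => Scoped (n + 1) m P ∧ Scoped n m Q
  | n, m, cond g P Q => g.Scoped n ∧ Scoped n m P ∧ Scoped n m Q
  | _, m, pvar i => i < m
  | n, m, fix P => Scoped n (m + 1) P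

/-- Every occurrence of the process variable `k` is time-guarded: it lies inside `Q`
for some subterm `σ.Q` or `⌊π.P⌋Q`. -/
def VarGuarded : ℕ → Proc W → Prop
  | _, nil => True
  | _, sigma _ => True
  | k, pos P => VarGuarded k P
  | k, sens _ P => VarGuarded k P
  | k, act _ _ P => VarGuarded k P
  | k, par P Q => VarGuarded k P ∧ VarGuarded k Q
  | k, snd _ _ P _ => VarGuarded k P
  | k, rcv _ P _ => VarGuarded k P
  | k, cond _ P Q => VarGuarded k P ∧ VarGuarded k Q
  | k, pvar i => i ≠ k
  | k, fix P => VarGuarded (k + 1) P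

/-- All recursions are time-guarded. -/
def TimeGuarded : Proc W → Prop
  | nil => True
  | sigma P => TimeGuarded P
  | pos P => TimeGuarded P
  | sens _ P => TimeGuarded P
  | act _ _ P => TimeGuarded P
  | par P Q => TimeGuarded P ∧ TimeGuarded Q
  | snd _ _ P Q => TimeGuarded P ∧ TimeGuarded Q
  | rcv _ P Q => TimeGuarded P ∧ TimeGuarded Q
  | cond _ P Q => TimeGuarded P ∧ TimeGuarded Q
  | pvar _ => True
  | fix P => VarGuarded 0 P ∧ TimeGuarded P

/-- The process contains a prefix `s?(x)`. -/
def ReadsSens (s : Sens) : Proc W → Prop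
  | nil => False
  | sigma P => ReadsSens s P
  | pos P => ReadsSens s P
  | sens s' P => s' = s ∨ ReadsSens s P
  | act _ _ P => ReadsSens s P
  | par P Q => ReadsSens s P ∨ ReadsSens s Q
  | snd _ _ P Q => ReadsSens s P ∨ ReadsSens s Q
  | rcv _ P Q => ReadsSens s P ∨ ReadsSens s Q
  | cond _ P Q => ReadsSens s P ∨ ReadsSens s Q
  | pvar _ => False
  | fix P => ReadsSens s P

/-- The process contains a prefix `a!e`. -/
def WritesAct (a : Act) : Proc W → Prop
  | nil => False
  | sigma P => WritesAct a P
  | pos P => WritesAct a P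
  | sens _ P => WritesAct a P
  | act a' _ P => a' = a ∨ WritesAct a P
  | par P Q => WritesAct a P ∨ WritesAct a Q
  | snd _ _ P Q => WritesAct a P ∨ WritesAct a Q
  | rcv _ P Q => WritesAct a P ∨ WritesAct a Q
  | cond _ P Q => WritesAct a P ∨ WritesAct a Q
  | pvar _ => False
  | fix P => WritesAct a P

/-- The channel `c` occurs in the process. -/
def HasChan (c : Chan) : Proc W → Prop
  | nil => False
  | sigma P => HasChan c P
  | pos P => HasChan c P
  | sens _ P => HasChan c P
  | act _ _ P => HasChan c P
  | par P Q => HasChan c P ∨ HasChan c Q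
  | snd c' _ P Q => c' = c ∨ HasChan c P ∨ HasChan c Q
  | rcv c' P Q => c' = c ∨ HasChan c P ∨ HasChan c Q
  | cond _ P Q => HasChan c P ∨ HasChan c Q
  | pvar _ => False
  | fix P => HasChan c P

/-- Apply `f` to every channel. -/
def mapChan (f : Chan → Chan) : Proc W → Proc W
  | nil => nil
  | sigma P => sigma (mapChan f P)
  | pos P => pos (mapChan f P)
  | sens s P => sens s (mapChan f P)
  | act a e P => act a e (mapChan f P)
  | par P Q => par (mapChan f P) (mapChan f Q)
  | snd c e P Q => snd (f c) e (mapChan f P) (mapChan f Q)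
  | rcv c P Q => rcv (f c) (mapChan f P) (mapChan f Q)
  | cond g P Q => cond g (mapChan f P) (mapChan f Q)
  | pvar i => pvar i
  | fix P => fix (mapChan f P)

/-- Parallel composition of a list of processes. -/
def prod (l : List (Proc W)) : Proc W := l.foldr par nil

/-- `T` is a process of the form `⌊π.P⌋Q`. -/
def IsTimeout (T Q : Proc W) : Prop :=
  (∃ c e P, T = snd c e P Q) ∨ ∃ c P, T = rcv c P Q

/-- The persistent input `c(x).P`, an abbreviation for `fix Z.⌊c(x).P⌋Z`. -/
def input (c : Chan) (P : Proc W) : Proc W := fix (rcv c (liftP 0 P) (pvar 0))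

end Proc

/-- Physical interfaces: partial maps from sensors and actuators to values. -/
structure Iface (W : World) where
  sens : Sens → Option W.V
  act : Act → Option W.V

def Iface.setSens (I : Iface W) (s : Sens) (v : W.V) : Iface W :=
  ⟨Function.update I.sens s (some v), I.act⟩

def Iface.setAct (I : Iface W) (a : Act) (v : W.V) : Iface W :=
  ⟨I.sens, Function.update I.act a (some v)⟩

/-- Mobility tags. -/
inductive Mob where
  | stat
  | mob

/-- Devices `n[I ⋈ P]` with mobility tag `μ` and location `h`. -/
structure Dev (W : World) where
  name : NodeName
  I : Iface W
  P : Proc W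
  μ : Mob
  h : W.Loc

/-- Put the process `Q` in parallel with the process of the device. -/
def Dev.addPar (d : Dev W) (Q : Proc W) : Dev W := { d with P := .par d.P Q }

/-- Networks. -/
inductive Network (W : World) where
  | zero
  | node (d : Dev W)
  | par (M N : Network W)
  | res (c : Chan) (M : Network W)

namespace Network

/-- The devices of a network. -/
def devs : Network W → List (Dev W)
  | zero => []
  | node d => [d]
  | par M N => devs M ++ devs N
  | res _ M => devs M

/-- The channel `c` occurs free in the network. -/
def HasFreeChan (c : Chan) : Network W → Prop
  | zero => False
  | node d => d.P.HasChan c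
  | par M N => HasFreeChan c M ∨ HasFreeChan c N
  | res d M => c ≠ d ∧ HasFreeChan c M

/-- Apply `f` to every channel, whether free, bound or binding. -/
def mapChan (f : Chan → Chan) : Network W → Network W
  | zero => zero
  | node d => node { d with P := d.P.mapChan f }
  | par M N => par (mapChan f M) (mapChan f N)
  | res c M => res (f c) (mapChan f M)

/-- Parallel composition of a list of devices. -/
def prod (l : List (Dev W)) : Network W := l.foldr (fun d M => par (node d) M) zero

/-- `(ν c₁)…(ν cₖ) M`. -/
def resList (cs : List Chan) (M : Network W) : Network W := cs.foldr res M

/-- Well-formed networks. -/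
structure WellFormed (M : Network W) : Prop where
  names : (M.devs.map Dev.name).Nodup
  acts : M.devs.Pairwise fun d e => ∀ a, d.I.act a = none ∨ e.I.act a = none
  nodeSens : M.devs.Pairwise fun d e =>
    ∀ s : Sens, s.locDep = false → d.I.sens s = none ∨ e.I.sens s = none
  reads : ∀ d ∈ M.devs, ∀ s, d.P.ReadsSens s → d.I.sens s ≠ none
  writes : ∀ d ∈ M.devs, ∀ a, d.P.WritesAct a → d.I.act a ≠ none
  locSens : ∀ d ∈ M.devs, ∀ s : Sens, s.locDep = true → d.I.sens s ≠ none → d.μ = .stat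

/-- The terms that the theory deals with: well-formed closed networks in which recursion
is time-guarded. -/
structure Ok (M : Network W) : Prop where
  wf : M.WellFormed
  closed : ∀ d ∈ M.devs, d.P.Scoped 0 0
  guarded : ∀ d ∈ M.devs, d.P.TimeGuarded

open Classical in
/-- `M[s@h ↦ v]`, the update by the environment of the sensor `s` at location `h`. -/
noncomputable def sensUpd (s : Sens) (h : W.Loc) (v : W.V) : Network W → Network W
  | zero => zero
  | node d => if d.h = h ∧ d.I.sens s ≠ none then node { d with I := d.I.setSens s v } else node d
  | par M N => par (sensUpd s h v M) (sensUpd s h v N)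
  | res c M => res c (sensUpd s h v M)

end Network

/-! ### Structural congruence -/

/-- Structural congruence of processes. -/
inductive PCong : Proc W → Proc W → Prop
  | refl P : PCong P P
  | symm {P Q} : PCong P Q → PCong Q P
  | trans {P Q R} : PCong P Q → PCong Q R → PCong P R
  | parNil P : PCong (.par P .nil) P
  | parComm P Q : PCong (.par P Q) (.par Q P)
  | parAssoc P Q R : PCong (.par (.par P Q) R) (.par P (.par Q R))
  | condTrue {g : Guard W} {P Q} : g.Eval true → PCong (.cond g P Q) P
  | condFalse {g : Guard W} {P Q} : g.Eval false → PCong (.cond g P Q) Q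
  | unfold P : PCong (.fix P) P.unfold
  | sigma {P P'} : PCong P P' → PCong (.sigma P) (.sigma P')
  | pos {P P'} : PCong P P' → PCong (.pos P) (.pos P')
  | sens s {P P'} : PCong P P' → PCong (.sens s P) (.sens s P')
  | act a e {P P'} : PCong P P' → PCong (.act a e P) (.act a e P')
  | par {P P' Q Q'} : PCong P P' → PCong Q Q' → PCong (.par P Q) (.par P' Q')
  | snd c e {P P' Q Q'} : PCong P P' → PCong Q Q' → PCong (.snd c e P Q) (.snd c e P' Q')
  | rcv c {P P' Q Q'} : PCong P P' → PCong Q Q' → PCong (.rcv c P Q) (.rcv c P' Q')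
  | cond g {P P' Q Q'} : PCong P P' → PCong Q Q' → PCong (.cond g P Q) (.cond g P' Q')
  | fix {P P'} : PCong P P' → PCong (.fix P) (.fix P')

open Classical in
/-- Structural congruence of networks. The clause `alpha` is the renaming of a bound channel
to a channel of the same range. -/
inductive NCong : Network W → Network W → Prop
  | refl M : NCong M M
  | symm {M N} : NCong M N → NCong N M
  | trans {M N O} : NCong M N → NCong N O → NCong M O
  | node n I {P Q} μ h : PCong P Q → NCong (.node ⟨n, I, P, μ, h⟩) (.node ⟨n, I, Q, μ, h⟩)
  | parZero M : NCong (.par M .zero) M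
  | parComm M N : NCong (.par M N) (.par N M)
  | parAssoc M N O : NCong (.par (.par M N) O) (.par M (.par N O))
  | resZero c : NCong (.res c .zero) .zero
  | resSwap c d M : NCong (.res c (.res d M)) (.res d (.res c M))
  | resPar {c M N} : ¬ M.HasFreeChan c → NCong (.res c (.par M N)) (.par M (.res c N))
  | alpha {c d M} : d.rng = c.rng → ¬ M.HasFreeChan d →
      NCong (.res c M) (.res d (M.mapChan (Equiv.swap c d)))
  | par {M M' N N'} : NCong M M' → NCong N N' → NCong (.par M N) (.par M' N')
  | res c {M M'} : NCong M M' → NCong (.res c M) (.res c M')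

/-! ### Reduction semantics -/

/-- Labels of instantaneous reductions: `τ`, or the actuator that is changed. -/
inductive RLabel where
  | tau
  | act (a : Act)

/-- Instantaneous reductions. -/
inductive RedInst : RLabel → Network W → Network W → Prop
  | pos n I P μ h :
      RedInst .tau (.node ⟨n, I, .pos P, μ, h⟩) (.node ⟨n, I, P.inst (.loc h), μ, h⟩)
  | sensread n I s P μ h {v} : I.sens s = some v →
      RedInst .tau (.node ⟨n, I, .sens s P, μ, h⟩) (.node ⟨n, I, P.inst v, μ, h⟩)
  | actunchg n I a P μ h {v} : I.act a = some v →
      RedInst .tau (.node ⟨n, I, .act a (.val v) P, μ, h⟩) (.node ⟨n, I, P, μ, h⟩)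
  | actchg n I a P μ h {v w} : I.act a = some w → w ≠ v →
      RedInst (.act a) (.node ⟨n, I, .act a (.val v) P, μ, h⟩) (.node ⟨n, I.setAct a v, P, μ, h⟩)
  | loccom n I c v P R Q S μ h : c.rng = .intra →
      RedInst .tau (.node ⟨n, I, .par (.snd c (.val v) P R) (.rcv c Q S), μ, h⟩)
        (.node ⟨n, I, .par P (Q.inst v), μ, h⟩)
  | glbcom n m I J c v P R Q S μ₁ μ₂ h k : c.rng.Covers (W.dist h k) →
      RedInst .tau
        (.par (.node ⟨n, I, .snd c (.val v) P R, μ₁, h⟩) (.node ⟨m, J, .rcv c Q S, μ₂, k⟩))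
        (.par (.node ⟨n, I, P, μ₁, h⟩) (.node ⟨m, J, Q.inst v, μ₂, k⟩))
  | parP {ω} (l : List (Dev W × Dev W × Proc W)) : (∀ t ∈ l, t.1.name = t.2.1.name) →
      RedInst ω (.prod (l.map fun t => t.1)) (.prod (l.map fun t => t.2.1)) →
      RedInst ω (.prod (l.map fun t => t.1.addPar t.2.2)) (.prod (l.map fun t => t.2.1.addPar t.2.2))
  | parN {ω M M'} N : RedInst ω M M' → RedInst ω (.par M N) (.par M' N)
  | res {ω M M'} c : RedInst ω M M' → RedInst ω (.res c M) (.res c M')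
  | struct {ω M N N' M'} : NCong M N → RedInst ω N N' → NCong N' M' → RedInst ω M M'

/-- Timed reductions. In the first two rules the process is
`∏ᵢ ⌊πᵢ.Pᵢ⌋Qᵢ | ∏ⱼ σ.Rⱼ`, where `ts` lists the pairs `(⌊πᵢ.Pᵢ⌋Qᵢ, Qᵢ)`. -/
inductive RedTime : Network W → Network W → Prop
  | timestat n I (ts : List (Proc W × Proc W)) (rs : List (Proc W)) h :
      (∀ t ∈ ts, Proc.IsTimeout t.1 t.2) →
      (∀ M', ¬ RedInst .tau (.node ⟨n, I, .par (.prod (ts.map fun t => t.1))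
        (.prod (rs.map .sigma)), .stat, h⟩) M') →
      RedTime (.node ⟨n, I, .par (.prod (ts.map fun t => t.1)) (.prod (rs.map .sigma)), .stat, h⟩)
        (.node ⟨n, I, .par (.prod (ts.map fun t => t.2)) (.prod rs), .stat, h⟩)
  | timemob n I (ts : List (Proc W × Proc W)) (rs : List (Proc W)) h k :
      (∀ t ∈ ts, Proc.IsTimeout t.1 t.2) →
      (∀ M', ¬ RedInst .tau (.node ⟨n, I, .par (.prod (ts.map fun t => t.1))
        (.prod (rs.map .sigma)), .mob, h⟩) M') →
      W.dist h k ≤ W.δ →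
      RedTime (.node ⟨n, I, .par (.prod (ts.map fun t => t.1)) (.prod (rs.map .sigma)), .mob, h⟩)
        (.node ⟨n, I, .par (.prod (ts.map fun t => t.2)) (.prod rs), .mob, k⟩)
  | timepar {M M' N N'} : RedTime M M' → RedTime N N' → (∀ O, ¬ RedInst .tau (.par M N) O) →
      RedTime (.par M N) (.par M' N')
  | timezero : RedTime .zero .zero
  | res {M M'} c : RedTime M M' → RedTime (.res c M) (.res c M')
  | struct {M N N' M'} : NCong M N → RedTime N N' → NCong N' M' → RedTime M M'

/-- The reduction `M ⟶ M'` (of kind `τ` or `σ`) to a well-formed network. -/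
def Red (M M' : Network W) : Prop := M'.Ok ∧ (RedInst .tau M M' ∨ RedTime M M')

/-- The reduction `M ⟶ₐ M'`, changing the actuator `a`, to a well-formed network. -/
def RedAct (a : Act) (M M' : Network W) : Prop := M'.Ok ∧ RedInst (.act a) M M'

/-- `M ⟶* M'`. -/
def Reds : Network W → Network W → Prop := Relation.ReflTransGen Red

/-! ### Reduction barbed congruence -/

/-- The barb of `M` at `a@h!v`: the value `v` appears on the actuator `a` at location `h`. -/
def Barb (M : Network W) (a : Act) (h : W.Loc) (v : W.V) : Prop :=
  ∃ gs n I P μ M', NCong M (.resList gs (.par (.node ⟨n, I, P, μ, h⟩) M')) ∧ I.act a = some v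

def WeakBarb (M : Network W) (a : Act) (h : W.Loc) (v : W.V) : Prop :=
  ∃ M', Reds M M' ∧ Barb M' a h v

/-- A relation between networks, all of them well-formed. -/
def OverNetworks (R : Network W → Network W → Prop) : Prop := ∀ M N, R M N → M.Ok ∧ N.Ok

def SymmRel (R : Network W → Network W → Prop) : Prop := ∀ M N, R M N → R N M

def BarbPreserving (R : Network W → Network W → Prop) : Prop :=
  ∀ M N, R M N → ∀ a h v, Barb M a h v → WeakBarb N a h v

def ReductionClosed (R : Network W → Network W → Prop) : Prop :=
  ∀ M N, R M N →
    (∀ M', Red M M' → ∃ N', Reds N N' ∧ R M' N') ∧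
    ∀ a M', RedAct a M M' → ∃ N₁ N₂ N', Reds N N₁ ∧ RedAct a N₁ N₂ ∧ Reds N₂ N' ∧ R M' N'

def Contextual (R : Network W → Network W → Prop) : Prop :=
  ∀ M N, R M N →
    (∀ O : Network W, (Network.par M O).Ok → (Network.par N O).Ok → R (.par M O) (.par N O)) ∧
    (∀ c, R (.res c M) (.res c N)) ∧
    ∀ s h, ∀ v ∈ W.dom s, R (M.sensUpd s h v) (N.sensUpd s h v)

/-- Reduction barbed congruence: the union of all symmetric, reduction closed, barb preserving
and contextual relations over networks. -/
def BarbedCongruent (M N : Network W) : Prop :=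
  ∃ R : Network W → Network W → Prop, OverNetworks R ∧ SymmRel R ∧ ReductionClosed R ∧
    BarbPreserving R ∧ Contextual R ∧ R M N

/-! ### Intensional labelled semantics -/

/-- Labels of the untimed transitions of processes. -/
inductive PLabel (W : World) where
  | tau
  | snd (c : Chan) (v : W.V)
  | rcv (c : Chan) (v : W.V)
  | pos (h : W.Loc)
  | sens (s : Sens) (v : W.V)
  | act (a : Act) (v : W.V)

/-- Untimed transitions of processes. -/
inductive PStep : Proc W → PLabel W → Proc W → Prop
  | snd c v P Q : PStep (.snd c (.val v) P Q) (.snd c v) P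
  | rcv c v P Q : PStep (.rcv c P Q) (.rcv c v) (P.inst v)
  | sens s v P : PStep (.sens s P) (.sens s v) (P.inst v)
  | act a v P : PStep (.act a (.val v) P) (.act a v) P
  | pos h P : PStep (.pos P) (.pos h) (P.inst (.loc h))
  | comL {c v P P' Q Q'} : PStep P (.snd c v) P' → PStep Q (.rcv c v) Q' → c.rng = .intra →
      PStep (.par P Q) .tau (.par P' Q')
  | comR {c v P P' Q Q'} : PStep P (.rcv c v) P' → PStep Q (.snd c v) Q' → c.rng = .intra →
      PStep (.par P Q) .tau (.par P' Q')
  | parL {l P P'} Q : PStep P l P' → PStep (.par P Q) l (.par P' Q)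
  | parR {l Q Q'} P : PStep Q l Q' → PStep (.par P Q) l (.par P Q')
  | fix {l P Q} : PStep P.unfold l Q → PStep (.fix P) l Q
  | condTrue {l g P Q R} : g.Eval true → PStep P l R → PStep (.cond g P Q) l R
  | condFalse {l g P Q R} : g.Eval false → PStep Q l R → PStep (.cond g P Q) l R

/-- Timed transitions of processes. -/
inductive PTime : Proc W → Proc W → Prop
  | nil : PTime .nil .nil
  | delay P : PTime (.sigma P) P
  | timeoutSnd c e P Q : PTime (.snd c e P Q) Q
  | timeoutRcv c P Q : PTime (.rcv c P Q) Q
  | par {P P' Q Q'} : PTime P P' → PTime Q Q' → (∀ R, ¬ PStep (.par P Q) .tau R) →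
      PTime (.par P Q) (.par P' Q')
  | fix {P Q} : PTime P.unfold Q → PTime (.fix P) Q
  | condTrue {g P Q R} : g.Eval true → PTime P R → PTime (.cond g P Q) R
  | condFalse {g P Q R} : g.Eval false → PTime Q R → PTime (.cond g P Q) R

/-- Labels of the untimed transitions of networks. -/
inductive NLabel (W : World) where
  | tau
  | act (a : Act)
  | snd (c : Chan) (v : W.V) (h : W.Loc)
  | rcv (c : Chan) (v : W.V) (h : W.Loc)

/-- The label is a transmission or a reception along the channel `c`. -/
def NLabel.IsOn (c : Chan) : NLabel W → Prop
  | .tau => False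
  | .act _ => False
  | .snd d _ _ => d = c
  | .rcv d _ _ => d = c

/-- Untimed transitions of networks. -/
inductive NStep : Network W → NLabel W → Network W → Prop
  | pos {n I P P' μ h} : PStep P (.pos h) P' →
      NStep (.node ⟨n, I, P, μ, h⟩) .tau (.node ⟨n, I, P', μ, h⟩)
  | sensRead {n I P P' μ h s v} : I.sens s = some v → PStep P (.sens s v) P' →
      NStep (.node ⟨n, I, P, μ, h⟩) .tau (.node ⟨n, I, P', μ, h⟩)
  | actUnChg {n I P P' μ h a v} : I.act a = some v → PStep P (.act a v) P' →
      NStep (.node ⟨n, I, P, μ, h⟩) .tau (.node ⟨n, I, P', μ, h⟩)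
  | actChg {n I P P' μ h a v w} : I.act a = some w → w ≠ v → PStep P (.act a v) P' →
      NStep (.node ⟨n, I, P, μ, h⟩) (.act a) (.node ⟨n, I.setAct a v, P', μ, h⟩)
  | locCom {n I P P' μ h} : PStep P .tau P' →
      NStep (.node ⟨n, I, P, μ, h⟩) .tau (.node ⟨n, I, P', μ, h⟩)
  | snd {n I P P' μ h c v} : PStep P (.snd c v) P' → c.rng ≠ .intra →
      NStep (.node ⟨n, I, P, μ, h⟩) (.snd c v h) (.node ⟨n, I, P', μ, h⟩)
  | rcv {n I P P' μ h c v} : PStep P (.rcv c v) P' → c.rng ≠ .intra →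
      NStep (.node ⟨n, I, P, μ, h⟩) (.rcv c v h) (.node ⟨n, I, P', μ, h⟩)
  | glbComL {M M' N N' c v h k} : NStep M (.snd c v k) M' → NStep N (.rcv c v h) N' →
      c.rng.Covers (W.dist h k) → NStep (.par M N) .tau (.par M' N')
  | glbComR {M M' N N' c v h k} : NStep M (.rcv c v h) M' → NStep N (.snd c v k) N' →
      c.rng.Covers (W.dist h k) → NStep (.par M N) .tau (.par M' N')
  | parL {l M M'} N : NStep M l M' → NStep (.par M N) l (.par M' N)
  | parR {l N N'} M : NStep N l N' → NStep (.par M N) l (.par M N')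
  | res {l M M' c} : NStep M l M' → ¬ l.IsOn c → NStep (.res c M) l (.res c M')

/-- Timed transitions of networks. -/
inductive NTime : Network W → Network W → Prop
  | stat {n I P P' h} : PTime P P' → (∀ M', ¬ NStep (.node ⟨n, I, P, .stat, h⟩) .tau M') →
      NTime (.node ⟨n, I, P, .stat, h⟩) (.node ⟨n, I, P', .stat, h⟩)
  | mob {n I P P' h k} : PTime P P' → (∀ M', ¬ NStep (.node ⟨n, I, P, .mob, h⟩) .tau M') →
      W.dist h k ≤ W.δ → NTime (.node ⟨n, I, P, .mob, h⟩) (.node ⟨n, I, P', .mob, k⟩)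
  | par {M M' N N'} : NTime M M' → NTime N N' → (∀ O, ¬ NStep (.par M N) .tau O) →
      NTime (.par M N) (.par M' N')
  | zero : NTime .zero .zero
  | res {M M'} c : NTime M M' → NTime (.res c M) (.res c M')

/-! ### Extensional semantics and bisimilarity -/

/-- Extensional actions. -/
inductive ELabel (W : World) where
  | tau
  | sigma
  | act (a : Act)
  | sndObs (c : Chan) (v : W.V) (k : W.Loc)
  | rcvObs (c : Chan) (v : W.V) (k : W.Loc)
  | sensEnv (s : Sens) (h : W.Loc) (v : W.V)
  | actEnv (a : Act) (h : W.Loc) (v : W.V)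

/-- Extensional transitions. -/
inductive EStep : Network W → ELabel W → Network W → Prop
  | tau {M M'} : NStep M .tau M' → EStep M .tau M'
  | sigma {M M'} : NTime M M' → EStep M .sigma M'
  | act {M M' a} : NStep M (.act a) M' → EStep M (.act a) M'
  | sndObs {M M' c v h k} : NStep M (.snd c v h) M' → c.rng.Covers (W.dist h k) →
      EStep M (.sndObs c v k) M'
  | rcvObs {M M' c v h k} : NStep M (.rcv c v h) M' → c.rng.Covers (W.dist k h) →
      EStep M (.rcvObs c v k) M'
  | sensEnv M {s h v} : v ∈ W.dom s → EStep M (.sensEnv s h v) (M.sensUpd s h v)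
  | actEnv {M a h v} : Barb M a h v → EStep M (.actEnv a h v) M

/-- The reflexive and transitive closure of the `τ`-transitions. -/
def WeakTau : Network W → Network W → Prop := Relation.ReflTransGen fun M M' => EStep M .tau M'

/-- The weak transition of a network that matches the action `α`: a sequence of
`τ`-transitions if `α = τ`, and `α` preceded and followed by `τ`-transitions otherwise. -/
def WeakStep (M : Network W) (α : ELabel W) (M' : Network W) : Prop :=
  (α = .tau ∧ WeakTau M M') ∨
    (α ≠ .tau ∧ ∃ M₁ M₂, WeakTau M M₁ ∧ EStep M₁ α M₂ ∧ WeakTau M₂ M')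

/-- Bisimulations over networks. -/
def IsBisimulation (R : Network W → Network W → Prop) : Prop :=
  OverNetworks R ∧ SymmRel R ∧
    ∀ M N, R M N → ∀ α M', EStep M α M' → ∃ N', WeakStep N α N' ∧ R M' N'

/-- Weak bisimilarity. -/
def Bisimilar (M N : Network W) : Prop :=
  ∃ R : Network W → Network W → Prop, IsBisimulation R ∧ R M N

/-! ### The smart home -/

/-- The names, the geometry and the threshold of the smart home. Range is an attribute of a
channel, so the restricted channels called `c₁, c₂` are two different pairs of channels in the two
systems: `c₁, c₂` in the proximity-based one, `d₁, d₂` in the GPS-based one. -/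
structure SmartHome (W : World) where
  /-- the phone, the two light managers, the boiler manager, the centralised light manager -/
  (nP n₁ n₂ nB nLM : NodeName)
  nodes_distinct : [nP, n₁, n₂, nB, nLM].Nodup
  (light₁ light₂ boiler : Act)
  acts_distinct : [light₁, light₂, boiler].Nodup
  (mode temp : Sens)
  mode_nodeDep : mode.locDep = false
  temp_locDep : temp.locDep = true
  dom_mode : W.dom mode = {.man, .auto}
  dom_temp : W.dom temp = Set.range fun n : ℕ => .int n
  (b g c₁ c₂ d₁ d₂ : Chan)
  b_ne_g : b ≠ g
  c₁_ne_c₂ : c₁ ≠ c₂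
  rng_b : b.rng = .internet
  rng_g : g.rng = .internet
  rng_c₁ : c₁.rng = .short 0
  rng_c₂ : c₂.rng = .short 0
  rng_d₁ : d₁.rng = .short 2
  rng_d₂ : d₂.rng = .short 1
  /-- the locations `loc 1, …, loc 4` of the house -/
  loc : ℕ → W.Loc
  out : W.Loc
  dist_loc : ∀ i ∈ Finset.Icc 1 4, ∀ j ∈ Finset.Icc 1 4,
    (W.dist (loc i) (loc j) : ℤ) = |(i : ℤ) - (j : ℤ)|
  dist_outside : ∀ l, (∀ j ∈ Finset.Icc 1 4, l ≠ loc j) →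
    ∀ i ∈ Finset.Icc 1 4, i ≤ W.dist l (loc i)
  out_outside : ∀ j ∈ Finset.Icc 1 4, out ≠ loc j
  Θ : ℕ

open Classical in
/-- The guard `e = v`. -/
noncomputable def eqGuard (e : Exp W) (v : W.V) : Guard W := ⟨[e], fun vs => decide (vs = [v])⟩

/-- The test `v < Θ` on integers. -/
def belowTest (Θ : ℕ) : List W.V → Bool
  | [.int z] => decide (z < Θ)
  | _ => false

/-- The guard `e < Θ`. -/
def ltGuard (e : Exp W) (Θ : ℕ) : Guard W := ⟨[e], belowTest Θ⟩

namespace SmartHome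

variable (H : SmartHome W)

def IP : Iface W := ⟨fun s => if s = H.mode then some .auto else none, fun _ => none⟩
def I₁ : Iface W := ⟨fun _ => none, fun a => if a = H.light₁ then some .off else none⟩
def I₂ : Iface W := ⟨fun _ => none, fun a => if a = H.light₂ then some .off else none⟩
def IB : Iface W := ⟨fun s => if s = H.temp then some (.int H.Θ) else none,
  fun a => if a = H.boiler then some .off else none⟩

/-- `fix X. mode?(z).⌊b⟨z⟩.σ.X⌋X` -/
def boilerCtrl : Proc W := .fix (.sens H.mode (.snd H.b (.var 0) (.sigma (.pvar 0)) (.pvar 0)))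

/-- `fix X. ⌊c⟨⟩.σ.X⌋X` -/
def lightCtrlOn (c : Chan) : Proc W := .fix (.snd c (.val .unit) (.sigma (.pvar 0)) (.pvar 0))

def lightCtrl : Proc W := .par (lightCtrlOn H.c₁) (lightCtrlOn H.c₂)

/-- `fix X. ⌊c().light!on.σ.X⌋ light!off.X` -/
def lightProc (c : Chan) (light : Act) : Proc W :=
  .fix (.rcv c (.act light (.val .on) (.sigma (.pvar 0))) (.act light (.val .off) (.pvar 0)))

/-- `temp?(t).[t < Θ] boiler!on.σ.X ; boiler!off.σ.X`, with `X` the process variable 0 -/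
def tempCtrl : Proc W :=
  .sens H.temp (.cond (ltGuard (.var 0) H.Θ)
    (.act H.boiler (.val .on) (.sigma (.pvar 0)))
    (.act H.boiler (.val .off) (.sigma (.pvar 0))))

/-- `fix Y. b(y).[y = auto] X ; σ.Y`, with `X` the process variable 0 (and 1 below `fix Y`) -/
noncomputable def manual : Proc W :=
  .fix (.input H.b (.cond (eqGuard (.var 0) .auto) (.pvar 1) (.sigma (.pvar 0))))

/-- `fix X. ⌊b(x).[x = man] boiler!on.σ.Manual ; TempCtrl⌋ TempCtrl` -/
noncomputable def auto : Proc W :=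
  .fix (.rcv H.b (.cond (eqGuard (.var 0) .man)
    (.act H.boiler (.val .on) (.sigma H.manual)) H.tempCtrl) H.tempCtrl)

def phone : Network W := .node ⟨H.nP, H.IP, .par H.boilerCtrl H.lightCtrl, .mob, H.out⟩

def lightMng₁ (c : Chan) : Network W :=
  .node ⟨H.n₁, H.I₁, lightProc c H.light₁, .stat, H.loc 1⟩

def lightMng₂ (c : Chan) : Network W :=
  .node ⟨H.n₂, H.I₂, lightProc c H.light₂, .stat, H.loc 4⟩

noncomputable def boilerMng : Network W := .node ⟨H.nB, H.IB, H.auto, .stat, H.loc 2⟩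

/-- The smart home, with its lights controlled through the channels `c` and `c'`. -/
noncomputable def home (c c' : Chan) : Network W :=
  .par (.par (H.lightMng₁ c) (H.lightMng₂ c')) H.boilerMng

/-- The proximity-based system `Sys`. -/
noncomputable def sys : Network W := .par H.phone (H.home H.c₁ H.c₂)

/-- `fix X. @(x).⌊g⟨x⟩.σ.X⌋X` -/
def lightCtrlGPS : Proc W :=
  .fix (.pos (.snd H.g (.var 0) (.sigma (.pvar 0)) (.pvar 0)))

def phoneGPS : Network W := .node ⟨H.nP, H.IP, .par H.boilerCtrl H.lightCtrlGPS, .mob, H.out⟩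

/-- `fix X. ⌊g(y).[y = loc1]⌊d₁⟨⟩.σ.X⌋X ; [y = loc4]⌊d₂⟨⟩.σ.X⌋X ; σ.X⌋ X` -/
noncomputable def clm : Proc W :=
  .fix (.rcv H.g
    (.cond (eqGuard (.var 0) (.loc (H.loc 1)))
      (.snd H.d₁ (.val .unit) (.sigma (.pvar 0)) (.pvar 0))
      (.cond (eqGuard (.var 0) (.loc (H.loc 4)))
        (.snd H.d₂ (.val .unit) (.sigma (.pvar 0)) (.pvar 0))
        (.sigma (.pvar 0))))
    (.pvar 0))

noncomputable def clightMng : Network W :=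
  .node ⟨H.nLM, ⟨fun _ => none, fun _ => none⟩, H.clm, .stat, H.loc 3⟩

/-- The GPS-based system. -/
noncomputable def sysGPS : Network W := .par H.phoneGPS (.par (H.home H.d₁ H.d₂) H.clightMng)

end SmartHome

end IoT

/-! ### Structural congruence of processes as a strong bisimulation -/

namespace IoT

variable {W : World}

/-! ### Substitution calculus -/

/-! Within one time slot both homes do the same thing. In the proximity system the phone reaches a
light manager exactly when it is in the manager's room, because range 0 means equality of locations.
In the GPS system the same information makes a detour: position detection, a message on `g` to the
central manager at `loc 3`, and a message on `d₁` or `d₂`, whose ranges 2 and 1 are the distances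
from `loc 3` to `loc 1` and `loc 4`. The detour consists of τ-steps on private channels, and since
time passes only when no τ-step is possible, the phone cannot move before the detour has run its
course.

Hence the same data, a `HomeState`, describe both systems; the GPS system carries in addition a
`Phase` that records how far the detour has come. The invariant `Sync` says that a manager that has
detected the phone in the current slot shares its room. The two rooms differ, so at most one manager
has done so, and a single boolean records whether the central manager has already sent its message.
The transitions of both systems are listed completely (`nstep_prox`, `nstep_gpsNet`, `ntime_prox`,
`ntime_gpsNet`). A detection in the proximity system is matched by finishing the detour, and a step
of the detour before the detection is matched by no step at all. Time agrees because, once the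
detour has reached its last phase, one system has a τ-step if and only if the other has
(`Sync.no_tau_iff`). The boiler control of the phone is treated as an arbitrary process that avoids
the private channels, and the boiler manager, which only uses `b`, is moved out of the restrictions
and treated as a context.

Both conclusions follow from one finer relation, `IntBisim`: a weak bisimilarity on the intensional
labels that matches actuator values immediately and is closed under sensor updates. It is a
congruence for parallel composition and restriction (`IntBisim.par`, `IntBisim.res`). It implies
bisimilarity because extensional actions are read off from intensional ones. It implies barbed
congruence once reductions and transitions are known to agree up to structural congruence
(`RedInst.nstep`, `NStep.redInst`, `RedTime.ntime`, `NTime.redTime`).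

That agreement rests on structural congruence being a strong bisimulation for all transitions
(`PCong.step`, `PCong.time`, `NCong.stepSim`, `NCong.timeSim`). The delicate point is the reduction
rule `parP`, which adds processes to the nodes on both sides of a reduction: the congruences used
inside that reduction may bind channels that occur in the added processes. The relation `AddRen`
repairs this by renaming bound channels along the whole derivation. -/

theorem Exp.subst_lift_comm {j k : ℕ} (h : j ≤ k) (v : W.V) (e : Exp W) :
    (e.lift j).subst (k + 1) v = (e.subst k v).lift j := by
  cases e with
  | val => rfl
  | var i =>
    simp only [Exp.lift, Exp.subst]
    split_ifs <;> (try simp only) <;> (try split_ifs) <;>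
      first | rfl | omega | (congr 1; omega)

theorem Exp.lift_lift {j k : ℕ} (h : j ≤ k) (e : Exp W) :
    (e.lift j).lift (k + 1) = (e.lift k).lift j := by
  cases e with
  | val => rfl
  | var i => simp only [Exp.lift, Exp.var.injEq]; split_ifs <;> omega

theorem Guard.subst_lift_comm {j k : ℕ} (h : j ≤ k) (v : W.V) (g : Guard W) :
    (g.lift j).subst (k + 1) v = (g.subst k v).lift j := by
  simp [Guard.lift, Guard.subst, Function.comp_def, Exp.subst_lift_comm h]

theorem Guard.lift_lift {j k : ℕ} (h : j ≤ k) (g : Guard W) :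
    (g.lift j).lift (k + 1) = (g.lift k).lift j := by
  simp [Guard.lift, Function.comp_def, Exp.lift_lift h]

theorem Guard.Eval.subst {g : Guard W} {b : Bool} (h : g.Eval b) (k : ℕ) (v : W.V) :
    (g.subst k v).Eval b := by
  obtain ⟨vs, h1, h2⟩ := h
  exact ⟨vs, by simp [Guard.subst, h1, Function.comp_def, Exp.subst], h2⟩

theorem Guard.Eval.lift {g : Guard W} {b : Bool} (h : g.Eval b) (k : ℕ) : (g.lift k).Eval b := by
  obtain ⟨vs, h1, h2⟩ := h
  exact ⟨vs, by simp [Guard.lift, h1, Function.comp_def, Exp.lift], h2⟩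

theorem Guard.Eval.unique {g : Guard W} {b b' : Bool} (h : g.Eval b) (h' : g.Eval b') : b = b' := by
  obtain ⟨vs, h1, h2⟩ := h
  obtain ⟨ws, h3, h4⟩ := h'
  have : vs = ws := List.map_injective_iff.2 (fun a b h => by cases h; rfl) (h1.symm.trans h3)
  rw [← h2, ← h4, this]

namespace Proc

theorem substV_liftV_comm {j k : ℕ} (h : j ≤ k) (v : W.V) (P : Proc W) :
    substV (k + 1) v (liftV j P) = liftV j (substV k v P) := by
  induction P generalizing j k <;>
    simp_all [substV, liftV, Exp.subst_lift_comm, Guard.subst_lift_comm]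

theorem liftV_liftV {j k : ℕ} (h : j ≤ k) (P : Proc W) :
    liftV (k + 1) (liftV j P) = liftV j (liftV k P) := by
  induction P generalizing j k <;> simp_all [liftV, Exp.lift_lift, Guard.lift_lift]

theorem liftV_liftP (j k : ℕ) (P : Proc W) : liftV j (liftP k P) = liftP k (liftV j P) := by
  induction P generalizing j k <;> simp_all [liftV, liftP]

theorem substV_liftP (j k : ℕ) (v : W.V) (P : Proc W) :
    substV j v (liftP k P) = liftP k (substV j v P) := by
  induction P generalizing j k <;> simp_all [substV, liftP]

theorem liftP_liftP {j k : ℕ} (h : j ≤ k) (P : Proc W) :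
    liftP (k + 1) (liftP j P) = liftP j (liftP k P) := by
  induction P generalizing j k <;> simp_all [liftP]
  split_ifs <;> omega

theorem substP_liftP (k : ℕ) (R P : Proc W) : substP k R (liftP k P) = P := by
  induction P generalizing k R <;> simp_all [substP, liftP]
  split_ifs <;> first | rfl | omega

theorem substV_substP (k j : ℕ) (v : W.V) (R P : Proc W) :
    substV k v (substP j R P) = substP j (substV k v R) (substV k v P) := by
  induction P generalizing k j R <;>
    simp_all [substV, substP, substV_liftV_comm, substV_liftP]
  split_ifs <;> rfl

theorem liftV_substP (k j : ℕ) (R P : Proc W) :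
    liftV k (substP j R P) = substP j (liftV k R) (liftV k P) := by
  induction P generalizing k j R <;>
    simp_all [liftV, substP, liftV_liftV, liftV_liftP]
  split_ifs <;> rfl

theorem liftP_substP {j k : ℕ} (h : j ≤ k) (R P : Proc W) :
    liftP k (substP j R P) = substP j (liftP k R) (liftP (k + 1) P) := by
  induction P generalizing k j R <;>
    simp_all [liftP, substP, liftV_liftP, liftP_liftP]
  split_ifs <;> (try simp only [liftP]) <;> (try split_ifs) <;>
    first | rfl | omega | (congr 1; omega)

theorem liftP_substP' {j k : ℕ} (h : j ≤ k) (R P : Proc W) :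
    liftP j (substP k R P) = substP (k + 1) (liftP j R) (liftP j P) := by
  induction P generalizing k j R <;>
    simp_all [liftP, substP, liftV_liftP, liftP_liftP]
  split_ifs <;> (try simp only [liftP]) <;> (try split_ifs) <;>
    first | rfl | omega | (congr 1; omega)

/-- The substitution lemma. On the right the substitution of `R` acts on `P` first, while the
variable `j` is still present; hence the index `k + 1` and the lifted `R`. -/
theorem substP_substP {j k : ℕ} (h : j ≤ k) (R S P : Proc W) :
    substP k R (substP j S P) = substP j (substP k R S) (substP (k + 1) (liftP j R) P) := by
  induction P generalizing k j R S <;>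
    simp_all [substP, liftV_substP, liftV_liftP, liftP_substP', liftP_liftP]
  split_ifs <;> (try simp only [substP]) <;> (try split_ifs) <;>
    first | rfl | omega | exact (substP_liftP _ _ _).symm

/-- Unfolding a recursion commutes with the four operations on terms. These identities carry the
recursion rules through the closure lemmas for `PConv`. -/
theorem unfold_substV (k : ℕ) (v : W.V) (P : Proc W) :
    substV k v P.unfold = (substV k v P).unfold := by simp [unfold, substV_substP, substV]

theorem unfold_liftV (k : ℕ) (P : Proc W) : liftV k P.unfold = (liftV k P).unfold := by
  simp [unfold, liftV_substP, liftV]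

theorem unfold_liftP (k : ℕ) (P : Proc W) : liftP k P.unfold = (liftP (k + 1) P).unfold := by
  simp [unfold, liftP_substP, liftP]

theorem unfold_substP (k : ℕ) (R P : Proc W) :
    substP k R P.unfold = (substP (k + 1) (liftP 0 R) P).unfold := by
  simp [unfold, substP_substP, substP]

end Proc

/-! ### Parallel conversion of processes -/

/-- One-step parallel version of structural congruence, with the recursion rules in the form
that suits induction on transitions. -/
inductive PConv : Proc W → Proc W → Prop
  | nil : PConv .nil .nil
  | pvar (i : ℕ) : PConv (.pvar i) (.pvar i)
  | sigma {P P' : Proc W} : PConv P P' → PConv (.sigma P) (.sigma P')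
  | pos {P P' : Proc W} : PConv P P' → PConv (.pos P) (.pos P')
  | sens (s : Sens) {P P' : Proc W} : PConv P P' → PConv (.sens s P) (.sens s P')
  | act (a : Act) (e : Exp W) {P P' : Proc W} : PConv P P' → PConv (.act a e P) (.act a e P')
  | par {P P' Q Q' : Proc W} : PConv P P' → PConv Q Q' → PConv (.par P Q) (.par P' Q')
  | snd (c : Chan) (e : Exp W) {P P' Q Q' : Proc W} :
      PConv P P' → PConv Q Q' → PConv (.snd c e P Q) (.snd c e P' Q')
  | rcv (c : Chan) {P P' Q Q' : Proc W} :
      PConv P P' → PConv Q Q' → PConv (.rcv c P Q) (.rcv c P' Q')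
  | cond (g : Guard W) {P P' Q Q' : Proc W} :
      PConv P P' → PConv Q Q' → PConv (.cond g P Q) (.cond g P' Q')
  | fix {P P' : Proc W} : PConv P P' → PConv (.fix P) (.fix P')
  | nilL {P P' : Proc W} : PConv P P' → PConv (.par P .nil) P'
  | nilR {P P' : Proc W} : PConv P P' → PConv P (.par P' .nil)
  | comm {P P' Q Q' : Proc W} : PConv P P' → PConv Q Q' → PConv (.par P Q) (.par Q' P')
  | assocL {P P' Q Q' R R' : Proc W} : PConv P P' → PConv Q Q' → PConv R R' →
      PConv (.par (.par P Q) R) (.par P' (.par Q' R'))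
  | assocR {P P' Q Q' R R' : Proc W} : PConv P P' → PConv Q Q' → PConv R R' →
      PConv (.par P (.par Q R)) (.par (.par P' Q') R')
  | trueL {g : Guard W} {P P' : Proc W} (Q : Proc W) :
      g.Eval true → PConv P P' → PConv (.cond g P Q) P'
  | trueR {g : Guard W} {P P' : Proc W} (Q : Proc W) :
      g.Eval true → PConv P P' → PConv P (.cond g P' Q)
  | falseL {g : Guard W} {Q Q' : Proc W} (P : Proc W) :
      g.Eval false → PConv Q Q' → PConv (.cond g P Q) Q'
  | falseR {g : Guard W} {Q Q' : Proc W} (P : Proc W) :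
      g.Eval false → PConv Q Q' → PConv Q (.cond g P Q')
  | unfoldL {P Q : Proc W} : PConv P.unfold Q → PConv (.fix P) Q
  | unfoldR {P Q : Proc W} : PConv P Q.unfold → PConv P (.fix Q)

namespace PConv

theorem refl (P : Proc W) : PConv P P := by
  induction P <;> constructor <;> assumption

theorem symm {P Q : Proc W} (h : PConv P Q) : PConv Q P := by
  induction h with
  | nil => exact .nil
  | pvar i => exact .pvar i
  | sigma _ ih => exact .sigma ih
  | pos _ ih => exact .pos ih
  | sens s _ ih => exact .sens s ih
  | act a e _ ih => exact .act a e ih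
  | par _ _ ih ih' => exact .par ih ih'
  | snd c e _ _ ih ih' => exact .snd c e ih ih'
  | rcv c _ _ ih ih' => exact .rcv c ih ih'
  | cond g _ _ ih ih' => exact .cond g ih ih'
  | fix _ ih => exact .fix ih
  | nilL _ ih => exact .nilR ih
  | nilR _ ih => exact .nilL ih
  | comm _ _ ih ih' => exact .comm ih' ih
  | assocL _ _ _ i j m => exact .assocR i j m
  | assocR _ _ _ i j m => exact .assocL i j m
  | trueL Q hg _ ih => exact .trueR Q hg ih
  | trueR Q hg _ ih => exact .trueL Q hg ih
  | falseL Q hg _ ih => exact .falseR Q hg ih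
  | falseR Q hg _ ih => exact .falseL Q hg ih
  | unfoldL _ ih => exact .unfoldR ih
  | unfoldR _ ih => exact .unfoldL ih

theorem pcong {P Q : Proc W} (h : PConv P Q) : PCong P Q := by
  induction h with
  | nil => exact .refl _
  | pvar i => exact .refl _
  | sigma _ ih => exact .sigma ih
  | pos _ ih => exact .pos ih
  | sens s _ ih => exact .sens s ih
  | act a e _ ih => exact .act a e ih
  | par _ _ ih ih' => exact .par ih ih'
  | snd c e _ _ ih ih' => exact .snd c e ih ih'
  | rcv c _ _ ih ih' => exact .rcv c ih ih'
  | cond g _ _ ih ih' => exact .cond g ih ih'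
  | fix _ ih => exact .fix ih
  | nilL _ ih => exact .trans (.parNil _) ih
  | nilR _ ih => exact .trans ih (.symm (.parNil _))
  | comm _ _ ih ih' => exact .trans (.par ih ih') (.parComm _ _)
  | assocL _ _ _ i j m => exact .trans (.parAssoc _ _ _) (.par i (.par j m))
  | assocR _ _ _ i j m => exact .trans (.symm (.parAssoc _ _ _)) (.par (.par i j) m)
  | trueL Q hg _ ih => exact .trans (.condTrue hg) ih
  | trueR Q hg _ ih => exact .trans ih (.symm (.condTrue hg))
  | falseL Q hg _ ih => exact .trans (.condFalse hg) ih
  | falseR Q hg _ ih => exact .trans ih (.symm (.condFalse hg))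
  | unfoldL _ ih => exact .trans (.unfold _) ih
  | unfoldR _ ih => exact .trans ih (.symm (.unfold _))

theorem substV {P Q : Proc W} (h : PConv P Q) (k : ℕ) (v : W.V) :
    PConv (Proc.substV k v P) (Proc.substV k v Q) := by
  induction h generalizing k with
  | nil => exact .nil
  | pvar i => exact .pvar i
  | sigma _ ih => exact .sigma (ih _)
  | pos _ ih => exact .pos (ih _)
  | sens s _ ih => exact .sens s (ih _)
  | act a e _ ih => exact .act a _ (ih _)
  | par _ _ ih ih' => exact .par (ih _) (ih' _)
  | snd c e _ _ ih ih' => exact .snd c _ (ih _) (ih' _)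
  | rcv c _ _ ih ih' => exact .rcv c (ih _) (ih' _)
  | cond g _ _ ih ih' => exact .cond _ (ih _) (ih' _)
  | fix _ ih => exact .fix (ih _)
  | nilL _ ih => exact .nilL (ih _)
  | nilR _ ih => exact .nilR (ih _)
  | comm _ _ ih ih' => exact .comm (ih _) (ih' _)
  | assocL _ _ _ i j m => exact .assocL (i _) (j _) (m _)
  | assocR _ _ _ i j m => exact .assocR (i _) (j _) (m _)
  | trueL Q hg _ ih => exact .trueL _ (hg.subst _ _) (ih _)
  | trueR Q hg _ ih => exact .trueR _ (hg.subst _ _) (ih _)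
  | falseL Q hg _ ih => exact .falseL _ (hg.subst _ _) (ih _)
  | falseR Q hg _ ih => exact .falseR _ (hg.subst _ _) (ih _)
  | unfoldL _ ih => exact .unfoldL (Proc.unfold_substV _ _ _ ▸ ih _)
  | unfoldR _ ih => exact .unfoldR (Proc.unfold_substV _ _ _ ▸ ih _)

theorem liftV {P Q : Proc W} (h : PConv P Q) (k : ℕ) : PConv (P.liftV k) (Q.liftV k) := by
  induction h generalizing k with
  | nil => exact .nil
  | pvar i => exact .pvar i
  | sigma _ ih => exact .sigma (ih _)
  | pos _ ih => exact .pos (ih _)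
  | sens s _ ih => exact .sens s (ih _)
  | act a e _ ih => exact .act a _ (ih _)
  | par _ _ ih ih' => exact .par (ih _) (ih' _)
  | snd c e _ _ ih ih' => exact .snd c _ (ih _) (ih' _)
  | rcv c _ _ ih ih' => exact .rcv c (ih _) (ih' _)
  | cond g _ _ ih ih' => exact .cond _ (ih _) (ih' _)
  | fix _ ih => exact .fix (ih _)
  | nilL _ ih => exact .nilL (ih _)
  | nilR _ ih => exact .nilR (ih _)
  | comm _ _ ih ih' => exact .comm (ih _) (ih' _)
  | assocL _ _ _ i j m => exact .assocL (i _) (j _) (m _)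
  | assocR _ _ _ i j m => exact .assocR (i _) (j _) (m _)
  | trueL Q hg _ ih => exact .trueL _ (hg.lift _) (ih _)
  | trueR Q hg _ ih => exact .trueR _ (hg.lift _) (ih _)
  | falseL Q hg _ ih => exact .falseL _ (hg.lift _) (ih _)
  | falseR Q hg _ ih => exact .falseR _ (hg.lift _) (ih _)
  | unfoldL _ ih => exact .unfoldL (Proc.unfold_liftV _ _ ▸ ih _)
  | unfoldR _ ih => exact .unfoldR (Proc.unfold_liftV _ _ ▸ ih _)

theorem liftP {P Q : Proc W} (h : PConv P Q) (k : ℕ) : PConv (P.liftP k) (Q.liftP k) := by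
  induction h generalizing k with
  | nil => exact .nil
  | pvar i => exact .pvar _
  | sigma _ ih => exact .sigma (ih _)
  | pos _ ih => exact .pos (ih _)
  | sens s _ ih => exact .sens s (ih _)
  | act a e _ ih => exact .act a _ (ih _)
  | par _ _ ih ih' => exact .par (ih _) (ih' _)
  | snd c e _ _ ih ih' => exact .snd c _ (ih _) (ih' _)
  | rcv c _ _ ih ih' => exact .rcv c (ih _) (ih' _)
  | cond g _ _ ih ih' => exact .cond _ (ih _) (ih' _)
  | fix _ ih => exact .fix (ih _)
  | nilL _ ih => exact .nilL (ih _)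
  | nilR _ ih => exact .nilR (ih _)
  | comm _ _ ih ih' => exact .comm (ih _) (ih' _)
  | assocL _ _ _ i j m => exact .assocL (i _) (j _) (m _)
  | assocR _ _ _ i j m => exact .assocR (i _) (j _) (m _)
  | trueL Q hg _ ih => exact .trueL _ hg (ih _)
  | trueR Q hg _ ih => exact .trueR _ hg (ih _)
  | falseL Q hg _ ih => exact .falseL _ hg (ih _)
  | falseR Q hg _ ih => exact .falseR _ hg (ih _)
  | unfoldL _ ih => exact .unfoldL (Proc.unfold_liftP _ _ ▸ ih _)
  | unfoldR _ ih => exact .unfoldR (Proc.unfold_liftP _ _ ▸ ih _)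

/-- The process and what is substituted into it are converted simultaneously. This is the benefit of
the parallel form: convertible bodies have convertible unfoldings in a single step, as
`PConv.unfold` records. -/
theorem substP {P Q : Proc W} (h : PConv P Q) (k : ℕ) {R S : Proc W} (hR : PConv R S) :
    PConv (Proc.substP k R P) (Proc.substP k S Q) := by
  induction h generalizing k R S with
  | nil => exact .nil
  | pvar i =>
    simp only [Proc.substP]
    split_ifs
    exacts [.pvar _, hR, .pvar _]
  | sigma _ ih => exact .sigma (ih _ hR)
  | pos _ ih => exact .pos (ih _ (hR.liftV 0))
  | sens s _ ih => exact .sens s (ih _ (hR.liftV 0))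
  | act a e _ ih => exact .act a _ (ih _ hR)
  | par _ _ ih ih' => exact .par (ih _ hR) (ih' _ hR)
  | snd c e _ _ ih ih' => exact .snd c _ (ih _ hR) (ih' _ hR)
  | rcv c _ _ ih ih' => exact .rcv c (ih _ (hR.liftV 0)) (ih' _ hR)
  | cond g _ _ ih ih' => exact .cond _ (ih _ hR) (ih' _ hR)
  | fix _ ih => exact .fix (ih _ (hR.liftP 0))
  | nilL _ ih => exact .nilL (ih _ hR)
  | nilR _ ih => exact .nilR (ih _ hR)
  | comm _ _ ih ih' => exact .comm (ih _ hR) (ih' _ hR)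
  | assocL _ _ _ i j m => exact .assocL (i _ hR) (j _ hR) (m _ hR)
  | assocR _ _ _ i j m => exact .assocR (i _ hR) (j _ hR) (m _ hR)
  | trueL Q hg _ ih => exact .trueL _ hg (ih _ hR)
  | trueR Q hg _ ih => exact .trueR _ hg (ih _ hR)
  | falseL Q hg _ ih => exact .falseL _ hg (ih _ hR)
  | falseR Q hg _ ih => exact .falseR _ hg (ih _ hR)
  | unfoldL _ ih => exact .unfoldL (Proc.unfold_substP _ _ _ ▸ ih _ hR)
  | unfoldR _ ih => exact .unfoldR (Proc.unfold_substP _ _ _ ▸ ih _ hR)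

theorem inst {P Q : Proc W} (h : PConv P Q) (v : W.V) : PConv (P.inst v) (Q.inst v) :=
  h.substV 0 v

theorem unfold {P Q : Proc W} (h : PConv P Q) : PConv P.unfold Q.unfold := h.substP 0 h.fix

end PConv

/-- Parallel conversions whose last rule is not one of the rules that only change the
right-hand side. -/
inductive PHead : Proc W → Proc W → Prop
  | sigma {P P' : Proc W} : PConv P P' → PHead (.sigma P) (.sigma P')
  | nil : PHead .nil .nil
  | pos {P P' : Proc W} : PConv P P' → PHead (.pos P) (.pos P')
  | sens (s : Sens) {P P' : Proc W} : PConv P P' → PHead (.sens s P) (.sens s P')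
  | act (a : Act) (e : Exp W) {P P' : Proc W} : PConv P P' → PHead (.act a e P) (.act a e P')
  | par {P P' Q Q' : Proc W} : PConv P P' → PConv Q Q' → PHead (.par P Q) (.par P' Q')
  | snd (c : Chan) (e : Exp W) {P P' Q Q' : Proc W} :
      PConv P P' → PConv Q Q' → PHead (.snd c e P Q) (.snd c e P' Q')
  | rcv (c : Chan) {P P' Q Q' : Proc W} :
      PConv P P' → PConv Q Q' → PHead (.rcv c P Q) (.rcv c P' Q')
  | cond (g : Guard W) {P P' Q Q' : Proc W} :
      PConv P P' → PConv Q Q' → PHead (.cond g P Q) (.cond g P' Q')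
  | fix {P P' : Proc W} : PConv P P' → PHead (.fix P) (.fix P')
  | nilL {P P' : Proc W} : PConv P P' → PHead (.par P .nil) P'
  | comm {P P' Q Q' : Proc W} : PConv P P' → PConv Q Q' → PHead (.par P Q) (.par Q' P')
  | assocL {P P' Q Q' R R' : Proc W} : PConv P P' → PConv Q Q' → PConv R R' →
      PHead (.par (.par P Q) R) (.par P' (.par Q' R'))
  | assocR {P P' Q Q' R R' : Proc W} : PConv P P' → PConv Q Q' → PConv R R' →
      PHead (.par P (.par Q R)) (.par (.par P' Q') R')
  | trueL {g : Guard W} {P P' : Proc W} (Q : Proc W) :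
      g.Eval true → PConv P P' → PHead (.cond g P Q) P'
  | falseL {g : Guard W} {Q Q' : Proc W} (P : Proc W) :
      g.Eval false → PConv Q Q' → PHead (.cond g P Q) Q'
  | unfoldL {P Q : Proc W} : PConv P.unfold Q → PHead (.fix P) Q
  | pvar (i : ℕ) : PHead (.pvar i) (.pvar i)

/-- The four rules that only enlarge the right-hand side leave the left-hand side alone, so they can
be peeled off one after the other. A property of `Q` that survives them has to be checked only for
conversions ending in a rule that inspects `P`. -/
theorem PConv.rec_right {Φ : Proc W → Prop} (h_nil : ∀ P, Φ P → Φ (.par P .nil))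
    (h_true : ∀ (g : Guard W) P Q, g.Eval true → Φ P → Φ (.cond g P Q))
    (h_false : ∀ (g : Guard W) P Q, g.Eval false → Φ Q → Φ (.cond g P Q))
    (h_fix : ∀ P : Proc W, Φ P.unfold → Φ (.fix P)) {P : Proc W}
    (h_head : ∀ Q, PHead P Q → Φ Q) {Q : Proc W} (h : PConv P Q) : Φ Q := by
  induction h with
  | nilR _ ih => exact h_nil _ (ih h_head)
  | trueR Q hg _ ih => exact h_true _ _ _ hg (ih h_head)
  | falseR Q hg _ ih => exact h_false _ _ _ hg (ih h_head)
  | unfoldR _ ih => exact h_fix _ (ih h_head)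
  | nil => exact h_head _ .nil
  | pvar i => exact h_head _ (.pvar i)
  | sigma h => exact h_head _ (.sigma h)
  | pos h => exact h_head _ (.pos h)
  | sens s h => exact h_head _ (.sens s h)
  | act a e h => exact h_head _ (.act a e h)
  | par h h' => exact h_head _ (.par h h')
  | snd c e h h' => exact h_head _ (.snd c e h h')
  | rcv c h h' => exact h_head _ (.rcv c h h')
  | cond g h h' => exact h_head _ (.cond g h h')
  | fix h => exact h_head _ (.fix h)
  | nilL h => exact h_head _ (.nilL h)
  | comm h h' => exact h_head _ (.comm h h')
  | assocL h h' h'' => exact h_head _ (.assocL h h' h'')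
  | assocR h h' h'' => exact h_head _ (.assocR h h' h'')
  | trueL Q hg h => exact h_head _ (.trueL Q hg h)
  | falseL Q hg h => exact h_head _ (.falseL Q hg h)
  | unfoldL h => exact h_head _ (.unfoldL h)

/-! ### Structural congruence of processes and transitions -/

theorem PStep.comm {P Q R : Proc W} {l : PLabel W} (h : PStep (.par P Q) l R) :
    ∃ R', PStep (.par Q P) l R' ∧ PCong R R' := by
  cases h with
  | comL h1 h2 h3 => exact ⟨_, .comR h2 h1 h3, .parComm _ _⟩
  | comR h1 h2 h3 => exact ⟨_, .comL h2 h1 h3, .parComm _ _⟩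
  | parL _ h => exact ⟨_, .parR _ h, .parComm _ _⟩
  | parR _ h => exact ⟨_, .parL _ h, .parComm _ _⟩

theorem PStep.assocL {P Q R S : Proc W} {l : PLabel W} (h : PStep (.par (.par P Q) R) l S) :
    ∃ S', PStep (.par P (.par Q R)) l S' ∧ PCong S S' := by
  cases h with
  | comL h1 h2 h3 =>
    cases h1 with
    | parL _ h => exact ⟨_, .comL h (.parR _ h2) h3, .parAssoc _ _ _⟩
    | parR _ h => exact ⟨_, .parR _ (.comL h h2 h3), .parAssoc _ _ _⟩
  | comR h1 h2 h3 =>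
    cases h1 with
    | parL _ h => exact ⟨_, .comR h (.parR _ h2) h3, .parAssoc _ _ _⟩
    | parR _ h => exact ⟨_, .parR _ (.comR h h2 h3), .parAssoc _ _ _⟩
  | parL _ h =>
    cases h with
    | comL h1 h2 h3 => exact ⟨_, .comL h1 (.parL _ h2) h3, .parAssoc _ _ _⟩
    | comR h1 h2 h3 => exact ⟨_, .comR h1 (.parL _ h2) h3, .parAssoc _ _ _⟩
    | parL _ h => exact ⟨_, .parL _ h, .parAssoc _ _ _⟩
    | parR _ h => exact ⟨_, .parR _ (.parL _ h), .parAssoc _ _ _⟩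
  | parR _ h => exact ⟨_, .parR _ (.parR _ h), .parAssoc _ _ _⟩

theorem PStep.assocR {P Q R S : Proc W} {l : PLabel W} (h : PStep (.par P (.par Q R)) l S) :
    ∃ S', PStep (.par (.par P Q) R) l S' ∧ PCong S S' := by
  cases h with
  | comL h1 h2 h3 =>
    cases h2 with
    | parL _ h => exact ⟨_, .parL _ (.comL h1 h h3), .symm (.parAssoc _ _ _)⟩
    | parR _ h => exact ⟨_, .comL (.parL _ h1) h h3, .symm (.parAssoc _ _ _)⟩
  | comR h1 h2 h3 =>
    cases h2 with
    | parL _ h => exact ⟨_, .parL _ (.comR h1 h h3), .symm (.parAssoc _ _ _)⟩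
    | parR _ h => exact ⟨_, .comR (.parL _ h1) h h3, .symm (.parAssoc _ _ _)⟩
  | parL _ h => exact ⟨_, .parL _ (.parL _ h), .symm (.parAssoc _ _ _)⟩
  | parR _ h =>
    cases h with
    | comL h1 h2 h3 => exact ⟨_, .comL (.parR _ h1) h2 h3, .symm (.parAssoc _ _ _)⟩
    | comR h1 h2 h3 => exact ⟨_, .comR (.parR _ h1) h2 h3, .symm (.parAssoc _ _ _)⟩
    | parL _ h => exact ⟨_, .parL _ (.parR _ h), .symm (.parAssoc _ _ _)⟩
    | parR _ h => exact ⟨_, .parR _ h, .symm (.parAssoc _ _ _)⟩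

theorem PStep.conv_right {P : Proc W} {l : PLabel W} {Q : Proc W}
    (h_head : ∀ P', PHead P P' → ∃ Q', PStep P' l Q' ∧ PCong Q Q') {P' : Proc W}
    (h : PConv P P') : ∃ Q', PStep P' l Q' ∧ PCong Q Q' := by
  refine PConv.rec_right (Φ := fun P' => ∃ Q', PStep P' l Q' ∧ PCong Q Q') ?_ ?_ ?_ ?_ h_head h
  · rintro P ⟨Q', h1, h2⟩
    exact ⟨_, .parL _ h1, .trans h2 (.symm (.parNil _))⟩
  · rintro g P Q hg ⟨Q', h1, h2⟩
    exact ⟨_, .condTrue hg h1, h2⟩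
  · rintro g P Q hg ⟨Q', h1, h2⟩
    exact ⟨_, .condFalse hg h1, h2⟩
  · rintro P ⟨Q', h1, h2⟩
    exact ⟨_, .fix h1, h2⟩

/-- Once the parallel compositions of converted components are known to match a transition, all
conversions of the parallel composition match it. -/
theorem PStep.conv_par {P Q R : Proc W} {l : PLabel W}
    (h_par : ∀ P' Q', PConv P P' → PConv Q Q' → ∃ R', PStep (.par P' Q') l R' ∧ PCong R R')
    (h_nil : Q = .nil → ∀ P', PConv P P' → ∃ R', PStep P' l R' ∧ PCong R R') {S : Proc W}
    (h : PConv (.par P Q) S) : ∃ R', PStep S l R' ∧ PCong R R' := by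
  refine PStep.conv_right (fun S h => ?_) h
  cases h with
  | par h1 h2 => exact h_par _ _ h1 h2
  | nilL h => exact h_nil rfl _ h
  | comm h1 h2 =>
    obtain ⟨R', h3, h4⟩ := h_par _ _ h1 h2
    obtain ⟨R'', h5, h6⟩ := h3.comm
    exact ⟨_, h5, h4.trans h6⟩
  | assocL h1 h2 h3 =>
    obtain ⟨R', h4, h5⟩ := h_par _ _ (.par h1 h2) h3
    obtain ⟨R'', h6, h7⟩ := h4.assocL
    exact ⟨_, h6, h5.trans h7⟩
  | assocR h1 h2 h3 =>
    obtain ⟨R', h4, h5⟩ := h_par _ _ h1 (.par h2 h3)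
    obtain ⟨R'', h6, h7⟩ := h4.assocR
    exact ⟨_, h6, h5.trans h7⟩

/-- Induction on the transition, the conversion being analysed inside each case. For a recursion the
induction hypothesis speaks about the unfolding, and `PConv.unfold` provides the conversion it
needs. A guard cannot be true on one side and false on the other, by `Guard.Eval.unique`. The
residuals are claimed only to be congruent, because regrouping parallel components is composed with
the conversions by transitivity. -/
theorem PStep.conv {P Q : Proc W} {l : PLabel W} (h : PStep P l Q) :
    ∀ {P' : Proc W}, PConv P P' → ∃ Q', PStep P' l Q' ∧ PCong Q Q' := by
  induction h with
  | snd c v P Q =>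
    refine PStep.conv_right fun P' h => ?_
    cases h with | snd _ _ h1 h2 => exact ⟨_, .snd _ _ _ _, h1.pcong⟩
  | rcv c v P Q =>
    refine PStep.conv_right fun P' h => ?_
    cases h with | rcv _ h1 h2 => exact ⟨_, .rcv _ _ _ _, (h1.inst v).pcong⟩
  | sens s v P =>
    refine PStep.conv_right fun P' h => ?_
    cases h with | sens _ h1 => exact ⟨_, .sens _ _ _, (h1.inst v).pcong⟩
  | act a v P =>
    refine PStep.conv_right fun P' h => ?_
    cases h with | act _ _ h1 => exact ⟨_, .act _ _ _, h1.pcong⟩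
  | pos k P =>
    refine PStep.conv_right fun P' h => ?_
    cases h with | pos h1 => exact ⟨_, .pos _ _, (h1.inst _).pcong⟩
  | comL h1 h2 h3 ih1 ih2 =>
    refine PStep.conv_par (fun P' Q' hP hQ => ?_) (fun h => ?_)
    · obtain ⟨_, h4, h5⟩ := ih1 hP
      obtain ⟨_, h6, h7⟩ := ih2 hQ
      exact ⟨_, .comL h4 h6 h3, .par h5 h7⟩
    · subst h; cases h2
  | comR h1 h2 h3 ih1 ih2 =>
    refine PStep.conv_par (fun P' Q' hP hQ => ?_) (fun h => ?_)
    · obtain ⟨_, h4, h5⟩ := ih1 hP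
      obtain ⟨_, h6, h7⟩ := ih2 hQ
      exact ⟨_, .comR h4 h6 h3, .par h5 h7⟩
    · subst h; cases h2
  | parL Q h ih =>
    refine PStep.conv_par (fun P' Q' hP hQ => ?_) (fun h0 P' hP => ?_)
    · obtain ⟨_, h4, h5⟩ := ih hP
      exact ⟨_, .parL _ h4, .par h5 hQ.pcong⟩
    · obtain ⟨_, h4, h5⟩ := ih hP
      subst h0
      exact ⟨_, h4, .trans (.parNil _) h5⟩
  | parR P h ih =>
    refine PStep.conv_par (fun P' Q' hP hQ => ?_) (fun h0 => ?_)
    · obtain ⟨_, h4, h5⟩ := ih hQ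
      exact ⟨_, .parR _ h4, .par hP.pcong h5⟩
    · subst h0; cases h
  | fix h ih =>
    refine PStep.conv_right fun P' h => ?_
    cases h with
    | fix h1 =>
      obtain ⟨_, h4, h5⟩ := ih h1.unfold
      exact ⟨_, .fix h4, h5⟩
    | unfoldL h1 => exact ih h1
  | condTrue hg h ih =>
    refine PStep.conv_right fun P' h => ?_
    cases h with
    | cond _ h1 h2 =>
      obtain ⟨_, h4, h5⟩ := ih h1
      exact ⟨_, .condTrue hg h4, h5⟩
    | trueL _ _ h1 => exact ih h1
    | falseL _ hg' _ => cases hg.unique hg'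
  | condFalse hg h ih =>
    refine PStep.conv_right fun P' h => ?_
    cases h with
    | cond _ h1 h2 =>
      obtain ⟨_, h4, h5⟩ := ih h2
      exact ⟨_, .condFalse hg h4, h5⟩
    | trueL _ hg' _ => cases hg.unique hg'
    | falseL _ _ h1 => exact ih h1

/-- Structural congruence is generated by parallel conversions. -/
theorem PCong.chain {P Q : Proc W} (h : PCong P Q) : Relation.ReflTransGen PConv P Q := by
  have lift2 {f : Proc W → Proc W → Proc W}
      (hf : ∀ {P P' Q Q'}, PConv P P' → PConv Q Q' → PConv (f P Q) (f P' Q')) {P P' Q Q' : Proc W}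
      (h1 : Relation.ReflTransGen PConv P P') (h2 : Relation.ReflTransGen PConv Q Q') :
      Relation.ReflTransGen PConv (f P Q) (f P' Q') :=
    (h1.lift (fun X => f X Q) fun _ _ h => hf h (.refl _)).trans
      (h2.lift (fun X => f P' X) fun _ _ h => hf (.refl _) h)
  induction h with
  | refl P => exact .refl
  | symm _ ih =>
    have : Std.Symm (PConv (W := W)) := ⟨fun _ _ h => h.symm⟩
    exact Relation.ReflTransGen.stdSymm.symm _ _ ih
  | trans _ _ ih ih' => exact ih.trans ih'
  | parNil P => exact .single (.nilL (.refl _))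
  | parComm P Q => exact .single (.comm (.refl _) (.refl _))
  | parAssoc P Q R => exact .single (.assocL (.refl _) (.refl _) (.refl _))
  | condTrue hg => exact .single (.trueL _ hg (.refl _))
  | condFalse hg => exact .single (.falseL _ hg (.refl _))
  | unfold P => exact .single (.unfoldL (.refl _))
  | sigma _ ih => exact ih.lift _ fun _ _ h => .sigma h
  | pos _ ih => exact ih.lift _ fun _ _ h => .pos h
  | sens s _ ih => exact ih.lift _ fun _ _ h => .sens s h
  | act a e _ ih => exact ih.lift _ fun _ _ h => .act a e h
  | par _ _ ih ih' => exact lift2 .par ih ih'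
  | snd c e _ _ ih ih' => exact lift2 (.snd c e) ih ih'
  | rcv c _ _ ih ih' => exact lift2 (.rcv c) ih ih'
  | cond g _ _ ih ih' => exact lift2 (.cond g) ih ih'
  | fix _ ih => exact ih.lift _ fun _ _ h => .fix h

/-- Structural congruence is a strong bisimulation for untimed transitions. -/
theorem PCong.step {P P' Q : Proc W} {l : PLabel W} (h : PCong P P') (hs : PStep P l Q) :
    ∃ Q', PStep P' l Q' ∧ PCong Q Q' := by
  have h' := h.chain
  clear h
  induction h' with
  | refl => exact ⟨_, hs, .refl _⟩
  | tail _ h ih =>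
    obtain ⟨Q', h1, h2⟩ := ih
    obtain ⟨Q'', h3, h4⟩ := h1.conv h
    exact ⟨_, h3, h2.trans h4⟩

theorem PTime.no_tau {P Q : Proc W} (h : PTime P Q) : ∀ R, ¬ PStep P .tau R := by
  induction h with
  | par _ _ h => exact h
  | fix _ ih => rintro R (_ | _); exact ih _ ‹_›
  | condTrue hg _ ih =>
    intro R h
    cases h with
    | condTrue _ h => exact ih _ h
    | condFalse hg' _ => cases hg.unique hg'
  | condFalse hg _ ih =>
    intro R h
    cases h with
    | condFalse _ h => exact ih _ h
    | condTrue hg' _ => cases hg.unique hg'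
  | _ => intro R h; cases h

theorem PCong.no_tau {P P' : Proc W} (h : PCong P P') (hP : ∀ R, ¬ PStep P .tau R) :
    ∀ R, ¬ PStep P' .tau R := fun _ hR => by
  obtain ⟨_, h1, _⟩ := h.symm.step hR
  exact hP _ h1

theorem PTime.conv_right {P Q : Proc W}
    (h_head : ∀ P', PHead P P' → ∃ Q', PTime P' Q' ∧ PCong Q Q') {P' : Proc W}
    (h : PConv P P') : ∃ Q', PTime P' Q' ∧ PCong Q Q' := by
  refine PConv.rec_right (Φ := fun P' => ∃ Q', PTime P' Q' ∧ PCong Q Q') ?_ ?_ ?_ ?_ h_head h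
  · rintro P ⟨Q', h1, h2⟩
    exact ⟨_, .par h1 .nil (PCong.no_tau (.symm (.parNil _)) h1.no_tau),
      .trans h2 (.symm (.parNil _))⟩
  · rintro g P Q hg ⟨Q', h1, h2⟩
    exact ⟨_, .condTrue hg h1, h2⟩
  · rintro g P Q hg ⟨Q', h1, h2⟩
    exact ⟨_, .condFalse hg h1, h2⟩
  · rintro P ⟨Q', h1, h2⟩
    exact ⟨_, .fix h1, h2⟩

/-- As for untimed transitions, with one more ingredient: the premise of parallel composition that
no τ is possible. It is invariant because congruence has already been shown to match untimed
transitions. -/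
theorem PTime.conv {P Q : Proc W} (h : PTime P Q) :
    ∀ {P' : Proc W}, PConv P P' → ∃ Q', PTime P' Q' ∧ PCong Q Q' := by
  induction h with
  | nil =>
    refine PTime.conv_right fun P' h => ?_
    cases h; exact ⟨_, .nil, .refl _⟩
  | delay P =>
    refine PTime.conv_right fun P' h => ?_
    cases h with | sigma h => exact ⟨_, .delay _, h.pcong⟩
  | timeoutSnd c e P Q =>
    refine PTime.conv_right fun P' h => ?_
    cases h with | snd _ _ h1 h2 => exact ⟨_, .timeoutSnd _ _ _ _, h2.pcong⟩
  | timeoutRcv c P Q =>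
    refine PTime.conv_right fun P' h => ?_
    cases h with | rcv _ h1 h2 => exact ⟨_, .timeoutRcv _ _ _, h2.pcong⟩
  | @par P P' Q Q' hP hQ hn ihP ihQ =>
    refine PTime.conv_right fun S h => ?_
    have h_par : ∀ A B, PConv P A → PConv Q B →
        ∃ R, PTime (.par A B) R ∧ PCong (.par P' Q') R := fun A B hA hB => by
      obtain ⟨_, h1, h2⟩ := ihP hA
      obtain ⟨_, h3, h4⟩ := ihQ hB
      exact ⟨_, .par h1 h3 (PCong.no_tau (.par hA.pcong hB.pcong) hn), .par h2 h4⟩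
    cases h with
    | par h1 h2 => exact h_par _ _ h1 h2
    | nilL h =>
      cases hQ
      obtain ⟨_, h1, h2⟩ := ihP h
      exact ⟨_, h1, .trans (.parNil _) h2⟩
    | comm h1 h2 =>
      obtain ⟨_, h3, h4⟩ := h_par _ _ h1 h2
      cases h3 with
      | par h5 h6 h7 =>
        exact ⟨_, .par h6 h5 (PCong.no_tau (.parComm _ _) h7), h4.trans (.parComm _ _)⟩
    | assocL h1 h2 h3 =>
      obtain ⟨_, h3, h4⟩ := h_par _ _ (.par h1 h2) h3
      cases h3 with
      | par h5 h6 h7 =>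
        cases h5 with
        | par h8 h9 h10 =>
          -- Regrouping creates a new inner composition, whose side condition is inherited from the
          -- whole: a τ of a component is a τ of the composition.
          have hn' := PCong.no_tau (.parAssoc _ _ _) h7
          exact ⟨_, .par h8 (.par h9 h6 fun _ h => hn' _ (.parR _ h)) hn',
            h4.trans (.parAssoc _ _ _)⟩
    | assocR h1 h2 h3 =>
      obtain ⟨_, h3, h4⟩ := h_par _ _ h1 (.par h2 h3)
      cases h3 with
      | par h5 h6 h7 =>
        cases h6 with
        | par h8 h9 h10 =>
          have hn' := PCong.no_tau (.symm (.parAssoc _ _ _)) h7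
          exact ⟨_, .par (.par h5 h8 fun _ h => hn' _ (.parL _ h)) h9 hn',
            h4.trans (.symm (.parAssoc _ _ _))⟩
  | fix h ih =>
    refine PTime.conv_right fun P' h => ?_
    cases h with
    | fix h1 =>
      obtain ⟨_, h4, h5⟩ := ih h1.unfold
      exact ⟨_, .fix h4, h5⟩
    | unfoldL h1 => exact ih h1
  | condTrue hg h ih =>
    refine PTime.conv_right fun P' h => ?_
    cases h with
    | cond _ h1 h2 =>
      obtain ⟨_, h4, h5⟩ := ih h1
      exact ⟨_, .condTrue hg h4, h5⟩
    | trueL _ _ h1 => exact ih h1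
    | falseL _ hg' _ => cases hg.unique hg'
  | condFalse hg h ih =>
    refine PTime.conv_right fun P' h => ?_
    cases h with
    | cond _ h1 h2 =>
      obtain ⟨_, h4, h5⟩ := ih h2
      exact ⟨_, .condFalse hg h4, h5⟩
    | trueL _ hg' _ => cases hg.unique hg'
    | falseL _ _ h1 => exact ih h1

/-- Structural congruence is a strong bisimulation for timed transitions. -/
theorem PCong.time {P P' Q : Proc W} (h : PCong P P') (hs : PTime P Q) :
    ∃ Q', PTime P' Q' ∧ PCong Q Q' := by
  have h' := h.chain
  clear h
  induction h' with
  | refl => exact ⟨_, hs, .refl _⟩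
  | tail _ h ih =>
    obtain ⟨Q', h1, h2⟩ := ih
    obtain ⟨Q'', h3, h4⟩ := h1.conv h
    exact ⟨_, h3, h2.trans h4⟩

end IoT

/-! ### Renaming of channels, and structural congruence of networks as a strong bisimulation -/

namespace IoT

variable {W : World}

/-! ### Channels of processes -/

namespace Proc

theorem hasChan_substV (c : Chan) (k : ℕ) (v : W.V) (P : Proc W) :
    HasChan c (substV k v P) ↔ HasChan c P := by
  induction P generalizing k <;> simp_all [substV, HasChan]

theorem hasChan_liftV (c : Chan) (k : ℕ) (P : Proc W) : HasChan c (liftV k P) ↔ HasChan c P := by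
  induction P generalizing k <;> simp_all [liftV, HasChan]

theorem hasChan_liftP (c : Chan) (k : ℕ) (P : Proc W) : HasChan c (liftP k P) ↔ HasChan c P := by
  induction P generalizing k <;> simp_all [liftP, HasChan]

theorem HasChan.of_substP {c : Chan} {k : ℕ} {R P : Proc W} (h : HasChan c (substP k R P)) :
    HasChan c P ∨ HasChan c R := by
  induction P generalizing k R <;> simp only [substP, HasChan] at h ⊢
  case pvar i =>
    split_ifs at h
    exacts [h.elim, .inr h, h.elim]
  case sigma ih => exact ih h
  case act ih => exact ih h
  case pos ih => simpa [hasChan_liftV] using ih h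
  case sens ih => simpa [hasChan_liftV] using ih h
  case fix ih => simpa [hasChan_liftP] using ih h
  case par ih ih' =>
    rcases h with h | h
    · have := ih h; tauto
    · have := ih' h; tauto
  case cond ih ih' =>
    rcases h with h | h
    · have := ih h; tauto
    · have := ih' h; tauto
  case snd ih ih' =>
    rcases h with h | h | h
    · tauto
    · have := ih h; tauto
    · have := ih' h; tauto
  case rcv ih ih' =>
    rcases h with h | h | h
    · tauto
    · have := ih h; rw [hasChan_liftV] at this; tauto
    · have := ih' h; tauto

theorem hasChan_inst (c : Chan) (v : W.V) (P : Proc W) : HasChan c (P.inst v) ↔ HasChan c P :=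
  hasChan_substV _ _ _ _

theorem HasChan.of_unfold {c : Chan} {P : Proc W} (h : HasChan c P.unfold) : HasChan c P :=
  h.of_substP.elim id id

theorem mapChan_substV (f : Chan → Chan) (k : ℕ) (v : W.V) (P : Proc W) :
    mapChan f (substV k v P) = substV k v (mapChan f P) := by
  induction P generalizing k <;> simp_all [substV, mapChan]

theorem mapChan_liftV (f : Chan → Chan) (k : ℕ) (P : Proc W) :
    mapChan f (liftV k P) = liftV k (mapChan f P) := by
  induction P generalizing k <;> simp_all [liftV, mapChan]

theorem mapChan_liftP (f : Chan → Chan) (k : ℕ) (P : Proc W) :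
    mapChan f (liftP k P) = liftP k (mapChan f P) := by
  induction P generalizing k <;> simp_all [liftP, mapChan]

theorem mapChan_substP (f : Chan → Chan) (k : ℕ) (R P : Proc W) :
    mapChan f (substP k R P) = substP k (mapChan f R) (mapChan f P) := by
  induction P generalizing k R <;> simp_all [substP, mapChan, mapChan_liftV, mapChan_liftP]
  split_ifs <;> rfl

theorem mapChan_inst (f : Chan → Chan) (v : W.V) (P : Proc W) :
    mapChan f (P.inst v) = (mapChan f P).inst v := mapChan_substV _ _ _ _

theorem mapChan_unfold (f : Chan → Chan) (P : Proc W) :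
    mapChan f P.unfold = (mapChan f P).unfold := by simp [unfold, mapChan_substP, mapChan]

theorem mapChan_mapChan (f g : Chan → Chan) (P : Proc W) :
    mapChan f (mapChan g P) = mapChan (f ∘ g) P := by
  induction P <;> simp_all [mapChan]

theorem mapChan_congr {f g : Chan → Chan} {P : Proc W} (h : ∀ c, HasChan c P → f c = g c) :
    mapChan f P = mapChan g P := by
  induction P <;> simp_all [mapChan, HasChan]

theorem mapChan_id (P : Proc W) : mapChan id P = P := by
  induction P <;> simp_all [mapChan]

theorem hasChan_mapChan (f : Chan → Chan) (c : Chan) (P : Proc W) :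
    HasChan c (mapChan f P) ↔ ∃ d, HasChan d P ∧ f d = c := by
  induction P <;> simp_all only [HasChan, mapChan, or_and_right, exists_or, exists_eq_left', false_and, exists_false]

theorem finite_hasChan (P : Proc W) : {c | HasChan c P}.Finite := by
  induction P <;> simp_all [HasChan, Set.ofPred_or]

end Proc

theorem PStep.hasChan {P P' : Proc W} {l : PLabel W} (h : PStep P l P') {c : Chan}
    (hc : P'.HasChan c) : P.HasChan c := by
  induction h <;> simp_all only [Proc.HasChan, Proc.hasChan_inst, forall_const]
  case fix ih => exact ih.of_unfold
  all_goals tauto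

theorem PTime.hasChan {P P' : Proc W} (h : PTime P P') {c : Chan}
    (hc : P'.HasChan c) : P.HasChan c := by
  induction h <;> simp_all only [Proc.HasChan, forall_const]
  case fix ih => exact ih.of_unfold
  all_goals tauto

theorem PStep.hasChan_snd {P P' : Proc W} {c : Chan} {v : W.V} (h : PStep P (.snd c v) P') :
    P.HasChan c := by
  generalize hl : PLabel.snd c v = l at h
  induction h <;> cases hl <;> simp_all only [Proc.HasChan, forall_const]
  case fix ih => exact ih.of_unfold
  all_goals tauto

theorem PStep.hasChan_rcv {P P' : Proc W} {c : Chan} {v : W.V} (h : PStep P (.rcv c v) P') :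
    P.HasChan c := by
  generalize hl : PLabel.rcv c v = l at h
  induction h <;> cases hl <;> simp_all only [Proc.HasChan, forall_const]
  case fix ih => exact ih.of_unfold
  all_goals tauto

/-- Renaming of the channel of a label. -/
def PLabel.mapChan (f : Chan → Chan) : PLabel W → PLabel W
  | .snd c v => .snd (f c) v
  | .rcv c v => .rcv (f c) v
  | l => l

theorem PStep.mapChan {f : Chan → Chan} (hf : ∀ c, (f c).rng = c.rng) {P P' : Proc W}
    {l : PLabel W} (h : PStep P l P') : PStep (P.mapChan f) (l.mapChan f) (P'.mapChan f) := by
  induction h with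
  | snd c v P Q => exact .snd _ _ _ _
  | rcv c v P Q => rw [Proc.mapChan_inst]; exact .rcv _ _ _ _
  | sens s v P => rw [Proc.mapChan_inst]; exact .sens _ _ _
  | act a v P => exact .act _ _ _
  | pos k P => rw [Proc.mapChan_inst]; exact .pos _ _
  | comL h1 h2 h3 ih1 ih2 => exact .comL ih1 ih2 ((hf _).trans h3)
  | comR h1 h2 h3 ih1 ih2 => exact .comR ih1 ih2 ((hf _).trans h3)
  | parL Q h ih => exact .parL _ ih
  | parR P h ih => exact .parR _ ih
  | fix h ih => rw [Proc.mapChan_unfold] at ih; exact .fix ih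
  | condTrue hg h ih => exact .condTrue hg ih
  | condFalse hg h ih => exact .condFalse hg ih

theorem PCong.mapChan (f : Chan → Chan) {P Q : Proc W} (h : PCong P Q) :
    PCong (P.mapChan f) (Q.mapChan f) := by
  induction h with
  | refl P => exact .refl _
  | symm _ ih => exact .symm ih
  | trans _ _ ih ih' => exact .trans ih ih'
  | parNil P => exact .parNil _
  | parComm P Q => exact .parComm _ _
  | parAssoc P Q R => exact .parAssoc _ _ _
  | condTrue hg => exact .condTrue hg
  | condFalse hg => exact .condFalse hg
  | unfold P => rw [Proc.mapChan_unfold]; exact .unfold _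
  | sigma _ ih => exact .sigma ih
  | pos _ ih => exact .pos ih
  | sens s _ ih => exact .sens s ih
  | act a e _ ih => exact .act a e ih
  | par _ _ ih ih' => exact .par ih ih'
  | snd c e _ _ ih ih' => exact .snd _ e ih ih'
  | rcv c _ _ ih ih' => exact .rcv _ ih ih'
  | cond g _ _ ih ih' => exact .cond g ih ih'
  | fix _ ih => exact .fix ih

theorem Proc.mapChan_symm_mapChan (π : Equiv.Perm Chan) (P : Proc W) :
    (P.mapChan π).mapChan π.symm = P := by
  rw [mapChan_mapChan, Equiv.symm_comp_self, mapChan_id]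

theorem rng_symm {π : Equiv.Perm Chan} (hπ : ∀ c, (π c).rng = c.rng) (c : Chan) :
    (π.symm c).rng = c.rng := by rw [← hπ, Equiv.apply_symm_apply]

/-- Untimed transitions survive every range-preserving renaming, but here a permutation is needed:
the premise that no τ is possible requires pulling transitions back along the inverse. -/
theorem PTime.mapChan {π : Equiv.Perm Chan} (hπ : ∀ c, (π c).rng = c.rng) {P P' : Proc W}
    (h : PTime P P') : PTime (P.mapChan π) (P'.mapChan π) := by
  induction h with
  | nil => exact .nil
  | delay P => exact .delay _
  | timeoutSnd c e P Q => exact .timeoutSnd _ _ _ _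
  | timeoutRcv c P Q => exact .timeoutRcv _ _ _
  | par _ _ hn ih ih' =>
    refine .par ih ih' fun R hR => hn (R.mapChan π.symm) ?_
    have := hR.mapChan (rng_symm hπ)
    simpa [Proc.mapChan, Proc.mapChan_symm_mapChan, PLabel.mapChan] using this
  | fix _ ih => rw [Proc.mapChan_unfold] at ih; exact .fix ih
  | condTrue hg _ ih => exact .condTrue hg ih
  | condFalse hg _ ih => exact .condFalse hg ih

/-! ### Channels of networks -/

/-- Renaming of the channel of a label. -/
def NLabel.mapChan (f : Chan → Chan) : NLabel W → NLabel W
  | .snd c v h => .snd (f c) v h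
  | .rcv c v h => .rcv (f c) v h
  | l => l

theorem NLabel.isOn_mapChan (π : Equiv.Perm Chan) (c : Chan) (l : NLabel W) :
    (l.mapChan π).IsOn (π c) ↔ l.IsOn c := by
  cases l <;> simp [NLabel.mapChan, NLabel.IsOn]

theorem NLabel.mapChan_of_not_isOn {f : Chan → Chan} {l : NLabel W}
    (h : ∀ c, l.IsOn c → f c = c) : l.mapChan f = l := by
  cases l <;> simp_all [NLabel.mapChan, NLabel.IsOn]

namespace Network

theorem mapChan_mapChan (f g : Chan → Chan) (M : Network W) :
    (M.mapChan g).mapChan f = M.mapChan (f ∘ g) := by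
  induction M <;> simp_all [mapChan, Proc.mapChan_mapChan]

theorem mapChan_id (M : Network W) : M.mapChan id = M := by
  induction M <;> simp_all [mapChan, Proc.mapChan_id]

theorem mapChan_symm_mapChan (π : Equiv.Perm Chan) (M : Network W) :
    (M.mapChan π).mapChan π.symm = M := by
  rw [mapChan_mapChan, Equiv.symm_comp_self, mapChan_id]

theorem hasFreeChan_mapChan (π : Equiv.Perm Chan) (c : Chan) (M : Network W) :
    (M.mapChan π).HasFreeChan (π c) ↔ M.HasFreeChan c := by
  induction M <;> simp_all [mapChan, HasFreeChan, Proc.hasChan_mapChan]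

theorem finite_hasFreeChan (M : Network W) : {c | M.HasFreeChan c}.Finite := by
  induction M with
  | zero => simp [HasFreeChan]
  | node d => exact Proc.finite_hasChan _
  | par M N ihM ihN => simpa [HasFreeChan, Set.ofPred_or] using And.intro ihM ihN
  | res c M ih => exact ih.subset fun d h => h.2

end Network

theorem NStep.hasFreeChan {M M' : Network W} {l : NLabel W} (h : NStep M l M') {c : Chan}
    (hc : M'.HasFreeChan c) : M.HasFreeChan c := by
  induction h with
  | pos h => exact h.hasChan hc
  | sensRead _ h => exact h.hasChan hc
  | actUnChg _ h => exact h.hasChan hc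
  | actChg _ _ h => exact h.hasChan hc
  | locCom h => exact h.hasChan hc
  | snd h _ => exact h.hasChan hc
  | rcv h _ => exact h.hasChan hc
  | glbComL _ _ _ ih ih' => exact hc.imp ih ih'
  | glbComR _ _ _ ih ih' => exact hc.imp ih ih'
  | parL _ _ ih => exact hc.imp_left ih
  | parR _ _ ih => exact hc.imp_right ih
  | res _ _ ih => exact ⟨hc.1, ih hc.2⟩

theorem NTime.hasFreeChan {M M' : Network W} (h : NTime M M') {c : Chan}
    (hc : M'.HasFreeChan c) : M.HasFreeChan c := by
  induction h with
  | stat h => exact h.hasChan hc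
  | mob h => exact h.hasChan hc
  | par _ _ _ ih ih' => exact hc.imp ih ih'
  | zero => exact hc
  | res _ _ ih => exact ⟨hc.1, ih hc.2⟩

theorem NStep.hasFreeChan_of_isOn {M M' : Network W} {l : NLabel W} (h : NStep M l M') {c : Chan}
    (hc : l.IsOn c) : M.HasFreeChan c := by
  induction h with
  | snd h _ => cases hc; exact h.hasChan_snd
  | rcv h _ => cases hc; exact h.hasChan_rcv
  | parL _ _ ih => exact .inl (ih hc)
  | parR _ _ ih => exact .inr (ih hc)
  | res _ h ih => exact ⟨fun h' => h (h' ▸ hc), ih hc⟩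
  | _ => exact hc.elim

theorem NStep.mapChan {π : Equiv.Perm Chan} (hπ : ∀ c, (π c).rng = c.rng) {M M' : Network W}
    {l : NLabel W} (h : NStep M l M') : NStep (M.mapChan π) (l.mapChan π) (M'.mapChan π) := by
  induction h with
  | pos h => exact .pos (h.mapChan hπ)
  | sensRead h1 h => exact .sensRead h1 (h.mapChan hπ)
  | actUnChg h1 h => exact .actUnChg h1 (h.mapChan hπ)
  | actChg h1 h2 h => exact .actChg h1 h2 (h.mapChan hπ)
  | locCom h => exact .locCom (h.mapChan hπ)
  | snd h h1 => exact .snd (h.mapChan hπ) (by rwa [hπ])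
  | rcv h h1 => exact .rcv (h.mapChan hπ) (by rwa [hπ])
  | glbComL _ _ h ih ih' => exact .glbComL ih ih' (by rwa [hπ])
  | glbComR _ _ h ih ih' => exact .glbComR ih ih' (by rwa [hπ])
  | parL _ _ ih => exact .parL _ ih
  | parR _ _ ih => exact .parR _ ih
  | res _ h ih => exact .res ih (by rwa [NLabel.isOn_mapChan])

theorem NTime.mapChan {π : Equiv.Perm Chan} (hπ : ∀ c, (π c).rng = c.rng) {M M' : Network W}
    (h : NTime M M') : NTime (M.mapChan π) (M'.mapChan π) := by
  have back {M N : Network W} (h : NStep (M.mapChan π) .tau N) :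
      NStep M .tau (N.mapChan π.symm) := by
    simpa [Network.mapChan_symm_mapChan, NLabel.mapChan] using h.mapChan (rng_symm hπ)
  induction h with
  | stat h hn => exact .stat (h.mapChan hπ) fun N hN => hn _ (back (M := .node _) hN)
  | mob h hn hd => exact .mob (h.mapChan hπ) (fun N hN => hn _ (back (M := .node _) hN)) hd
  | par _ _ hn ih ih' => exact .par ih ih' fun N hN => hn _ (back (M := .par _ _) hN)
  | zero => exact .zero
  | res _ _ ih => exact .res _ ih

theorem NTime.no_tau {M M' : Network W} (h : NTime M M') : ∀ N, ¬ NStep M .tau N := by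
  induction h with
  | stat _ h => exact h
  | mob _ h _ => exact h
  | par _ _ h => exact h
  | zero => intro N h; cases h
  | res _ _ ih => intro N h; cases h with | res h _ => exact ih _ h

/-! ### Structural congruence of networks and transitions -/

/-- `N` matches the untimed transitions of `M` up to structural congruence. -/
def StepSim (M N : Network W) : Prop :=
  ∀ l M', NStep M l M' → ∃ N', NStep N l N' ∧ NCong M' N'

/-- `N` matches the timed transitions of `M` up to structural congruence. -/
def TimeSim (M N : Network W) : Prop := ∀ M', NTime M M' → ∃ N', NTime N N' ∧ NCong M' N'

theorem StepSim.node {P Q : Proc W} (n : NodeName) (I : Iface W) (μ : Mob) (k : W.Loc)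
    (h : PCong P Q) : StepSim (.node ⟨n, I, P, μ, k⟩) (.node ⟨n, I, Q, μ, k⟩) := by
  intro l M' hM
  cases hM with
  | pos h1 => obtain ⟨_, h2, h3⟩ := h.step h1; exact ⟨_, .pos h2, .node _ _ _ _ h3⟩
  | sensRead h0 h1 =>
    obtain ⟨_, h2, h3⟩ := h.step h1; exact ⟨_, .sensRead h0 h2, .node _ _ _ _ h3⟩
  | actUnChg h0 h1 =>
    obtain ⟨_, h2, h3⟩ := h.step h1; exact ⟨_, .actUnChg h0 h2, .node _ _ _ _ h3⟩
  | actChg h0 h0' h1 =>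
    obtain ⟨_, h2, h3⟩ := h.step h1; exact ⟨_, .actChg h0 h0' h2, .node _ _ _ _ h3⟩
  | locCom h1 => obtain ⟨_, h2, h3⟩ := h.step h1; exact ⟨_, .locCom h2, .node _ _ _ _ h3⟩
  | snd h1 h0 => obtain ⟨_, h2, h3⟩ := h.step h1; exact ⟨_, .snd h2 h0, .node _ _ _ _ h3⟩
  | rcv h1 h0 => obtain ⟨_, h2, h3⟩ := h.step h1; exact ⟨_, .rcv h2 h0, .node _ _ _ _ h3⟩

theorem StepSim.parComm (M N : Network W) : StepSim (.par M N) (.par N M) := by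
  intro l M' h
  cases h with
  | glbComL h1 h2 h3 => exact ⟨_, .glbComR h2 h1 h3, .parComm _ _⟩
  | glbComR h1 h2 h3 => exact ⟨_, .glbComL h2 h1 h3, .parComm _ _⟩
  | parL _ h => exact ⟨_, .parR _ h, .parComm _ _⟩
  | parR _ h => exact ⟨_, .parL _ h, .parComm _ _⟩

theorem StepSim.parAssoc (M N O : Network W) :
    StepSim (.par (.par M N) O) (.par M (.par N O)) := by
  intro l M' h
  cases h with
  | glbComL h1 h2 h3 =>
    cases h1 with
    | parL _ h => exact ⟨_, .glbComL h (.parR _ h2) h3, .parAssoc _ _ _⟩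
    | parR _ h => exact ⟨_, .parR _ (.glbComL h h2 h3), .parAssoc _ _ _⟩
  | glbComR h1 h2 h3 =>
    cases h1 with
    | parL _ h => exact ⟨_, .glbComR h (.parR _ h2) h3, .parAssoc _ _ _⟩
    | parR _ h => exact ⟨_, .parR _ (.glbComR h h2 h3), .parAssoc _ _ _⟩
  | parL _ h =>
    cases h with
    | glbComL h1 h2 h3 => exact ⟨_, .glbComL h1 (.parL _ h2) h3, .parAssoc _ _ _⟩
    | glbComR h1 h2 h3 => exact ⟨_, .glbComR h1 (.parL _ h2) h3, .parAssoc _ _ _⟩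
    | parL _ h => exact ⟨_, .parL _ h, .parAssoc _ _ _⟩
    | parR _ h => exact ⟨_, .parR _ (.parL _ h), .parAssoc _ _ _⟩
  | parR _ h => exact ⟨_, .parR _ (.parR _ h), .parAssoc _ _ _⟩

theorem StepSim.parAssoc' (M N O : Network W) :
    StepSim (.par M (.par N O)) (.par (.par M N) O) := by
  intro l M' h
  cases h with
  | glbComL h1 h2 h3 =>
    cases h2 with
    | parL _ h => exact ⟨_, .parL _ (.glbComL h1 h h3), .symm (.parAssoc _ _ _)⟩
    | parR _ h => exact ⟨_, .glbComL (.parL _ h1) h h3, .symm (.parAssoc _ _ _)⟩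
  | glbComR h1 h2 h3 =>
    cases h2 with
    | parL _ h => exact ⟨_, .parL _ (.glbComR h1 h h3), .symm (.parAssoc _ _ _)⟩
    | parR _ h => exact ⟨_, .glbComR (.parL _ h1) h h3, .symm (.parAssoc _ _ _)⟩
  | parL _ h => exact ⟨_, .parL _ (.parL _ h), .symm (.parAssoc _ _ _)⟩
  | parR _ h =>
    cases h with
    | glbComL h1 h2 h3 => exact ⟨_, .glbComL (.parR _ h1) h2 h3, .symm (.parAssoc _ _ _)⟩
    | glbComR h1 h2 h3 => exact ⟨_, .glbComR (.parR _ h1) h2 h3, .symm (.parAssoc _ _ _)⟩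
    | parL _ h => exact ⟨_, .parL _ (.parR _ h), .symm (.parAssoc _ _ _)⟩
    | parR _ h => exact ⟨_, .parR _ h, .symm (.parAssoc _ _ _)⟩

theorem StepSim.resSwap (c d : Chan) (M : Network W) :
    StepSim (.res c (.res d M)) (.res d (.res c M)) := by
  intro l M' h
  cases h with
  | res h1 h2 => cases h1 with | res h3 h4 => exact ⟨_, .res (.res h3 h2) h4, .resSwap _ _ _⟩

/-- A network that does not know `c` never acts on `c` and never learns it, since channels are not
transmitted. So extending the scope over `M` blocks nothing, and a communication between `M` and `N`
uses a channel other than `c`. -/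
theorem StepSim.resPar {c : Chan} {M : Network W} (N : Network W) (hc : ¬ M.HasFreeChan c) :
    StepSim (.res c (.par M N)) (.par M (.res c N)) := by
  intro l M' h
  cases h with
  | res h h' =>
    have hM {l M'} (hs : NStep M l M') : ¬ M'.HasFreeChan c := fun h => hc (hs.hasFreeChan h)
    have hM' {l M'} (hs : NStep M l M') : ¬ l.IsOn c := fun h => hc (hs.hasFreeChan_of_isOn h)
    cases h with
    | glbComL h1 h2 h3 => exact ⟨_, .glbComL h1 (.res h2 fun h => hM' h1 h) h3, .resPar (hM h1)⟩
    | glbComR h1 h2 h3 => exact ⟨_, .glbComR h1 (.res h2 fun h => hM' h1 h) h3, .resPar (hM h1)⟩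
    | parL _ h => exact ⟨_, .parL _ h, .resPar (hM h)⟩
    | parR _ h => exact ⟨_, .parR _ (.res h h'), .resPar hc⟩

theorem StepSim.resPar' {c : Chan} {M : Network W} (N : Network W) (hc : ¬ M.HasFreeChan c) :
    StepSim (.par M (.res c N)) (.res c (.par M N)) := by
  intro l M' h
  have hM {l M'} (hs : NStep M l M') : ¬ M'.HasFreeChan c := fun h => hc (hs.hasFreeChan h)
  have hM' {l M'} (hs : NStep M l M') : ¬ l.IsOn c := fun h => hc (hs.hasFreeChan_of_isOn h)
  cases h with
  | glbComL h1 h2 h3 =>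
    cases h2 with
    | res h2 h4 => exact ⟨_, .res (.glbComL h1 h2 h3) id, .symm (.resPar (hM h1))⟩
  | glbComR h1 h2 h3 =>
    cases h2 with
    | res h2 h4 => exact ⟨_, .res (.glbComR h1 h2 h3) id, .symm (.resPar (hM h1))⟩
  | parL _ h => exact ⟨_, .res (.parL _ h) (hM' h), .symm (.resPar (hM h))⟩
  | parR _ h =>
    cases h with
    | res h h' => exact ⟨_, .res (.parR _ h) h', .symm (.resPar hc)⟩

open Classical in
theorem swap_rng {c d : Chan} (h : d.rng = c.rng) (x : Chan) :
    (Equiv.swap c d x).rng = x.rng := by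
  rw [Equiv.swap_apply_def]; split_ifs <;> simp_all

open Classical in
theorem StepSim.alpha {c d : Chan} {M : Network W} (h : d.rng = c.rng)
    (hd : ¬ M.HasFreeChan d) : StepSim (.res c M) (.res d (M.mapChan (Equiv.swap c d))) := by
  intro l M' hM
  cases hM with
  | res h1 h2 =>
    have h3 := h1.mapChan (π := Equiv.swap c d) (swap_rng h)
    have h4 : ¬ l.IsOn d := fun h => hd (h1.hasFreeChan_of_isOn h)
    -- The label is not on `c`, which is restricted, nor on `d`, which is not free in `M`; so the
    -- swap fixes it.
    rw [NLabel.mapChan_of_not_isOn fun e he => Equiv.swap_apply_of_ne_of_ne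
      (by rintro rfl; exact h2 he) (by rintro rfl; exact h4 he)] at h3
    exact ⟨_, .res h3 h4, .alpha h fun h => hd (h1.hasFreeChan h)⟩

open Classical in
-- Renaming a bound channel is undone by a renaming of the same kind. This lets the backward half of
-- the α-case follow from the forward half.
theorem alpha_symm {c d : Chan} {M : Network W} (hd : ¬ M.HasFreeChan d) :
    ¬ (M.mapChan (Equiv.swap c d)).HasFreeChan c ∧
      (M.mapChan (Equiv.swap c d)).mapChan (Equiv.swap d c) = M := by
  constructor
  · rwa [← Network.hasFreeChan_mapChan (Equiv.swap c d), Equiv.swap_apply_right] at hd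
  · rw [Equiv.swap_comm d c, Network.mapChan_mapChan, ← Equiv.Perm.coe_mul, Equiv.swap_mul_self]
    exact Network.mapChan_id M

theorem StepSim.par {M M' N N' : Network W} (h1 : NCong M M') (h2 : NCong N N')
    (hM : StepSim M M') (hN : StepSim N N') : StepSim (.par M N) (.par M' N') := by
  intro l O h
  cases h with
  | glbComL h3 h4 h5 =>
    obtain ⟨_, h6, h7⟩ := hM _ _ h3
    obtain ⟨_, h8, h9⟩ := hN _ _ h4
    exact ⟨_, .glbComL h6 h8 h5, .par h7 h9⟩
  | glbComR h3 h4 h5 =>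
    obtain ⟨_, h6, h7⟩ := hM _ _ h3
    obtain ⟨_, h8, h9⟩ := hN _ _ h4
    exact ⟨_, .glbComR h6 h8 h5, .par h7 h9⟩
  | parL _ h =>
    obtain ⟨_, h6, h7⟩ := hM _ _ h
    exact ⟨_, .parL _ h6, .par h7 h2⟩
  | parR _ h =>
    obtain ⟨_, h6, h7⟩ := hN _ _ h
    exact ⟨_, .parR _ h6, .par h1 h7⟩

theorem StepSim.res {M M' : Network W} (c : Chan) (hM : StepSim M M') :
    StepSim (.res c M) (.res c M') := by
  intro l O h
  cases h with
  | res h h' =>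
    obtain ⟨_, h6, h7⟩ := hM _ _ h
    exact ⟨_, .res h6 h', .res c h7⟩

/-- The two directions are proved together so that the rule of symmetry costs nothing in the
induction on the congruence. -/
theorem NCong.stepSim {M N : Network W} (h : NCong M N) : StepSim M N ∧ StepSim N M := by
  induction h with
  | refl M => exact ⟨fun _ _ h => ⟨_, h, .refl _⟩, fun _ _ h => ⟨_, h, .refl _⟩⟩
  | symm _ ih => exact ih.symm
  | trans _ _ ih ih' =>
    refine ⟨fun _ _ h => ?_, fun _ _ h => ?_⟩
    · obtain ⟨_, h1, h2⟩ := ih.1 _ _ h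
      obtain ⟨_, h3, h4⟩ := ih'.1 _ _ h1
      exact ⟨_, h3, h2.trans h4⟩
    · obtain ⟨_, h1, h2⟩ := ih'.2 _ _ h
      obtain ⟨_, h3, h4⟩ := ih.2 _ _ h1
      exact ⟨_, h3, h2.trans h4⟩
  | node n I μ k h => exact ⟨.node n I μ k h, .node n I μ k h.symm⟩
  | parZero M =>
    refine ⟨fun l M' h => ?_, fun l M' h => ⟨_, .parL _ h, .symm (.parZero _)⟩⟩
    cases h with
    | glbComL _ h _ => cases h
    | glbComR _ h _ => cases h
    | parL _ h => exact ⟨_, h, .parZero _⟩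
    | parR _ h => cases h
  | parComm M N => exact ⟨.parComm _ _, .parComm _ _⟩
  | parAssoc M N O => exact ⟨.parAssoc _ _ _, .parAssoc' _ _ _⟩
  | resZero c =>
    refine ⟨fun l M' h => ?_, fun l M' h => nomatch h⟩
    cases h with | res h _ => cases h
  | resSwap c d M => exact ⟨.resSwap _ _ _, .resSwap _ _ _⟩
  | resPar h => exact ⟨.resPar _ h, .resPar' _ h⟩
  | @alpha c d M h h' =>
    refine ⟨.alpha h h', ?_⟩
    have := StepSim.alpha h.symm (alpha_symm (c := c) h').1
    rwa [(alpha_symm h').2] at this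
  | par h1 h2 ih1 ih2 => exact ⟨.par h1 h2 ih1.1 ih2.1, .par h1.symm h2.symm ih1.2 ih2.2⟩
  | res c _ ih => exact ⟨.res c ih.1, .res c ih.2⟩

theorem NCong.no_tau {M N : Network W} (h : NCong M N) (hM : ∀ M', ¬ NStep M .tau M') :
    ∀ N', ¬ NStep N .tau N' := fun _ hN => by
  obtain ⟨_, h1, _⟩ := h.stepSim.2 _ _ hN
  exact hM _ h1

theorem TimeSim.node {P Q : Proc W} (n : NodeName) (I : Iface W) (μ : Mob) (k : W.Loc)
    (h : PCong P Q) : TimeSim (.node ⟨n, I, P, μ, k⟩) (.node ⟨n, I, Q, μ, k⟩) := by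
  intro M' hM
  cases hM with
  | stat h1 h2 =>
    obtain ⟨_, h3, h4⟩ := h.time h1
    exact ⟨_, .stat h3 (NCong.no_tau (.node _ _ _ _ h) h2), .node _ _ _ _ h4⟩
  | mob h1 h2 hd =>
    obtain ⟨_, h3, h4⟩ := h.time h1
    exact ⟨_, .mob h3 (NCong.no_tau (.node _ _ _ _ h) h2) hd, .node _ _ _ _ h4⟩

open Classical in
theorem TimeSim.alpha {c d : Chan} {M : Network W} (h : d.rng = c.rng)
    (hd : ¬ M.HasFreeChan d) : TimeSim (.res c M) (.res d (M.mapChan (Equiv.swap c d))) := by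
  intro M' hM
  cases hM with
  | res _ h1 =>
    exact ⟨_, .res _ (h1.mapChan (π := Equiv.swap c d) (swap_rng h)),
      .alpha h fun h => hd (h1.hasFreeChan h)⟩

theorem TimeSim.par {M M' N N' : Network W} (h1 : NCong M M') (h2 : NCong N N')
    (hM : TimeSim M M') (hN : TimeSim N N') : TimeSim (.par M N) (.par M' N') := by
  intro O h
  cases h with
  | par h3 h4 h5 =>
    obtain ⟨_, h6, h7⟩ := hM _ h3
    obtain ⟨_, h8, h9⟩ := hN _ h4
    exact ⟨_, .par h6 h8 (NCong.no_tau (.par h1 h2) h5), .par h7 h9⟩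

/-- The premises that forbid τ are invariant under congruence by `NCong.stepSim`. What remains is to
regroup the timed transitions of the components, with side conditions of inner compositions
inherited from outer ones. -/
theorem NCong.timeSim {M N : Network W} (h : NCong M N) : TimeSim M N ∧ TimeSim N M := by
  induction h with
  | refl M => exact ⟨fun _ h => ⟨_, h, .refl _⟩, fun _ h => ⟨_, h, .refl _⟩⟩
  | symm _ ih => exact ih.symm
  | trans _ _ ih ih' =>
    refine ⟨fun _ h => ?_, fun _ h => ?_⟩
    · obtain ⟨_, h1, h2⟩ := ih.1 _ h
      obtain ⟨_, h3, h4⟩ := ih'.1 _ h1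
      exact ⟨_, h3, h2.trans h4⟩
    · obtain ⟨_, h1, h2⟩ := ih'.2 _ h
      obtain ⟨_, h3, h4⟩ := ih.2 _ h1
      exact ⟨_, h3, h2.trans h4⟩
  | node n I μ k h => exact ⟨.node n I μ k h, .node n I μ k h.symm⟩
  | parZero M =>
    refine ⟨fun M' h => ?_, fun M' h => ?_⟩
    · cases h with
      | par h1 h2 h3 => cases h2; exact ⟨_, h1, .parZero _⟩
    · exact ⟨_, .par h .zero (NCong.no_tau (.symm (.parZero _)) h.no_tau), .symm (.parZero _)⟩
  | parComm M N =>
    refine ⟨fun M' h => ?_, fun M' h => ?_⟩ <;>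
    · cases h with
      | par h1 h2 h3 => exact ⟨_, .par h2 h1 (NCong.no_tau (.parComm _ _) h3), .parComm _ _⟩
  | parAssoc M N O =>
    refine ⟨fun M' h => ?_, fun M' h => ?_⟩
    · cases h with
      | par h1 h2 h3 =>
        cases h1 with
        | par h4 h5 h6 =>
          have hn := NCong.no_tau (.parAssoc _ _ _) h3
          exact ⟨_, .par h4 (.par h5 h2 fun _ h => hn _ (.parR _ h)) hn, .parAssoc _ _ _⟩
    · cases h with
      | par h1 h2 h3 =>
        cases h2 with
        | par h4 h5 h6 =>
          have hn := NCong.no_tau (.symm (.parAssoc _ _ _)) h3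
          exact ⟨_, .par (.par h1 h4 fun _ h => hn _ (.parL _ h)) h5 hn, .symm (.parAssoc _ _ _)⟩
  | resZero c =>
    refine ⟨fun M' h => ?_, fun M' h => ?_⟩
    · cases h with | res _ h => cases h; exact ⟨_, .zero, .resZero _⟩
    · cases h; exact ⟨_, .res _ .zero, .symm (.resZero _)⟩
  | resSwap c d M =>
    refine ⟨fun M' h => ?_, fun M' h => ?_⟩ <;>
    · cases h with
      | res _ h => cases h with | res _ h => exact ⟨_, .res _ (.res _ h), .resSwap _ _ _⟩
  | @resPar c M N hc =>
    refine ⟨fun M' h => ?_, fun M' h => ?_⟩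
    · have hn := NCong.no_tau (.resPar hc) h.no_tau
      cases h with
      | res _ h =>
        cases h with
        | par h1 h2 h3 =>
          exact ⟨_, .par h1 (.res _ h2) hn, .resPar fun h => hc (h1.hasFreeChan h)⟩
    · have hn := NCong.no_tau (.symm (.resPar hc)) h.no_tau
      cases h with
      | par h1 h2 h3 =>
        cases h2 with
        | res _ h2 =>
          exact ⟨_, .res _ (.par h1 h2 fun _ h => hn _ (.res h id)),
            .symm (.resPar fun h => hc (h1.hasFreeChan h))⟩
  | @alpha c d M h h' =>
    refine ⟨.alpha h h', ?_⟩
    have := TimeSim.alpha h.symm (alpha_symm (c := c) h').1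
    rwa [(alpha_symm h').2] at this
  | par h1 h2 ih1 ih2 => exact ⟨.par h1 h2 ih1.1 ih2.1, .par h1.symm h2.symm ih1.2 ih2.2⟩
  | res c _ ih =>
    refine ⟨fun M' h => ?_, fun M' h => ?_⟩
    · cases h with | res _ h => obtain ⟨_, h1, h2⟩ := ih.1 _ h; exact ⟨_, .res _ h1, .res _ h2⟩
    · cases h with | res _ h => obtain ⟨_, h1, h2⟩ := ih.2 _ h; exact ⟨_, .res _ h1, .res _ h2⟩

end IoT

/-! ### Agreement of the reduction semantics with the labelled semantics -/

namespace IoT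

variable {W : World}

/-! ### Flat networks -/

/-- The part of a device that structural congruence does not touch. -/
def Dev.data (d : Dev W) : NodeName × Iface W × Mob × W.Loc := (d.name, d.I, d.μ, d.h)

namespace Network

theorem data_mapChan (f : Chan → Chan) (M : Network W) :
    (M.mapChan f).devs.map Dev.data = M.devs.map Dev.data := by
  induction M <;> simp_all [mapChan, devs, Dev.data]

theorem devs_prod (ds : List (Dev W)) : (prod ds).devs = ds := by
  induction ds with
  | nil => rfl
  | cons d ds ih => exact congrArg (d :: ·) ih

theorem devs_resList (cs : List Chan) (M : Network W) : (resList cs M).devs = M.devs := by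
  induction cs with
  | nil => rfl
  | cons c cs ih => exact ih

end Network

/-- Congruence reorders devices and rewrites their processes, but touches nothing else. So both the
distinctness of names and the values shown by actuators are invariants. -/
theorem NCong.perm_data {M N : Network W} (h : NCong M N) :
    (M.devs.map Dev.data).Perm (N.devs.map Dev.data) := by
  induction h with
  | refl M => exact .refl _
  | symm _ ih => exact ih.symm
  | trans _ _ ih ih' => exact ih.trans ih'
  | parComm M N => simpa [Network.devs] using List.perm_append_comm
  | alpha _ _ => simp [Network.devs, Network.data_mapChan]
  | par _ _ ih ih' => simpa [Network.devs] using ih.append ih'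
  | res c _ ih => exact ih
  | _ => simp [Network.devs, Dev.data]

theorem NCong.perm_names {M N : Network W} (h : NCong M N) :
    (M.devs.map Dev.name).Perm (N.devs.map Dev.name) := by
  have := h.perm_data.map Prod.fst
  rwa [List.map_map, List.map_map] at this

theorem exists_fresh (r : Range) {X : Set Chan} (hX : X.Finite) : ∃ c : Chan, c.rng = r ∧ c ∉ X := by
  have hinf : (Set.range fun n : ℕ => (⟨r, n⟩ : Chan)).Infinite :=
    Set.infinite_range_of_injective fun m n h => by simpa using h
  obtain ⟨_, ⟨n, rfl⟩, hn⟩ := (hinf.sdiff hX).nonempty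
  exact ⟨_, rfl, hn⟩

theorem NCong.resList (cs : List Chan) {M N : Network W} (h : NCong M N) :
    NCong (.resList cs M) (.resList cs N) := by
  induction cs with
  | nil => exact h
  | cons c cs ih => exact .res c ih

theorem NCong.par_resList {M : Network W} (N : Network W) {cs : List Chan}
    (h : ∀ c ∈ cs, ¬ M.HasFreeChan c) :
    NCong (.par M (.resList cs N)) (.resList cs (.par M N)) := by
  induction cs with
  | nil => exact .refl _
  | cons c cs ih =>
    exact .trans (.symm (.resPar (h c (by simp)))) (.res c (ih fun d hd => h d (by simp [hd])))

theorem NCong.resList_par (M : Network W) {N : Network W} {cs : List Chan}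
    (h : ∀ c ∈ cs, ¬ N.HasFreeChan c) :
    NCong (.par (.resList cs M) N) (.resList cs (.par M N)) :=
  .trans (.parComm _ _) (.trans (.par_resList _ h) (.resList _ (.parComm _ _)))

theorem NCong.prod_append (ds es : List (Dev W)) :
    NCong (.par (.prod ds) (.prod es)) (.prod (ds ++ es)) := by
  induction ds with
  | nil => exact .trans (.parComm _ _) (.parZero _)
  | cons d ds ih => exact .trans (.parAssoc _ _ _) (.par (.refl _) ih)

theorem NCong.parLeftComm (M N O : Network W) :
    NCong (.par M (.par N O)) (.par N (.par M O)) :=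
  .trans (.symm (.parAssoc _ _ _)) (.trans (.par (.parComm _ _) (.refl _)) (.parAssoc _ _ _))

theorem NCong.prod_perm {ds es : List (Dev W)} (h : ds.Perm es) :
    NCong (.prod ds) (.prod es) := by
  induction h with
  | nil => exact .refl _
  | cons d _ ih => exact .par (.refl _) ih
  | swap d e ds => exact .parLeftComm _ _ _
  | trans _ _ ih ih' => exact ih.trans ih'

open Classical in
/-- Every network is structurally congruent to one in which all restrictions are outermost and
avoid a given finite set of channels. -/
theorem exists_flat (M : Network W) {X : Set Chan} (hX : X.Finite) :
    ∃ cs ds, (∀ c ∈ cs, c ∉ X) ∧ NCong M (.resList cs (.prod ds)) := by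
  -- The statement is strengthened to all renamings of `M`: for a restriction the bound channel is
  -- first made fresh, and the induction hypothesis must then apply to the renamed body.
  suffices H : ∀ π : Equiv.Perm Chan, (∀ c, (π c).rng = c.rng) →
      ∃ cs ds, (∀ c ∈ cs, c ∉ X) ∧ NCong (M.mapChan π) (.resList cs (.prod ds)) by
    simpa [Network.mapChan_id] using H (Equiv.refl _) fun _ => rfl
  induction M generalizing X with
  | zero => exact fun π _ => ⟨[], [], by simp, .refl _⟩
  | node d => exact fun π _ => ⟨[], [_], by simp, .symm (.parZero _)⟩
  | par M N ihM ihN =>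
    intro π hπ
    -- The binders on the left avoid the right component, and those on the right then avoid the
    -- flattened left component; so both lists can be moved outwards without capture.
    obtain ⟨cs, ds, h1, h2⟩ := ihM (hX.union (N.mapChan π).finite_hasFreeChan) π hπ
    obtain ⟨bs, es, h3, h4⟩ := ihN (hX.union (Network.prod ds).finite_hasFreeChan) π hπ
    refine ⟨cs ++ bs, ds ++ es, ?_, ?_⟩
    · intro c hc
      rcases List.mem_append.1 hc with hc | hc
      · exact fun h => h1 c hc (.inl h)
      · exact fun h => h3 c hc (.inl h)
    · have h5 : NCong (.par (.resList cs (.prod ds)) (N.mapChan π))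
          (.resList cs (.par (.prod ds) (N.mapChan π))) :=
        .resList_par _ fun c hc h => h1 c hc (.inr h)
      have h6 : NCong (.par (.prod ds) (.resList bs (.prod es)))
          (.resList bs (.par (.prod ds) (.prod es))) :=
        .par_resList _ fun c hc h => h3 c hc (.inr h)
      rw [show Network.resList (cs ++ bs) (.prod (ds ++ es)) =
        .resList cs (.resList bs (.prod (ds ++ es))) from List.foldr_append]
      exact .trans (.par h2 (.refl _)) (.trans h5 (.resList cs (.trans (.par (.refl _) h4)
        (.trans h6 (.resList bs (.prod_append _ _))))))
  | res c M ih =>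
    intro π hπ
    obtain ⟨d, hd, hd'⟩ := exists_fresh (π c).rng (hX.union (M.mapChan π).finite_hasFreeChan)
    obtain ⟨cs, ds, h1, h2⟩ := ih hX (Equiv.swap (π c) d * π) fun e => by
      rw [Equiv.Perm.mul_apply, swap_rng hd, hπ]
    refine ⟨d :: cs, ds, ?_, ?_⟩
    · simpa using ⟨fun h => hd' (.inl h), h1⟩
    · refine .trans (.alpha hd fun h => hd' (.inr h)) (.res d ?_)
      rwa [Network.mapChan_mapChan]

/-! ### Adding processes to the nodes of a network -/

/-- Put the process `f n` in parallel with the process of the node `n`. -/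
def Network.addPar (f : NodeName → Proc W) : Network W → Network W
  | zero => zero
  | node d => node (d.addPar (f d.name))
  | par M N => par (addPar f M) (addPar f N)
  | res c M => res c (addPar f M)

theorem Network.addPar_prod (f : NodeName → Proc W) (ds : List (Dev W)) :
    (prod ds).addPar f = prod (ds.map fun d => d.addPar (f d.name)) := by
  induction ds with
  | nil => rfl
  | cons d ds ih => exact congrArg (Network.par _) ih

theorem NStep.addPar (f : NodeName → Proc W) {M M' : Network W} {l : NLabel W}
    (h : NStep M l M') : NStep (M.addPar f) l (M'.addPar f) := by
  induction h with
  | pos h => exact .pos (.parL _ h)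
  | sensRead h1 h => exact .sensRead h1 (.parL _ h)
  | actUnChg h1 h => exact .actUnChg h1 (.parL _ h)
  | actChg h1 h2 h => exact .actChg h1 h2 (.parL _ h)
  | locCom h => exact .locCom (.parL _ h)
  | snd h h1 => exact .snd (.parL _ h) h1
  | rcv h h1 => exact .rcv (.parL _ h) h1
  | glbComL _ _ h ih ih' => exact .glbComL ih ih' h
  | glbComR _ _ h ih ih' => exact .glbComR ih ih' h
  | parL _ _ ih => exact .parL _ ih
  | parR _ _ ih => exact .parR _ ih
  | res _ h ih => exact .res ih h

open Classical in
/-- `AddRen f X σ M M'`: the network `M'` arises from `M` by renaming the free channels by `σ`,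
renaming bound channels apart from the images of the free ones and from `X`, and putting the
process `f n` in parallel with the process of the node `n`. -/
inductive AddRen (f : NodeName → Proc W) (X : Set Chan) :
    (Chan → Chan) → Network W → Network W → Prop
  | zero (σ : Chan → Chan) : AddRen f X σ .zero .zero
  | node (σ : Chan → Chan) (d : Dev W) :
      AddRen f X σ (.node d) (.node { d with P := .par (d.P.mapChan σ) (f d.name) })
  | par {σ : Chan → Chan} {M M' N N' : Network W} :
      AddRen f X σ M M' → AddRen f X σ N N' → AddRen f X σ (.par M N) (.par M' N')
  | res {σ : Chan → Chan} {c c' : Chan} {M M' : Network W} : c'.rng = c.rng → c' ∉ X →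
      (∀ a, M.HasFreeChan a → a ≠ c → σ a ≠ c') →
      AddRen f X (Function.update σ c c') M M' → AddRen f X σ (.res c M) (.res c' M')

namespace AddRen

variable {f : NodeName → Proc W} {X : Set Chan}

theorem hasFreeChan (hf : ∀ n c, (f n).HasChan c → c ∈ X) {σ : Chan → Chan} {M M' : Network W}
    (h : AddRen f X σ M M') {c : Chan} (hc : M'.HasFreeChan c) :
    c ∈ X ∨ ∃ a, M.HasFreeChan a ∧ σ a = c := by
  induction h with
  | zero σ => exact hc.elim
  | node σ d =>
    rcases hc with hc | hc
    · exact .inr ((Proc.hasChan_mapChan _ _ _).1 hc)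
    · exact .inl (hf _ _ hc)
  | par _ _ ih ih' =>
    rcases hc with hc | hc
    · exact (ih hc).imp_right fun ⟨a, h, h'⟩ => ⟨a, .inl h, h'⟩
    · exact (ih' hc).imp_right fun ⟨a, h, h'⟩ => ⟨a, .inr h, h'⟩
  | @res σ b b' M M' _ _ _ _ ih =>
    refine (ih hc.2).imp_right fun ⟨a, h, h'⟩ => ?_
    have hab : a ≠ b := by rintro rfl; simp at h'; exact hc.1 h'.symm
    exact ⟨a, ⟨hab, h⟩, by simpa [hab] using h'⟩

theorem congr {σ τ : Chan → Chan} {M M' : Network W} (h : AddRen f X σ M M')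
    (hστ : ∀ a, M.HasFreeChan a → σ a = τ a) : AddRen f X τ M M' := by
  induction h generalizing τ with
  | zero σ => exact .zero _
  | node σ d => rw [Proc.mapChan_congr hστ]; exact .node _ _
  | par _ _ ih ih' => exact .par (ih fun a h => hστ a (.inl h)) (ih' fun a h => hστ a (.inr h))
  | res h1 h2 h3 _ ih =>
    refine .res h1 h2 (fun a ha hac => hστ a ⟨hac, ha⟩ ▸ h3 a ha hac) (ih fun a ha => ?_)
    simp only [Function.update_apply]
    split_ifs with hac
    exacts [rfl, hστ a ⟨hac, ha⟩]

theorem comp_perm (hf : ∀ n c, (f n).HasChan c → c ∈ X) {π : Equiv.Perm Chan}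
    (hπ : ∀ c, (π c).rng = c.rng) (hX : ∀ c ∈ X, π c = c) {σ : Chan → Chan} {M M' : Network W}
    (h : AddRen f X σ M M') : AddRen f X (π ∘ σ) M (M'.mapChan π) := by
  classical
  induction h with
  | zero σ => exact .zero _
  | node σ d =>
    have h1 : (f d.name).mapChan π = f d.name := by
      rw [Proc.mapChan_congr (g := id) fun c hc => hX c (hf _ _ hc), Proc.mapChan_id]
    simp only [Network.mapChan, Proc.mapChan, Proc.mapChan_mapChan, h1]
    exact .node _ _
  | par _ _ ih ih' => exact .par ih ih'
  | @res σ c c' M M' h1 h2 h3 _ ih =>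
    refine .res ((hπ _).trans h1) (fun h => h2 ?_) (fun a ha hac h => h3 a ha hac (π.injective h)) ?_
    · rwa [π.injective (hX _ h)] at h
    · rwa [← Function.comp_update]

theorem mapChan {π : Equiv.Perm Chan} (hπ : ∀ c, (π c).rng = c.rng) {σ : Chan → Chan}
    {M M' : Network W} (h : AddRen f X (σ ∘ π) M M') : AddRen f X σ (M.mapChan π) M' := by
  induction M generalizing σ M' with
  | zero => cases h; exact .zero _
  | node d =>
    cases h
    rw [← Proc.mapChan_mapChan]
    exact .node σ { d with P := d.P.mapChan π }
  | par M N ih ih' => cases h with | par h h' => exact .par (ih h) (ih' h')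
  | res c M ih =>
    cases h with
    | res h1 h2 h3 h4 =>
      refine .res (h1.trans (hπ _).symm) h2 (fun a ha hac => ?_) (ih ?_)
      · rw [← π.apply_symm_apply a] at ha hac ⊢
        rw [Network.hasFreeChan_mapChan] at ha
        exact h3 _ ha fun h => hac (h ▸ rfl)
      · convert h4 using 1
        funext a
        by_cases hac : a = c
        · subst hac; simp
        · simp [Function.update_of_ne, hac]

theorem exists_fresh (hX : X.Finite) (r : Range) (σ : Chan → Chan) (M N : Network W) :
    ∃ e : Chan, e.rng = r ∧ e ∉ X ∧ (∀ a, M.HasFreeChan a → σ a ≠ e) ∧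
      ∀ a, N.HasFreeChan a → σ a ≠ e := by
  obtain ⟨e, h1, h2⟩ := IoT.exists_fresh r (hX.union ((M.finite_hasFreeChan.image σ).union
    (N.finite_hasFreeChan.image σ)))
  exact ⟨e, h1, fun h => h2 (.inl h), fun a ha h => h2 (.inr (.inl ⟨a, ha, h⟩)),
    fun a ha h => h2 (.inr (.inr ⟨a, ha, h⟩))⟩

theorem exists_addRen (f : NodeName → Proc W) (hX : X.Finite) (σ : Chan → Chan) (M : Network W) :
    ∃ M', AddRen f X σ M M' := by
  classical
  induction M generalizing σ with
  | zero => exact ⟨_, .zero _⟩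
  | node d => exact ⟨_, .node _ _⟩
  | par M N ih ih' =>
    obtain ⟨_, h⟩ := ih σ
    obtain ⟨_, h'⟩ := ih' σ
    exact ⟨_, .par h h'⟩
  | res c M ih =>
    obtain ⟨e, h1, h2, h3, _⟩ := exists_fresh hX c.rng σ M M
    obtain ⟨_, h⟩ := ih (Function.update σ c e)
    exact ⟨_, .res h1 h2 (fun a ha _ => h3 a ha) h⟩

/-- Two such networks differ only in the fresh names chosen for bound channels, which α-conversion
identifies. The name chosen by one side does not occur free in the body on the other side, so
swapping the two names is a legitimate renaming. -/
theorem unique (hf : ∀ n c, (f n).HasChan c → c ∈ X) {σ : Chan → Chan} {M M' M'' : Network W}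
    (h : AddRen f X σ M M') (h' : AddRen f X σ M M'') : NCong M' M'' := by
  classical
  induction M generalizing σ M' M'' with
  | zero => cases h; cases h'; exact .refl _
  | node d => cases h; cases h'; exact .refl _
  | par M N ih ih' =>
    cases h with
    | par h1 h2 => cases h' with | par h3 h4 => exact .par (ih h1 h3) (ih' h2 h4)
  | res c M ih =>
    cases h with
    | @res _ _ d _ M' h1 h2 h3 h4 =>
    cases h' with
    | @res _ _ e _ M'' h5 h6 h7 h8 =>
    by_cases hde : d = e
    · subst hde; exact .res _ (ih h4 h8)
    have hfree : ¬ M'.HasFreeChan e := fun h => by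
      rcases h4.hasFreeChan hf h with h | ⟨a, ha, ha'⟩
      · exact h6 h
      · by_cases hac : a = c
        · subst hac; simp at ha'; exact hde ha'
        · exact h7 a ha hac (by simpa [hac] using ha')
    refine .trans (.alpha (h5.trans h1.symm) hfree) (.res e (ih ?_ h8))
    have h9 := h4.comp_perm hf (π := Equiv.swap d e) (swap_rng (h5.trans h1.symm))
      (fun x hx => Equiv.swap_apply_of_ne_of_ne (by rintro rfl; exact h2 hx)
        (by rintro rfl; exact h6 hx))
    convert h9.congr (τ := Function.update σ c e) fun a ha => ?_
    by_cases hac : a = c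
    · subst hac; simp
    · simp only [Function.comp_apply, Function.update_of_ne hac]
      exact Equiv.swap_apply_of_ne_of_ne (h3 a ha hac) (h7 a ha hac)

/-- The point of `AddRen`: a derivation of a congruence can be replayed with processes added to the
nodes, because every binder occurring in it has been renamed away from their channels. Transitivity
needs `unique`, since the two halves may have chosen different names for the middle network. -/
theorem exists_ncong (hX : X.Finite) (hf : ∀ n c, (f n).HasChan c → c ∈ X) {M N : Network W}
    (h : NCong M N) (σ : Chan → Chan) :
    ∃ M' N', AddRen f X σ M M' ∧ AddRen f X σ N N' ∧ NCong M' N' := by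
  classical
  induction h generalizing σ with
  | refl M =>
    obtain ⟨M', h⟩ := exists_addRen f hX σ M
    exact ⟨_, _, h, h, .refl _⟩
  | symm _ ih =>
    obtain ⟨_, _, h1, h2, h3⟩ := ih σ
    exact ⟨_, _, h2, h1, h3.symm⟩
  | trans _ _ ih ih' =>
    obtain ⟨_, _, h1, h2, h3⟩ := ih σ
    obtain ⟨_, _, h4, h5, h6⟩ := ih' σ
    exact ⟨_, _, h1, h5, h3.trans ((h2.unique hf h4).trans h6)⟩
  | node n I μ k h =>
    exact ⟨_, _, .node _ _, .node _ _, .node _ _ _ _ (.par (h.mapChan σ) (.refl _))⟩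
  | parZero M =>
    obtain ⟨M', h⟩ := exists_addRen f hX σ M
    exact ⟨_, _, .par h (.zero _), h, .parZero _⟩
  | parComm M N =>
    obtain ⟨M', h⟩ := exists_addRen f hX σ M
    obtain ⟨N', h'⟩ := exists_addRen f hX σ N
    exact ⟨_, _, .par h h', .par h' h, .parComm _ _⟩
  | parAssoc M N O =>
    obtain ⟨M', h⟩ := exists_addRen f hX σ M
    obtain ⟨N', h'⟩ := exists_addRen f hX σ N
    obtain ⟨O', h''⟩ := exists_addRen f hX σ O
    exact ⟨_, _, .par (.par h h') h'', .par h (.par h' h''), .parAssoc _ _ _⟩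
  | resZero c =>
    obtain ⟨e, h1, h2, -⟩ := exists_fresh hX c.rng σ (.zero : Network W) .zero
    exact ⟨_, _, .res h1 h2 (fun a ha => ha.elim) (.zero _), .zero _, .resZero _⟩
  | resSwap c d M =>
    -- If the two binders coincide, both sides are the same network. Otherwise the two updates of
    -- the renaming commute.
    by_cases hcd : c = d
    · subst hcd
      obtain ⟨M', h⟩ := exists_addRen f hX σ (.res c (.res c M))
      exact ⟨_, _, h, h, .refl _⟩
    obtain ⟨e, h1, h2, h3, -⟩ := exists_fresh hX c.rng σ M M
    obtain ⟨e', h4, h5⟩ := IoT.exists_fresh d.rng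
      ((hX.union (M.finite_hasFreeChan.image σ)).union (Set.finite_singleton e))
    have h6 : ∀ a, M.HasFreeChan a → σ a ≠ e' := fun a ha h => h5 (.inl (.inr ⟨a, ha, h⟩))
    have h7 : e ≠ e' := fun h => h5 (.inr h.symm)
    have h8 : e' ∉ X := fun h => h5 (.inl (.inl h))
    obtain ⟨M', h⟩ := exists_addRen f hX (Function.update (Function.update σ c e) d e') M
    refine ⟨.res e (.res e' M'), .res e' (.res e M'), .res h1 h2 (fun a ha _ => h3 a ha.2)
      (.res h4 h8 (fun a ha _ => ?_) h), .res h4 h8 (fun a ha _ => h6 a ha.2)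
      (.res h1 h2 (fun a ha _ => ?_) ?_), .resSwap _ _ _⟩
    · simp only [Function.update_apply]
      split_ifs
      exacts [h7, h6 a ha]
    · simp only [Function.update_apply]
      split_ifs
      exacts [h7.symm, h3 a ha]
    · rwa [Function.update_comm (Ne.symm hcd)]
  | @resPar c M N hc =>
    obtain ⟨e, h1, h2, h3, h4⟩ := exists_fresh hX c.rng σ M N
    obtain ⟨M', h⟩ := exists_addRen f hX σ M
    obtain ⟨N', h'⟩ := exists_addRen f hX (Function.update σ c e) N
    refine ⟨_, _, .res h1 h2 (fun a ha _ => ha.elim (h3 a) (h4 a)) (.par (h.congr fun a ha => ?_) h'),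
      .par h (.res h1 h2 (fun a ha _ => h4 a ha) h'), .resPar fun he => ?_⟩
    · rw [Function.update_of_ne (by rintro rfl; exact hc ha)]
    · rcases h.hasFreeChan hf he with he | ⟨a, ha, ha'⟩
      exacts [h2 he, h3 a ha ha']
  | @alpha c d M hr hd =>
    obtain ⟨e, h1, h2, h3, h4⟩ := exists_fresh hX c.rng σ M (M.mapChan (Equiv.swap c d))
    obtain ⟨M', h⟩ := exists_addRen f hX (Function.update σ c e) M
    refine ⟨_, _, .res h1 h2 (fun a ha _ => h3 a ha) h,
      .res (h1.trans hr.symm) h2 (fun a ha _ => h4 a (by convert ha)) ?_, .refl _⟩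
    convert AddRen.mapChan (π := Equiv.swap c d) (swap_rng hr) (σ := Function.update σ d e)
      (h.congr fun a ha => ?_)
    by_cases hac : a = c
    · subst hac; simp
    · have had : a ≠ d := by rintro rfl; exact hd ha
      simp [hac, had, Equiv.swap_apply_of_ne_of_ne hac had]
  | par _ _ ih ih' =>
    obtain ⟨_, _, h1, h2, h3⟩ := ih σ
    obtain ⟨_, _, h4, h5, h6⟩ := ih' σ
    exact ⟨_, _, .par h1 h4, .par h2 h5, .par h3 h6⟩
  | @res c M N _ ih =>
    obtain ⟨e, h1, h2, h3, h4⟩ := exists_fresh hX c.rng σ M N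
    obtain ⟨_, _, h5, h6, h7⟩ := ih (Function.update σ c e)
    exact ⟨_, _, .res h1 h2 (fun a ha _ => h3 a ha) h5, .res h1 h2 (fun a ha _ => h4 a ha) h6,
      .res e h7⟩

theorem prod (f : NodeName → Proc W) (X : Set Chan) (ds : List (Dev W)) :
    AddRen f X id (.prod ds) ((Network.prod ds).addPar f) := by
  induction ds with
  | nil => exact .zero _
  | cons d ds ih =>
    refine .par ?_ ih
    have := AddRen.node (f := f) (X := X) id d
    rwa [Proc.mapChan_id] at this

end AddRen

/-- Without restrictions at either end nothing has to be renamed there, so the replayed derivation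
ends at the intended networks, even if the original one passed through binders of channels in `X`.
-/
theorem NCong.addPar_prod {f : NodeName → Proc W} {X : Set Chan} (hX : X.Finite)
    (hf : ∀ n c, (f n).HasChan c → c ∈ X) {ds es : List (Dev W)}
    (h : NCong (.prod ds) (.prod es)) :
    NCong ((Network.prod ds).addPar f) ((Network.prod es).addPar f) := by
  obtain ⟨_, _, h1, h2, h3⟩ := AddRen.exists_ncong hX hf h id
  exact ((AddRen.prod f X ds).unique hf h1).trans (h3.trans (h2.unique hf (AddRen.prod f X es)))

/-! ### Reductions are transitions -/

def RLabel.toNLabel : RLabel → NLabel W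
  | .tau => .tau
  | .act a => .act a

theorem NStep.exists_node {d : Dev W} {l : NLabel W} {N : Network W} (h : NStep (.node d) l N) :
    ∃ d', N = .node d' := by
  cases h <;> exact ⟨_, rfl⟩

theorem NStep.exists_prod {ds : List (Dev W)} {l : NLabel W} {N : Network W}
    (h : NStep (.prod ds) l N) : ∃ es, N = .prod es := by
  induction ds generalizing l N with
  | nil => cases h
  | cons d ds ih =>
    cases h with
    | glbComL h1 h2 _ =>
      obtain ⟨d', rfl⟩ := h1.exists_node
      obtain ⟨es, rfl⟩ := ih h2
      exact ⟨d' :: es, rfl⟩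
    | glbComR h1 h2 _ =>
      obtain ⟨d', rfl⟩ := h1.exists_node
      obtain ⟨es, rfl⟩ := ih h2
      exact ⟨d' :: es, rfl⟩
    | parL _ h1 => obtain ⟨d', rfl⟩ := h1.exists_node; exact ⟨d' :: ds, rfl⟩
    | parR _ h2 => obtain ⟨es, rfl⟩ := ih h2; exact ⟨d :: es, rfl⟩

/-- A finite assignment of processes to distinct names is the restriction of a function that
uses finitely many channels. -/
theorem exists_assignment (l : List (NodeName × Proc W)) (h : (l.map Prod.fst).Nodup) :
    ∃ (f : NodeName → Proc W) (X : Set Chan), X.Finite ∧ (∀ n c, (f n).HasChan c → c ∈ X) ∧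
      ∀ t ∈ l, f t.1 = t.2 := by
  induction l with
  | nil => exact ⟨fun _ => .nil, ∅, Set.finite_empty, fun _ _ h => h.elim, by simp⟩
  | cons t l ih =>
    rw [List.map_cons, List.nodup_cons] at h
    obtain ⟨f, X, h1, h2, h3⟩ := ih h.2
    refine ⟨Function.update f t.1 t.2, X ∪ {c | t.2.HasChan c}, h1.union t.2.finite_hasChan,
      fun n c hc => ?_, fun u hu => ?_⟩
    · by_cases hn : n = t.1
      · subst hn; simp at hc; exact .inr hc
      · rw [Function.update_of_ne hn] at hc; exact .inl (h2 _ _ hc)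
    · rcases List.mem_cons.1 hu with rfl | hu
      · simp
      · rw [Function.update_of_ne, h3 u hu]
        rintro h'
        exact h.1 (h' ▸ List.mem_map_of_mem hu)

/-- The critical rule is `parP`. Because node names are distinct, the added processes form a
function of the name; the transition obtained for the smaller network is extended by `NStep.addPar`,
and the congruence to its target by `NCong.addPar_prod`. The rule of structural congruence is
absorbed by `NCong.stepSim`. -/
theorem RedInst.nstep {ω : RLabel} {M M' : Network W} (h : RedInst ω M M')
    (hn : (M.devs.map Dev.name).Nodup) : ∃ N, NStep M ω.toNLabel N ∧ NCong N M' := by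
  induction h with
  | pos n I P μ h => exact ⟨_, .pos (.pos _ _), .refl _⟩
  | sensread n I s P μ h hs => exact ⟨_, .sensRead hs (.sens _ _ _), .refl _⟩
  | actunchg n I a P μ h ha => exact ⟨_, .actUnChg ha (.act _ _ _), .refl _⟩
  | actchg n I a P μ h ha hv => exact ⟨_, .actChg ha hv (.act _ _ _), .refl _⟩
  | loccom n I c v P R Q S μ h hc =>
    exact ⟨_, .locCom (.comL (.snd _ _ _ _) (.rcv _ _ _ _) hc), .refl _⟩
  | glbcom n m I J c v P R Q S μ₁ μ₂ h k hc =>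
    have hr : c.rng ≠ .intra := fun h => by rw [h] at hc; exact hc
    exact ⟨_, .glbComL (.snd (.snd _ _ _ _) hr) (.rcv (.rcv _ _ _ _) hr)
      (by rwa [W.dist_comm]), .refl _⟩
  | @parP ω l hname _ ih =>
    have hn' : ((l.map fun t => (t.1.name, t.2.2)).map Prod.fst).Nodup := by
      simpa [Network.devs_prod, Function.comp_def, Dev.addPar] using hn
    obtain ⟨f, X, hX, hf, hfl⟩ := exists_assignment _ hn'
    obtain ⟨N, h1, h2⟩ := ih (by simpa [Network.devs_prod, Function.comp_def] using hn')
    obtain ⟨es, rfl⟩ := h1.exists_prod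
    have h3 : ∀ t ∈ l, f t.1.name = t.2.2 := fun t ht =>
      hfl (t.1.name, t.2.2) (List.mem_map_of_mem ht)
    have h4 := h1.addPar f
    have h5 := NCong.addPar_prod hX hf h2
    rw [Network.addPar_prod, List.map_map, List.map_congr_left
      (g := fun t => t.1.addPar t.2.2) fun t ht => by simp [h3 t ht]] at h4
    rw [Network.addPar_prod f (List.map _ l), List.map_map, List.map_congr_left
      (g := fun t => t.2.1.addPar t.2.2) fun t ht => by simp [← hname t ht, h3 t ht]] at h5
    exact ⟨_, h4, h5⟩
  | parN N _ ih =>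
    obtain ⟨N', h1, h2⟩ := ih (by
      rw [Network.devs, List.map_append] at hn; exact (List.nodup_append.1 hn).1)
    exact ⟨_, .parL _ h1, .par h2 (.refl _)⟩
  | @res ω _ _ c _ ih =>
    obtain ⟨N', h1, h2⟩ := ih hn
    exact ⟨_, .res h1 (by cases ω <;> exact id), .res c h2⟩
  | struct h1 _ h2 ih =>
    obtain ⟨N', h3, h4⟩ := ih (h1.perm_names.nodup_iff.1 hn)
    obtain ⟨N'', h5, h6⟩ := h1.stepSim.2 _ _ h3
    exact ⟨_, h5, h6.symm.trans (h4.trans h2)⟩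

/-! ### Transitions are reductions -/

/-- Transitions of a process that consume prefixes on top of it. -/
inductive HeadStep : PLabel W → Proc W → Proc W → Prop
  | snd (c : Chan) (v : W.V) (P Q : Proc W) : HeadStep (.snd c v) (.snd c (.val v) P Q) P
  | rcv (c : Chan) (v : W.V) (P Q : Proc W) : HeadStep (.rcv c v) (.rcv c P Q) (P.inst v)
  | sens (s : Sens) (v : W.V) (P : Proc W) : HeadStep (.sens s v) (.sens s P) (P.inst v)
  | act (a : Act) (v : W.V) (P : Proc W) : HeadStep (.act a v) (.act a (.val v) P) P
  | pos (h : W.Loc) (P : Proc W) : HeadStep (.pos h) (.pos P) (P.inst (.loc h))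
  | com (c : Chan) (v : W.V) (P Q R S : Proc W) : c.rng = .intra →
      HeadStep .tau (.par (.snd c (.val v) P R) (.rcv c Q S)) (.par P (Q.inst v))

theorem PCong.parParComm (A S B T : Proc W) :
    PCong (.par (.par A S) (.par B T)) (.par (.par A B) (.par S T)) :=
  .trans (.parAssoc _ _ _) (.trans (.par (.refl _) (.trans (.symm (.parAssoc _ _ _))
    (.trans (.par (.parComm _ _) (.refl _)) (.parAssoc _ _ _)))) (.symm (.parAssoc _ _ _)))

/-- A transition may originate below parallel compositions, recursions and conditionals. Structural
congruence removes all of these and exposes the active prefixes beside an idle remainder `S`, which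
is the shape required by the reduction axioms. -/
theorem PStep.exists_headStep {P P' : Proc W} {l : PLabel W} (h : PStep P l P') :
    ∃ A A' S, HeadStep l A A' ∧ PCong P (.par A S) ∧ PCong P' (.par A' S) := by
  induction h with
  | snd c v P Q => exact ⟨_, _, .nil, .snd _ _ _ _, .symm (.parNil _), .symm (.parNil _)⟩
  | rcv c v P Q => exact ⟨_, _, .nil, .rcv _ _ _ _, .symm (.parNil _), .symm (.parNil _)⟩
  | sens s v P => exact ⟨_, _, .nil, .sens _ _ _, .symm (.parNil _), .symm (.parNil _)⟩
  | act a v P => exact ⟨_, _, .nil, .act _ _ _, .symm (.parNil _), .symm (.parNil _)⟩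
  | pos k P => exact ⟨_, _, .nil, .pos _ _, .symm (.parNil _), .symm (.parNil _)⟩
  | comL _ _ hc ih ih' =>
    obtain ⟨_, _, S, h1, h2, h3⟩ := ih
    obtain ⟨_, _, T, h4, h5, h6⟩ := ih'
    cases h1; cases h4
    exact ⟨_, _, .par S T, .com _ _ _ _ _ _ hc, .trans (.par h2 h5) (.parParComm _ _ _ _),
      .trans (.par h3 h6) (.parParComm _ _ _ _)⟩
  | comR _ _ hc ih ih' =>
    obtain ⟨_, _, S, h1, h2, h3⟩ := ih
    obtain ⟨_, _, T, h4, h5, h6⟩ := ih'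
    cases h1; cases h4
    exact ⟨_, _, .par T S, .com _ _ _ _ _ _ hc,
      .trans (.parComm _ _) (.trans (.par h5 h2) (.parParComm _ _ _ _)),
      .trans (.parComm _ _) (.trans (.par h6 h3) (.parParComm _ _ _ _))⟩
  | parL Q _ ih =>
    obtain ⟨_, _, S, h1, h2, h3⟩ := ih
    exact ⟨_, _, .par S Q, h1, .trans (.par h2 (.refl _)) (.parAssoc _ _ _),
      .trans (.par h3 (.refl _)) (.parAssoc _ _ _)⟩
  | parR P _ ih =>
    obtain ⟨_, _, S, h1, h2, h3⟩ := ih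
    exact ⟨_, _, .par S P, h1,
      .trans (.parComm _ _) (.trans (.par h2 (.refl _)) (.parAssoc _ _ _)),
      .trans (.parComm _ _) (.trans (.par h3 (.refl _)) (.parAssoc _ _ _))⟩
  | fix _ ih =>
    obtain ⟨_, _, S, h1, h2, h3⟩ := ih
    exact ⟨_, _, S, h1, .trans (.unfold _) h2, h3⟩
  | condTrue hg _ ih =>
    obtain ⟨_, _, S, h1, h2, h3⟩ := ih
    exact ⟨_, _, S, h1, .trans (.condTrue hg) h2, h3⟩
  | condFalse hg _ ih =>
    obtain ⟨_, _, S, h1, h2, h3⟩ := ih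
    exact ⟨_, _, S, h1, .trans (.condFalse hg) h2, h3⟩

theorem RedInst.node {ω : RLabel} {n : NodeName} {I I' : Iface W} {A A' S P P' : Proc W} {μ : Mob}
    {k : W.Loc} (h : RedInst ω (.node ⟨n, I, A, μ, k⟩) (.node ⟨n, I', A', μ, k⟩))
    (h1 : PCong P (.par A S)) (h2 : PCong P' (.par A' S)) :
    RedInst ω (.node ⟨n, I, P, μ, k⟩) (.node ⟨n, I', P', μ, k⟩) :=
  -- The rule `parP` is used for a list with one device. Such a product ends in `zero`, which is
  -- inserted before the reduction and removed after it.
  .struct (.trans (.node _ _ _ _ h1) (.symm (.parZero _)))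
    (.parP [(⟨n, I, A, μ, k⟩, ⟨n, I', A', μ, k⟩, S)] (by simp) (.parN .zero h))
    (.trans (.parZero _) (.node _ _ _ _ h2.symm))

theorem NStep.redInst_node {ω : RLabel} {d : Dev W} {N : Network W}
    (h : NStep (.node d) ω.toNLabel N) : RedInst ω (.node d) N := by
  generalize hl : ω.toNLabel = l at h
  cases h <;> cases ω <;> cases hl <;> rename_i h
  case pos =>
    obtain ⟨_, _, S, h1, h2, h3⟩ := h.exists_headStep
    cases h1; exact .node (.pos _ _ _ _ _) h2 h3
  case sensRead h0 =>
    obtain ⟨_, _, S, h1, h2, h3⟩ := h.exists_headStep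
    cases h1; exact .node (.sensread _ _ _ _ _ _ h0) h2 h3
  case actUnChg h0 =>
    obtain ⟨_, _, S, h1, h2, h3⟩ := h.exists_headStep
    cases h1; exact .node (.actunchg _ _ _ _ _ _ h0) h2 h3
  case actChg h0 h0' =>
    obtain ⟨_, _, S, h1, h2, h3⟩ := h.exists_headStep
    cases h1; exact .node (.actchg _ _ _ _ _ _ h0 h0') h2 h3
  case locCom =>
    obtain ⟨_, _, S, h1, h2, h3⟩ := h.exists_headStep
    cases h1; exact .node (.loccom _ _ _ _ _ _ _ _ _ _ ‹_›) h2 h3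

theorem NStep.redInst_com {d d' e e' : Dev W} {c : Chan} {v : W.V} {h k : W.Loc}
    (h1 : NStep (.node d) (.snd c v k) (.node d')) (h2 : NStep (.node e) (.rcv c v h) (.node e'))
    (h3 : c.rng.Covers (W.dist h k)) :
    RedInst .tau (.par (.node d) (.node e)) (.par (.node d') (.node e')) := by
  cases h1 with
  | @snd n I P P' μ _ _ _ h4 _ =>
  cases h2 with
  | @rcv m J Q Q' μ' _ _ _ h5 _ =>
  obtain ⟨_, _, S, h6, h7, h8⟩ := h4.exists_headStep
  obtain ⟨_, _, T, h9, h10, h11⟩ := h5.exists_headStep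
  cases h6 with
  | snd _ _ _ R =>
  cases h9 with
  | rcv _ _ Q R' =>
  -- Here `parP` acts on a list of two devices, adding both idle remainders at once; again the
  -- trailing `zero` has to be inserted and removed.
  refine .struct (.par (.node _ _ _ _ h7) (.trans (.node _ _ _ _ h10) (.symm (.parZero _))))
    (.parP [(⟨n, I, .snd c (.val v) _ R, μ, k⟩, ⟨n, I, _, μ, k⟩, S),
      (⟨m, J, .rcv c Q R', μ', h⟩, ⟨m, J, _, μ', h⟩, T)] (by simp)
      (.struct (.symm (.parAssoc _ _ _)) (.parN .zero (.glbcom _ _ _ _ _ _ _ _ _ _ _ _ _ _ ?_))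
        (.parAssoc _ _ _)))
    (.par (.node _ _ _ _ h8.symm) (.trans (.parZero _) (.node _ _ _ _ h11.symm)))
  rwa [W.dist_comm]

/-- A visible action of a product belongs to a single device, which can be moved to the front. In a
communication this places the partner next to the other device, as the axiom `glbcom` demands. -/
theorem NStep.exists_sender {ds : List (Dev W)} {l : NLabel W} (hl : l ≠ .tau) {N : Network W}
    (h : NStep (.prod ds) l N) : ∃ e e' O, NStep (.node e) l (.node e') ∧
      NCong (.prod ds) (.par (.node e) O) ∧ NCong N (.par (.node e') O) := by
  induction ds generalizing N with
  | nil => cases h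
  | cons d ds ih =>
    cases h with
    | glbComL _ _ _ => exact (hl rfl).elim
    | glbComR _ _ _ => exact (hl rfl).elim
    | parL _ h =>
      obtain ⟨d', rfl⟩ := h.exists_node
      exact ⟨_, _, _, h, .refl _, .refl _⟩
    | parR _ h =>
      obtain ⟨e, e', O, h1, h2, h3⟩ := ih h
      exact ⟨e, e', .par (.node d) O, h1, .trans (.par (.refl _) h2) (.parLeftComm _ _ _),
        .trans (.par (.refl _) h3) (.parLeftComm _ _ _)⟩

theorem NStep.redInst_prod {ω : RLabel} {ds : List (Dev W)} {N : Network W}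
    (h : NStep (.prod ds) ω.toNLabel N) : RedInst ω (.prod ds) N := by
  induction ds generalizing N with
  | nil => cases h
  | cons d ds ih =>
    change NStep (.par (.node d) (.prod ds)) _ _ at h
    generalize hl : ω.toNLabel = l at h
    cases h with
    | glbComL h1 h2 h3 =>
      cases ω <;> cases hl
      obtain ⟨d', rfl⟩ := h1.exists_node
      obtain ⟨e, e', O, h4, h5, h6⟩ := h2.exists_sender (by simp)
      exact .struct (.trans (.par (.refl _) h5) (.symm (.parAssoc _ _ _)))
        (.parN O (h1.redInst_com h4 h3)) (.trans (.parAssoc _ _ _) (.par (.refl _) h6.symm))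
    | glbComR h1 h2 h3 =>
      cases ω <;> cases hl
      obtain ⟨d', rfl⟩ := h1.exists_node
      obtain ⟨e, e', O, h4, h5, h6⟩ := h2.exists_sender (by simp)
      exact .struct (.trans (.par (.refl _) h5) (.trans (.parLeftComm _ _ _)
        (.symm (.parAssoc _ _ _)))) (.parN O (h4.redInst_com h1 h3))
        (.trans (.parAssoc _ _ _) (.trans (.parLeftComm _ _ _) (.par (.refl _) h6.symm)))
    | parL _ h => subst hl; exact .parN _ h.redInst_node
    | parR _ h => subst hl; exact .struct (.parComm _ _) (.parN _ (ih h)) (.parComm _ _)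

theorem NStep.redInst_resList {ω : RLabel} {cs : List Chan} {ds : List (Dev W)} {N : Network W}
    (h : NStep (.resList cs (.prod ds)) ω.toNLabel N) : RedInst ω (.resList cs (.prod ds)) N := by
  induction cs generalizing N with
  | nil => exact h.redInst_prod
  | cons c cs ih => cases h with | res h _ => exact .res c (ih h)

/-- Communicating devices may be separated by restrictions in the syntax. After flattening, the
network is a product under outermost restrictions, where partners can be made adjacent. -/
theorem NStep.redInst {ω : RLabel} {M N : Network W} (h : NStep M ω.toNLabel N) :
    RedInst ω M N := by
  obtain ⟨cs, ds, -, h1⟩ := exists_flat M Set.finite_empty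
  obtain ⟨_, h2, h3⟩ := h1.stepSim.1 _ _ h
  exact .struct h1 h2.redInst_resList h3.symm

theorem not_nstep_tau {M : Network W} (h : ∀ M', ¬ RedInst .tau M M') :
    ∀ M', ¬ NStep M .tau M' := fun _ hM => h _ (NStep.redInst (ω := .tau) hM)

/-- This serves the negative premises of the timed reductions. Turning a hypothetical reduction into
a transition uses `RedInst.nstep`, hence the condition on names. -/
theorem not_redInst_tau {M : Network W} (hn : (M.devs.map Dev.name).Nodup)
    (h : ∀ M', ¬ NStep M .tau M') : ∀ M', ¬ RedInst .tau M M' := fun _ hM => by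
  obtain ⟨_, h1, _⟩ := hM.nstep hn
  exact h _ h1

/-! ### Timed reductions and timed transitions -/

theorem PTime.prod_timeout {ts : List (Proc W × Proc W)}
    (hts : ∀ t ∈ ts, Proc.IsTimeout t.1 t.2)
    (hn : ∀ R, ¬ PStep (Proc.prod (ts.map fun t => t.1)) .tau R) :
    PTime (Proc.prod (ts.map fun t => t.1)) (Proc.prod (ts.map fun t => t.2)) := by
  induction ts with
  | nil => exact .nil
  | cons t ts ih =>
    refine .par ?_ (ih (fun u hu => hts u (by simp [hu])) fun R hR => hn _ (.parR _ hR)) hn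
    rcases hts t List.mem_cons_self with ⟨c, e, P, h⟩ | ⟨c, P, h⟩
    · simpa only [h] using PTime.timeoutSnd c e P t.2
    · simpa only [h] using PTime.timeoutRcv c P t.2

theorem PTime.prod_sigma {rs : List (Proc W)}
    (hn : ∀ R, ¬ PStep (Proc.prod (rs.map .sigma)) .tau R) :
    PTime (Proc.prod (rs.map .sigma)) (Proc.prod rs) := by
  induction rs with
  | nil => exact .nil
  | cons r rs ih => exact .par (.delay _) (ih fun R hR => hn _ (.parR _ hR)) hn

theorem PTime.normal {ts : List (Proc W × Proc W)} {rs : List (Proc W)}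
    (hts : ∀ t ∈ ts, Proc.IsTimeout t.1 t.2)
    (hn : ∀ R, ¬ PStep (.par (Proc.prod (ts.map fun t => t.1)) (Proc.prod (rs.map .sigma))) .tau R) :
    PTime (.par (Proc.prod (ts.map fun t => t.1)) (Proc.prod (rs.map .sigma)))
      (.par (Proc.prod (ts.map fun t => t.2)) (Proc.prod rs)) :=
  .par (.prod_timeout hts fun _ hR => hn _ (.parL _ hR)) (.prod_sigma fun _ hR => hn _ (.parR _ hR)) hn

theorem RedTime.ntime {M M' : Network W} (h : RedTime M M') : ∃ N, NTime M N ∧ NCong N M' := by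
  induction h with
  | timestat n I ts rs k hts hn =>
    have hn' := not_nstep_tau hn
    exact ⟨_, .stat (.normal hts fun R hR => hn' _ (.locCom hR)) hn', .refl _⟩
  | timemob n I ts rs h k hts hn hd =>
    have hn' := not_nstep_tau hn
    exact ⟨_, .mob (.normal hts fun R hR => hn' _ (.locCom hR)) hn' hd, .refl _⟩
  | timepar _ _ hn ih ih' =>
    obtain ⟨_, h1, h2⟩ := ih
    obtain ⟨_, h3, h4⟩ := ih'
    exact ⟨_, .par h1 h3 (not_nstep_tau hn), .par h2 h4⟩
  | timezero => exact ⟨_, .zero, .refl _⟩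
  | res c _ ih =>
    obtain ⟨_, h1, h2⟩ := ih
    exact ⟨_, .res c h1, .res c h2⟩
  | struct h1 _ h2 ih =>
    obtain ⟨_, h3, h4⟩ := ih
    obtain ⟨_, h5, h6⟩ := h1.timeSim.2 _ h3
    exact ⟨_, h5, h6.symm.trans (h4.trans h2)⟩

theorem PCong.prod_append (l l' : List (Proc W)) :
    PCong (.par (Proc.prod l) (Proc.prod l')) (Proc.prod (l ++ l')) := by
  induction l with
  | nil => exact .trans (.parComm _ _) (.parNil _)
  | cons P l ih => exact .trans (.parAssoc _ _ _) (.par (.refl _) ih)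

/-- A process that lets time pass has only timeouts and sleeping prefixes at its top. Up to
congruence they can be sorted into the two products that the timed reduction axioms prescribe. -/
theorem PTime.exists_normal {P P' : Proc W} (h : PTime P P') :
    ∃ (ts : List (Proc W × Proc W)) (rs : List (Proc W)),
      (∀ t ∈ ts, Proc.IsTimeout t.1 t.2) ∧
      PCong P (.par (Proc.prod (ts.map fun t => t.1)) (Proc.prod (rs.map .sigma))) ∧
      PCong P' (.par (Proc.prod (ts.map fun t => t.2)) (Proc.prod rs)) := by
  have hnil (P : Proc W) : PCong P (.par (.par P .nil) .nil) :=
    .symm (.trans (.parNil _) (.parNil _))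
  induction h with
  | nil => exact ⟨[], [], by simp, .symm (.parNil _), .symm (.parNil _)⟩
  | delay P =>
    exact ⟨[], [P], by simp, .trans (hnil _) (.parComm _ _), .trans (hnil _) (.parComm _ _)⟩
  | timeoutSnd c e P Q =>
    exact ⟨[(_, Q)], [], by simpa using .inl ⟨_, _, _, rfl⟩, hnil _, hnil _⟩
  | timeoutRcv c P Q =>
    exact ⟨[(_, Q)], [], by simpa using .inr ⟨_, _, rfl⟩, hnil _, hnil _⟩
  | par _ _ _ ih ih' =>
    obtain ⟨ts, rs, h1, h2, h3⟩ := ih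
    obtain ⟨ts', rs', h1', h2', h3'⟩ := ih'
    refine ⟨ts ++ ts', rs ++ rs', ?_, ?_, ?_⟩
    · intro t ht
      exact (List.mem_append.1 ht).elim (h1 t) (h1' t)
    · rw [List.map_append, List.map_append]
      exact .trans (.par h2 h2') (.trans (.parParComm _ _ _ _)
        (.par (.prod_append _ _) (.prod_append _ _)))
    · rw [List.map_append]
      exact .trans (.par h3 h3') (.trans (.parParComm _ _ _ _)
        (.par (.prod_append _ _) (.prod_append _ _)))
  | fix _ ih =>
    obtain ⟨ts, rs, h1, h2, h3⟩ := ih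
    exact ⟨ts, rs, h1, .trans (.unfold _) h2, h3⟩
  | condTrue hg _ ih =>
    obtain ⟨ts, rs, h1, h2, h3⟩ := ih
    exact ⟨ts, rs, h1, .trans (.condTrue hg) h2, h3⟩
  | condFalse hg _ ih =>
    obtain ⟨ts, rs, h1, h2, h3⟩ := ih
    exact ⟨ts, rs, h1, .trans (.condFalse hg) h2, h3⟩

theorem NTime.redTime {M M' : Network W} (h : NTime M M') (hn : (M.devs.map Dev.name).Nodup) :
    RedTime M M' := by
  induction h with
  | @stat n I _ _ k h h' =>
    obtain ⟨ts, rs, h1, h2, h3⟩ := h.exists_normal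
    have h4 := NCong.node n I .stat k h2
    exact .struct h4 (.timestat _ _ ts rs _ h1
      (not_redInst_tau (by simp [Network.devs]) (h4.no_tau h'))) (.node _ _ _ _ h3.symm)
  | @mob n I _ _ k _ h h' hd =>
    obtain ⟨ts, rs, h1, h2, h3⟩ := h.exists_normal
    have h4 := NCong.node n I .mob k h2
    exact .struct h4 (.timemob _ _ ts rs _ _ h1
      (not_redInst_tau (by simp [Network.devs]) (h4.no_tau h')) hd) (.node _ _ _ _ h3.symm)
  | par _ _ h ih ih' =>
    have hn' := hn
    rw [Network.devs, List.map_append, List.nodup_append] at hn'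
    exact .timepar (ih hn'.1) (ih' hn'.2.1) (not_redInst_tau hn h)
  | zero => exact .timezero
  | res c _ ih => exact .res c (ih hn)

/-! ### Barbs -/

/-- Only the locations and interfaces of devices matter for a barb, and congruence merely permutes
them. Conversely, flattening allows any chosen device to be brought to the front of the product. -/
theorem barb_iff {M : Network W} {a : Act} {h : W.Loc} {v : W.V} :
    Barb M a h v ↔ ∃ d ∈ M.devs, d.h = h ∧ d.I.act a = some v := by
  have key {M N : Network W} (hMN : NCong M N) (hM : ∃ d ∈ M.devs, d.h = h ∧ d.I.act a = some v) :
      ∃ d ∈ N.devs, d.h = h ∧ d.I.act a = some v := by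
    obtain ⟨d, hd, h1, h2⟩ := hM
    obtain ⟨e, he, hde⟩ := List.mem_map.1 (hMN.perm_data.mem_iff.1 (List.mem_map_of_mem hd))
    simp only [Dev.data, Prod.mk.injEq] at hde
    exact ⟨e, he, by rw [hde.2.2.2, h1], by rw [hde.2.1, h2]⟩
  constructor
  · rintro ⟨gs, n, I, P, μ, M', h1, h2⟩
    exact key h1.symm ⟨⟨n, I, P, μ, h⟩, by rw [Network.devs_resList]; simp [Network.devs], rfl, h2⟩
  · intro hM
    obtain ⟨cs, ds, -, h1⟩ := exists_flat M Set.finite_empty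
    obtain ⟨d, hd, h2, h3⟩ := key h1 hM
    rw [Network.devs_resList, Network.devs_prod] at hd
    obtain ⟨es, fs, rfl⟩ := List.append_of_mem hd
    obtain ⟨n, I, P, μ, k⟩ := d
    subst h2
    exact ⟨cs, n, I, P, μ, .prod (es ++ fs), h1.trans (.resList cs (.prod_perm List.perm_middle)), h3⟩

end IoT

/-! ### Subject reduction, and a congruence contained in both equivalences -/

namespace IoT

variable {W : World}

/-! ### Subject reduction -/

theorem Exp.Scoped.subst {n k : ℕ} {e : Exp W} (h : e.Scoped (n + 1)) (hk : k ≤ n) (v : W.V) :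
    (e.subst k v).Scoped n := by
  cases e with
  | val => trivial
  | var i =>
    simp only [Exp.Scoped, Exp.subst] at h ⊢
    split_ifs <;> simp only <;> omega

theorem Exp.Scoped.lift {n : ℕ} {e : Exp W} (h : e.Scoped n) (k : ℕ) :
    (e.lift k).Scoped (n + 1) := by
  cases e with
  | val => trivial
  | var i =>
    simp only [Exp.Scoped, Exp.lift] at h ⊢
    split_ifs <;> omega

theorem Guard.Scoped.subst {n k : ℕ} {g : Guard W} (h : g.Scoped (n + 1)) (hk : k ≤ n) (v : W.V) :
    (g.subst k v).Scoped n := by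
  simpa [Guard.Scoped, Guard.subst] using fun e he => (h e he).subst hk v

theorem Guard.Scoped.lift {n : ℕ} {g : Guard W} (h : g.Scoped n) (k : ℕ) :
    (g.lift k).Scoped (n + 1) := by
  simpa [Guard.Scoped, Guard.lift] using fun e he => (h e he).lift k

namespace Proc

theorem Scoped.substV {n m k : ℕ} {P : Proc W} (h : Scoped (n + 1) m P) (hk : k ≤ n) (v : W.V) :
    Scoped n m (substV k v P) := by
  induction P generalizing n m k <;>
    simp_all [Proc.substV, Scoped, Exp.Scoped.subst, Guard.Scoped.subst]

theorem Scoped.liftV {n m : ℕ} {P : Proc W} (h : Scoped n m P) (k : ℕ) :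
    Scoped (n + 1) m (liftV k P) := by
  induction P generalizing n m k <;>
    simp_all [Proc.liftV, Scoped, Exp.Scoped.lift, Guard.Scoped.lift]

theorem Scoped.liftP {n m : ℕ} {P : Proc W} (h : Scoped n m P) (k : ℕ) :
    Scoped n (m + 1) (liftP k P) := by
  induction P generalizing n m k <;> simp_all [Proc.liftP, Scoped]
  split_ifs <;> omega

theorem Scoped.substP {n m k : ℕ} {P R : Proc W} (h : Scoped n (m + 1) P) (hk : k ≤ m)
    (hR : Scoped n m R) : Scoped n m (substP k R P) := by
  induction P generalizing n m k R <;> simp_all [Proc.substP, Scoped, Scoped.liftV, Scoped.liftP]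
  split_ifs <;> first | exact hR | (simp only [Scoped]; omega)

theorem Scoped.inst {m : ℕ} {P : Proc W} (h : Scoped 1 m P) (v : W.V) : Scoped 0 m (P.inst v) :=
  h.substV le_rfl v

theorem Scoped.unfold {P : Proc W} (h : Scoped 0 1 P) : Scoped 0 0 P.unfold :=
  Scoped.substP (m := 0) h le_rfl h

theorem varGuarded_substV (j k : ℕ) (v : W.V) (P : Proc W) :
    VarGuarded j (substV k v P) ↔ VarGuarded j P := by
  induction P generalizing j k <;> simp_all [Proc.substV, VarGuarded]

theorem timeGuarded_substV (k : ℕ) (v : W.V) (P : Proc W) :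
    TimeGuarded (substV k v P) ↔ TimeGuarded P := by
  induction P generalizing k <;> simp_all [Proc.substV, TimeGuarded, varGuarded_substV]

theorem varGuarded_liftV (j k : ℕ) (P : Proc W) : VarGuarded j (liftV k P) ↔ VarGuarded j P := by
  induction P generalizing j k <;> simp_all [Proc.liftV, VarGuarded]

theorem timeGuarded_liftV (k : ℕ) (P : Proc W) : TimeGuarded (liftV k P) ↔ TimeGuarded P := by
  induction P generalizing k <;> simp_all [Proc.liftV, TimeGuarded, varGuarded_liftV]

theorem varGuarded_liftP_of_lt {j k : ℕ} (h : j < k) (P : Proc W) :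
    VarGuarded j (liftP k P) ↔ VarGuarded j P := by
  induction P generalizing j k <;> simp_all [Proc.liftP, VarGuarded]
  split_ifs <;> omega

theorem varGuarded_liftP_of_le {j k : ℕ} (h : k ≤ j) (P : Proc W) :
    VarGuarded (j + 1) (liftP k P) ↔ VarGuarded j P := by
  induction P generalizing j k <;> simp_all [Proc.liftP, VarGuarded]
  split_ifs <;> omega

theorem varGuarded_liftP_self (k : ℕ) (P : Proc W) : VarGuarded k (liftP k P) := by
  induction P generalizing k <;> simp_all [Proc.liftP, VarGuarded]
  split_ifs <;> omega

theorem timeGuarded_liftP (k : ℕ) (P : Proc W) : TimeGuarded (liftP k P) ↔ TimeGuarded P := by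
  induction P generalizing k <;> simp_all [Proc.liftP, TimeGuarded, varGuarded_liftP_of_lt]

theorem VarGuarded.substP {j k : ℕ} (h : j < k) {P R : Proc W} (hP : VarGuarded j P)
    (hR : VarGuarded j R) : VarGuarded j (substP k R P) := by
  induction P generalizing j k R <;>
    simp_all [Proc.substP, VarGuarded, varGuarded_liftV, varGuarded_liftP_of_le]
  split_ifs <;> first | exact hR | (simp only [VarGuarded]; omega)

theorem TimeGuarded.substP {k : ℕ} {P R : Proc W} (hP : TimeGuarded P) (hR : TimeGuarded R) :
    TimeGuarded (substP k R P) := by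
  induction P generalizing k R <;>
    simp_all [Proc.substP, TimeGuarded, timeGuarded_liftV, timeGuarded_liftP]
  case pvar => split_ifs <;> first | exact hR | trivial
  -- The substituted process is lifted past the binder, so the variable bound by the recursion does
  -- not occur in it and is trivially guarded there.
  case fix => exact hP.1.substP (by omega) (varGuarded_liftP_self 0 _)

theorem timeGuarded_inst (v : W.V) (P : Proc W) : TimeGuarded (P.inst v) ↔ TimeGuarded P :=
  timeGuarded_substV _ _ _

theorem TimeGuarded.unfold {P : Proc W} (h : TimeGuarded (.fix P)) : TimeGuarded P.unfold :=
  h.2.substP h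

theorem readsSens_substV (s : Sens) (k : ℕ) (v : W.V) (P : Proc W) :
    ReadsSens s (substV k v P) ↔ ReadsSens s P := by
  induction P generalizing k <;> simp_all [Proc.substV, ReadsSens]

theorem readsSens_liftV (s : Sens) (k : ℕ) (P : Proc W) :
    ReadsSens s (liftV k P) ↔ ReadsSens s P := by
  induction P generalizing k <;> simp_all [Proc.liftV, ReadsSens]

theorem readsSens_liftP (s : Sens) (k : ℕ) (P : Proc W) :
    ReadsSens s (liftP k P) ↔ ReadsSens s P := by
  induction P generalizing k <;> simp_all [Proc.liftP, ReadsSens]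

theorem writesAct_substV (a : Act) (k : ℕ) (v : W.V) (P : Proc W) :
    WritesAct a (substV k v P) ↔ WritesAct a P := by
  induction P generalizing k <;> simp_all [Proc.substV, WritesAct]

theorem writesAct_liftV (a : Act) (k : ℕ) (P : Proc W) :
    WritesAct a (liftV k P) ↔ WritesAct a P := by
  induction P generalizing k <;> simp_all [Proc.liftV, WritesAct]

theorem writesAct_liftP (a : Act) (k : ℕ) (P : Proc W) :
    WritesAct a (liftP k P) ↔ WritesAct a P := by
  induction P generalizing k <;> simp_all [Proc.liftP, WritesAct]

theorem ReadsSens.of_substP {s : Sens} {k : ℕ} {R P : Proc W} (h : ReadsSens s (substP k R P)) :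
    ReadsSens s P ∨ ReadsSens s R := by
  induction P generalizing k R <;> simp only [Proc.substP, ReadsSens] at h ⊢
  case pvar i =>
    split_ifs at h
    exacts [h.elim, .inr h, h.elim]
  case sigma ih => exact ih h
  case act ih => exact ih h
  case pos ih => simpa [readsSens_liftV] using ih h
  case fix ih => simpa [readsSens_liftP] using ih h
  case sens ih =>
    rcases h with h | h
    · tauto
    · have := ih h; rw [readsSens_liftV] at this; tauto
  all_goals
    rename_i ih ih'
    rcases h with h | h
    · have := ih h; (try simp only [readsSens_liftV] at this); tauto
    · have := ih' h; tauto

theorem WritesAct.of_substP {a : Act} {k : ℕ} {R P : Proc W} (h : WritesAct a (substP k R P)) :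
    WritesAct a P ∨ WritesAct a R := by
  induction P generalizing k R <;> simp only [Proc.substP, WritesAct] at h ⊢
  case pvar i =>
    split_ifs at h
    exacts [h.elim, .inr h, h.elim]
  case sigma ih => exact ih h
  case sens ih => simpa [writesAct_liftV] using ih h
  case pos ih => simpa [writesAct_liftV] using ih h
  case fix ih => simpa [writesAct_liftP] using ih h
  case act ih =>
    rcases h with h | h
    · tauto
    · have := ih h; tauto
  all_goals
    rename_i ih ih'
    rcases h with h | h
    · have := ih h; (try simp only [writesAct_liftV] at this); tauto
    · have := ih' h; tauto

/-- `Q` is a possible evolution of `P`, as far as well-formedness is concerned. -/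
structure Evolves (P Q : Proc W) : Prop where
  closed : Scoped 0 0 P → Scoped 0 0 Q
  guarded : TimeGuarded P → TimeGuarded Q
  reads : ∀ s, ReadsSens s Q → ReadsSens s P
  writes : ∀ a, WritesAct a Q → WritesAct a P

theorem Evolves.refl (P : Proc W) : Evolves P P := ⟨id, id, fun _ => id, fun _ => id⟩

theorem Evolves.par {P P' Q Q' : Proc W} (h : Evolves P P') (h' : Evolves Q Q') :
    Evolves (.par P Q) (.par P' Q') :=
  ⟨fun ⟨a, b⟩ => ⟨h.closed a, h'.closed b⟩, fun ⟨a, b⟩ => ⟨h.guarded a, h'.guarded b⟩,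
    fun s => Or.imp (h.reads s) (h'.reads s), fun a => Or.imp (h.writes a) (h'.writes a)⟩

theorem Evolves.fix {P Q : Proc W} (h : Evolves P.unfold Q) : Evolves (.fix P) Q :=
  ⟨fun a => h.closed (Scoped.unfold a), fun a => h.guarded a.unfold,
    fun s a => (h.reads s a).of_substP.elim id id, fun b a => (h.writes b a).of_substP.elim id id⟩

theorem Evolves.condTrue {P P' : Proc W} (g : Guard W) (Q : Proc W) (h : Evolves P P') :
    Evolves (.cond g P Q) P' :=
  ⟨fun a => h.closed a.2.1, fun a => h.guarded a.1, fun s a => .inl (h.reads s a),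
    fun s a => .inl (h.writes s a)⟩

theorem Evolves.condFalse {Q Q' : Proc W} (g : Guard W) (P : Proc W) (h : Evolves Q Q') :
    Evolves (.cond g P Q) Q' :=
  ⟨fun a => h.closed a.2.2, fun a => h.guarded a.2, fun s a => .inr (h.reads s a),
    fun s a => .inr (h.writes s a)⟩

end Proc

theorem PStep.evolves {P Q : Proc W} {l : PLabel W} (h : PStep P l Q) : P.Evolves Q := by
  induction h with
  | snd c v P Q => exact ⟨fun h => h.2.1, fun h => h.1, fun _ h => .inl h, fun _ h => .inl h⟩
  | rcv c v P Q =>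
    exact ⟨fun h => h.1.inst v, fun h => (Proc.timeGuarded_inst _ _).2 h.1,
      fun _ h => .inl ((Proc.readsSens_substV _ _ _ _).1 h),
      fun _ h => .inl ((Proc.writesAct_substV _ _ _ _).1 h)⟩
  | sens s v P =>
    exact ⟨fun h => Proc.Scoped.inst h v, fun h => (Proc.timeGuarded_inst _ _).2 h,
      fun _ h => .inr ((Proc.readsSens_substV _ _ _ _).1 h),
      fun _ h => (Proc.writesAct_substV _ 0 v P).1 h⟩
  | act a v P => exact ⟨fun h => h.2, fun h => h, fun _ h => h, fun _ h => .inr h⟩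
  | pos k P =>
    exact ⟨fun h => Proc.Scoped.inst h _, fun h => (Proc.timeGuarded_inst _ _).2 h,
      fun _ h => (Proc.readsSens_substV _ 0 _ P).1 h,
      fun _ h => (Proc.writesAct_substV _ 0 _ P).1 h⟩
  | comL _ _ _ ih ih' => exact ih.par ih'
  | comR _ _ _ ih ih' => exact ih.par ih'
  | parL _ _ ih => exact ih.par (.refl _)
  | parR _ _ ih => exact .par (.refl _) ih
  | fix _ ih => exact ih.fix
  | condTrue _ _ ih => exact ih.condTrue _ _
  | condFalse _ _ ih => exact ih.condFalse _ _

theorem PTime.evolves {P Q : Proc W} (h : PTime P Q) : P.Evolves Q := by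
  induction h with
  | nil => exact .refl _
  | delay P => exact ⟨id, id, fun _ h => h, fun _ h => h⟩
  | timeoutSnd c e P Q => exact ⟨fun h => h.2.2, fun h => h.2, fun _ h => .inr h, fun _ h => .inr h⟩
  | timeoutRcv c P Q => exact ⟨fun h => h.2, fun h => h.2, fun _ h => .inr h, fun _ h => .inr h⟩
  | par _ _ _ ih ih' => exact ih.par ih'
  | fix _ ih => exact ih.fix
  | condTrue _ _ ih => exact ih.condTrue _ _
  | condFalse _ _ ih => exact ih.condFalse _ _

/-- `e` is a possible evolution of the device `d`, as far as well-formedness is concerned. -/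
structure Dev.Evolves (d e : Dev W) : Prop where
  name : e.name = d.name
  mob : e.μ = d.μ
  sens : ∀ s, e.I.sens s = none ↔ d.I.sens s = none
  act : ∀ a, e.I.act a = none ↔ d.I.act a = none
  proc : d.P.Evolves e.P

theorem Dev.Evolves.refl (d : Dev W) : d.Evolves d :=
  ⟨rfl, rfl, fun _ => .rfl, fun _ => .rfl, .refl _⟩

/-- Carries the conditions on pairs of devices, that actuators and node-dependent sensors are not
shared, along an evolution of the network device by device. -/
theorem List.Forall₂.pairwise {α β : Type*} {S : α → β → Prop} {R : α → α → Prop}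
    {R' : β → β → Prop} (hR : ∀ {a a' b b'}, S a b → S a' b' → R a a' → R' b b') {l : List α}
    {l' : List β} (h : List.Forall₂ S l l') (hl : l.Pairwise R) : l'.Pairwise R' := by
  induction h with
  | nil => exact .nil
  | @cons a b l l' hab h ih =>
    rw [List.pairwise_cons] at hl ⊢
    refine ⟨fun b' hb' => ?_, ih hl.2⟩
    obtain ⟨i, hi, rfl⟩ := List.mem_iff_getElem.1 hb'
    have hi' : i < l.length := h.length_eq ▸ hi
    exact hR hab (h.get hi' hi) (hl.1 _ (List.getElem_mem hi'))

theorem forall₂_evolves_names {l l' : List (Dev W)} (h : List.Forall₂ Dev.Evolves l l') :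
    l'.map Dev.name = l.map Dev.name := by
  induction h with
  | nil => rfl
  | cons h _ ih => simp [h.name, ih]

/-- Well-formedness sees only where an interface is defined and which sensors and actuators a
process mentions. The former is constant and the latter can only shrink. Thus transitions, the
passage of time and sensor updates are all handled device by device. -/
theorem Network.Ok.evolves {M N : Network W} (hM : M.Ok)
    (h : List.Forall₂ Dev.Evolves M.devs N.devs) : N.Ok := by
  have hmem : ∀ e ∈ N.devs, ∃ d ∈ M.devs, d.Evolves e := fun e he => by
    obtain ⟨i, hi, rfl⟩ := List.mem_iff_getElem.1 he
    have hi' : i < M.devs.length := h.length_eq ▸ hi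
    exact ⟨_, List.getElem_mem hi', h.get hi' hi⟩
  refine ⟨⟨forall₂_evolves_names h ▸ hM.wf.names, ?_, ?_, ?_, ?_, ?_⟩, ?_, ?_⟩
  · exact List.Forall₂.pairwise (fun h h' H a => by rw [h.act, h'.act]; exact H a) h hM.wf.acts
  · exact List.Forall₂.pairwise (fun h h' H a => by rw [h.sens, h'.sens]; exact H a) h
      hM.wf.nodeSens
  · intro e he s hs
    obtain ⟨d, hd, h⟩ := hmem e he
    exact fun H => hM.wf.reads d hd s (h.proc.reads s hs) ((h.sens s).1 H)
  · intro e he a ha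
    obtain ⟨d, hd, h⟩ := hmem e he
    exact fun H => hM.wf.writes d hd a (h.proc.writes a ha) ((h.act a).1 H)
  · intro e he s hs hs'
    obtain ⟨d, hd, h⟩ := hmem e he
    exact h.mob.trans (hM.wf.locSens d hd s hs fun H => hs' ((h.sens s).2 H))
  · intro e he
    obtain ⟨d, hd, h⟩ := hmem e he
    exact h.proc.closed (hM.closed d hd)
  · intro e he
    obtain ⟨d, hd, h⟩ := hmem e he
    exact h.proc.guarded (hM.guarded d hd)

theorem forall₂_evolves_refl (l : List (Dev W)) : List.Forall₂ Dev.Evolves l l :=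
  List.forall₂_same.2 fun d _ => .refl d

theorem NStep.evolves {M N : Network W} {l : NLabel W} (h : NStep M l N) :
    List.Forall₂ Dev.Evolves M.devs N.devs := by
  induction h with
  | pos h => exact .cons ⟨rfl, rfl, fun _ => .rfl, fun _ => .rfl, h.evolves⟩ .nil
  | sensRead _ h => exact .cons ⟨rfl, rfl, fun _ => .rfl, fun _ => .rfl, h.evolves⟩ .nil
  | actUnChg _ h => exact .cons ⟨rfl, rfl, fun _ => .rfl, fun _ => .rfl, h.evolves⟩ .nil
  | actChg h1 _ h =>
    refine .cons ⟨rfl, rfl, fun _ => .rfl, fun b => ?_, h.evolves⟩ .nil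
    simp only [Iface.setAct, Function.update_apply]
    split_ifs with hb
    · simp [hb, h1]
    · rfl
  | locCom h => exact .cons ⟨rfl, rfl, fun _ => .rfl, fun _ => .rfl, h.evolves⟩ .nil
  | snd h _ => exact .cons ⟨rfl, rfl, fun _ => .rfl, fun _ => .rfl, h.evolves⟩ .nil
  | rcv h _ => exact .cons ⟨rfl, rfl, fun _ => .rfl, fun _ => .rfl, h.evolves⟩ .nil
  | glbComL _ _ _ ih ih' => exact List.rel_append ih ih'
  | glbComR _ _ _ ih ih' => exact List.rel_append ih ih'
  | parL _ _ ih => exact List.rel_append ih (forall₂_evolves_refl _)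
  | parR _ _ ih => exact List.rel_append (forall₂_evolves_refl _) ih
  | res _ _ ih => exact ih

theorem NTime.evolves {M N : Network W} (h : NTime M N) :
    List.Forall₂ Dev.Evolves M.devs N.devs := by
  induction h with
  | stat h _ => exact .cons ⟨rfl, rfl, fun _ => .rfl, fun _ => .rfl, h.evolves⟩ .nil
  | mob h _ _ => exact .cons ⟨rfl, rfl, fun _ => .rfl, fun _ => .rfl, h.evolves⟩ .nil
  | par _ _ _ ih ih' => exact List.rel_append ih ih'
  | zero => exact .nil
  | res _ _ ih => exact ih

theorem Network.sensUpd_evolves (s : Sens) (h : W.Loc) (v : W.V) (M : Network W) :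
    List.Forall₂ Dev.Evolves M.devs (M.sensUpd s h v).devs := by
  induction M with
  | zero => exact .nil
  | node d =>
    simp only [sensUpd]
    split_ifs with hd
    · refine .cons ⟨rfl, rfl, fun s' => ?_, fun _ => .rfl, .refl _⟩ .nil
      simp only [Iface.setSens, Function.update_apply]
      split_ifs with hs
      · simpa [hs] using hd.2
      · rfl
    · exact forall₂_evolves_refl _
  | par _ _ ih ih' => exact List.rel_append ih ih'
  | res _ _ ih => exact ih

theorem NStep.ok {M N : Network W} {l : NLabel W} (h : NStep M l N) (hM : M.Ok) : N.Ok :=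
  hM.evolves h.evolves

theorem NTime.ok {M N : Network W} (h : NTime M N) (hM : M.Ok) : N.Ok := hM.evolves h.evolves

theorem Network.Ok.sensUpd {M : Network W} (hM : M.Ok) (s : Sens) (h : W.Loc) (v : W.V) :
    (M.sensUpd s h v).Ok := hM.evolves (M.sensUpd_evolves s h v)

theorem Network.Ok.res {M : Network W} (hM : M.Ok) (c : Chan) : (Network.res c M).Ok :=
  ⟨⟨hM.wf.names, hM.wf.acts, hM.wf.nodeSens, hM.wf.reads, hM.wf.writes, hM.wf.locSens⟩, hM.closed,
    hM.guarded⟩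

/-! ### Intensional bisimilarity -/

/-- Sequences of `τ`-transitions. -/
def NTaus : Network W → Network W → Prop := Relation.ReflTransGen fun M N => NStep M .tau N

/-- Weak untimed transitions. -/
def WeakNStep (M : Network W) (l : NLabel W) (M' : Network W) : Prop :=
  (l = .tau ∧ NTaus M M') ∨ ∃ M₁ M₂, NTaus M M₁ ∧ NStep M₁ l M₂ ∧ NTaus M₂ M'

theorem NTaus.par_left {M M' : Network W} (h : NTaus M M') (N : Network W) :
    NTaus (.par M N) (.par M' N) :=
  Relation.ReflTransGen.lift (Network.par · N) (fun _ _ h => NStep.parL N h) _ _ h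

theorem NTaus.res {M M' : Network W} (h : NTaus M M') (c : Chan) : NTaus (.res c M) (.res c M') :=
  Relation.ReflTransGen.lift (Network.res c) (fun _ _ h => NStep.res h id) _ _ h

theorem NTaus.ok {M N : Network W} (h : NTaus M N) (hM : M.Ok) : N.Ok := by
  induction h with
  | refl => exact hM
  | tail _ h ih => exact h.ok ih

theorem NTaus.eq_of_no_tau {M N : Network W} (h : NTaus M N) (hM : ∀ M', ¬ NStep M .tau M') :
    N = M := by
  rcases Relation.ReflTransGen.cases_head h with h | ⟨M', h, _⟩
  exacts [h.symm, (hM _ h).elim]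

theorem WeakNStep.single {M M' : Network W} {l : NLabel W} (h : NStep M l M') :
    WeakNStep M l M' := .inr ⟨_, _, .refl, h, .refl⟩

theorem WeakNStep.tau_iff {M M' : Network W} : WeakNStep M .tau M' ↔ NTaus M M' := by
  constructor
  · rintro (⟨_, h⟩ | ⟨_, _, h1, h2, h3⟩)
    exacts [h, (h1.tail h2).trans h3]
  · exact fun h => .inl ⟨rfl, h⟩

/-- Bisimulations for the intensional semantics that preserve the values of the actuators and
are closed under sensor updates. -/
structure IsIntBisim (R : Network W → Network W → Prop) : Prop where
  symm : ∀ {M N}, R M N → R N M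
  step : ∀ {M N}, R M N → ∀ {l M'}, NStep M l M' → ∃ N', WeakNStep N l N' ∧ R M' N'
  time : ∀ {M N}, R M N → ∀ {M'}, NTime M M' → ∃ N₁ N', NTaus N N₁ ∧ NTime N₁ N' ∧ R M' N'
  upd : ∀ {M N}, R M N → ∀ s h v, R (M.sensUpd s h v) (N.sensUpd s h v)
  barb : ∀ {M N}, R M N → ∀ {a h v}, (∃ d ∈ M.devs, d.h = h ∧ d.I.act a = some v) →
    ∃ d ∈ N.devs, d.h = h ∧ d.I.act a = some v

namespace IsIntBisim

variable {R : Network W → Network W → Prop}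

theorem taus (hR : IsIntBisim R) {M N M' : Network W} (h : R M N) (hM : NTaus M M') :
    ∃ N', NTaus N N' ∧ R M' N' := by
  induction hM with
  | refl => exact ⟨_, .refl, h⟩
  | tail _ h ih =>
    obtain ⟨N', h1, h2⟩ := ih
    obtain ⟨N'', h3, h4⟩ := hR.step h2 h
    exact ⟨N'', h1.trans (WeakNStep.tau_iff.1 h3), h4⟩

theorem weakNStep (hR : IsIntBisim R) {M N M' : Network W} {l : NLabel W} (h : R M N)
    (hM : WeakNStep M l M') : ∃ N', WeakNStep N l N' ∧ R M' N' := by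
  rcases hM with ⟨rfl, hM⟩ | ⟨M₁, M₂, h1, h2, h3⟩
  · obtain ⟨N', h1, h2⟩ := hR.taus h hM
    exact ⟨N', .inl ⟨rfl, h1⟩, h2⟩
  · obtain ⟨N₁, h4, h5⟩ := hR.taus h h1
    obtain ⟨N₂, h6, h7⟩ := hR.step h5 h2
    obtain ⟨N', h8, h9⟩ := hR.taus h7 h3
    refine ⟨N', ?_, h9⟩
    rcases h6 with ⟨rfl, h6⟩ | ⟨N₃, N₄, h10, h11, h12⟩
    · exact .inl ⟨rfl, h4.trans (h6.trans h8)⟩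
    · exact .inr ⟨N₃, N₄, h4.trans h10, h11, h12.trans h8⟩

end IsIntBisim

/-- Intensional bisimilarity. -/
def IntBisim (M N : Network W) : Prop := ∃ R, IsIntBisim R ∧ R M N

theorem isIntBisim_intBisim : IsIntBisim (W := W) IntBisim where
  symm := fun ⟨R, hR, h⟩ => ⟨R, hR, hR.symm h⟩
  step := fun ⟨R, hR, h⟩ _ _ hM => by
    obtain ⟨N', h1, h2⟩ := hR.step h hM
    exact ⟨N', h1, R, hR, h2⟩
  time := fun ⟨R, hR, h⟩ _ hM => by
    obtain ⟨N₁, N', h1, h2, h3⟩ := hR.time h hM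
    exact ⟨N₁, N', h1, h2, R, hR, h3⟩
  upd := fun ⟨R, hR, h⟩ s l v => ⟨R, hR, hR.upd h s l v⟩
  barb := fun ⟨_, hR, h⟩ => hR.barb h

theorem NCong.sensUpd {M N : Network W} (h : NCong M N) (s : Sens) (l : W.Loc) (v : W.V) :
    NCong (M.sensUpd s l v) (N.sensUpd s l v) := by
  have hfree (c : Chan) (M : Network W) :
      (M.sensUpd s l v).HasFreeChan c ↔ M.HasFreeChan c := by
    induction M with
    | node d => simp only [Network.sensUpd]; split_ifs <;> rfl
    | _ => simp_all [Network.sensUpd, Network.HasFreeChan]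
  have hmap (f : Chan → Chan) (M : Network W) :
      (M.mapChan f).sensUpd s l v = (M.sensUpd s l v).mapChan f := by
    induction M with
    | node d => simp only [Network.sensUpd, Network.mapChan]; split_ifs <;> rfl
    | _ => simp_all [Network.sensUpd, Network.mapChan]
  induction h with
  | refl M => exact .refl _
  | symm _ ih => exact ih.symm
  | trans _ _ ih ih' => exact ih.trans ih'
  | node n I μ k h =>
    simp only [Network.sensUpd]
    split_ifs <;> exact .node _ _ _ _ h
  | parZero M => exact .parZero _
  | parComm M N => exact .parComm _ _
  | parAssoc M N O => exact .parAssoc _ _ _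
  | resZero c => exact .resZero _
  | resSwap c d M => exact .resSwap _ _ _
  | resPar hc => exact .resPar (by rwa [hfree])
  | alpha hr hd =>
    simp only [Network.sensUpd, hmap]
    exact .alpha hr (by rwa [hfree])
  | par _ _ ih ih' => exact .par ih ih'
  | res c _ ih => exact .res c ih

theorem isIntBisim_ncong : IsIntBisim (W := W) NCong where
  symm := .symm
  step := fun h _ _ hM => by
    obtain ⟨N', h1, h2⟩ := h.stepSim.1 _ _ hM
    exact ⟨N', .single h1, h2⟩
  time := fun h _ hM => by
    obtain ⟨N', h1, h2⟩ := h.timeSim.1 _ hM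
    exact ⟨_, N', .refl, h1, h2⟩
  upd := fun h s l v => h.sensUpd s l v
  barb := fun h _ _ _ hM => by
    obtain ⟨d, hd, h1, h2⟩ := hM
    obtain ⟨e, he, hde⟩ := List.mem_map.1 (h.perm_data.mem_iff.1 (List.mem_map_of_mem hd))
    simp only [Dev.data, Prod.mk.injEq] at hde
    exact ⟨e, he, by rw [hde.2.2.2, h1], by rw [hde.2.1, h2]⟩

namespace IntBisim

theorem symm {M N : Network W} (h : IntBisim M N) : IntBisim N M := isIntBisim_intBisim.symm h

theorem of_ncong {M N : Network W} (h : NCong M N) : IntBisim M N := ⟨_, isIntBisim_ncong, h⟩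

/-- Bisimulations compose. For the passage of time, the τ-steps by which `N` prepares for its tick
are matched first, so that `O` is related to the network that actually ticks. -/
theorem trans {M N O : Network W} (h : IntBisim M N) (h' : IntBisim N O) : IntBisim M O := by
  have hR := isIntBisim_intBisim (W := W)
  refine ⟨fun M O => ∃ N, IntBisim M N ∧ IntBisim N O, ⟨?_, ?_, ?_, ?_, ?_⟩, N, h, h'⟩
  · rintro M O ⟨N, h1, h2⟩
    exact ⟨N, h2.symm, h1.symm⟩
  · rintro M O ⟨N, h1, h2⟩ l M' hM
    obtain ⟨N', h3, h4⟩ := hR.step h1 hM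
    obtain ⟨O', h5, h6⟩ := hR.weakNStep h2 h3
    exact ⟨O', h5, N', h4, h6⟩
  · rintro M O ⟨N, h1, h2⟩ M' hM
    obtain ⟨N₁, N', h3, h4, h5⟩ := hR.time h1 hM
    obtain ⟨O₁, h6, h7⟩ := hR.taus h2 h3
    obtain ⟨O₂, O', h8, h9, h10⟩ := hR.time h7 h4
    exact ⟨O₂, O', h6.trans h8, h9, N', h5, h10⟩
  · rintro M O ⟨N, h1, h2⟩ s l v
    exact ⟨_, hR.upd h1 s l v, hR.upd h2 s l v⟩
  · rintro M O ⟨N, h1, h2⟩ a l v hM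
    exact hR.barb h2 (hR.barb h1 hM)

theorem res {M N : Network W} (h : IntBisim M N) (c : Chan) :
    IntBisim (.res c M) (.res c N) := by
  have hR := isIntBisim_intBisim (W := W)
  refine ⟨fun M' N' => ∃ M N, M' = .res c M ∧ N' = .res c N ∧ IntBisim M N, ⟨?_, ?_, ?_, ?_, ?_⟩,
    M, N, rfl, rfl, h⟩
  · rintro _ _ ⟨M, N, rfl, rfl, h⟩
    exact ⟨_, _, rfl, rfl, h.symm⟩
  · rintro _ _ ⟨M, N, rfl, rfl, h⟩ l M' hM
    cases hM with
    | res hM hl =>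
      obtain ⟨N', h1, h2⟩ := hR.step h hM
      refine ⟨.res c N', ?_, _, _, rfl, rfl, h2⟩
      rcases h1 with ⟨rfl, h1⟩ | ⟨N₁, N₂, h1, h2, h3⟩
      · exact .inl ⟨rfl, h1.res c⟩
      · exact .inr ⟨_, _, h1.res c, .res h2 hl, h3.res c⟩
  · rintro _ _ ⟨M, N, rfl, rfl, h⟩ M' hM
    cases hM with
    | res _ hM =>
      obtain ⟨N₁, N', h1, h2, h3⟩ := hR.time h hM
      exact ⟨_, _, h1.res c, .res c h2, _, _, rfl, rfl, h3⟩
  · rintro _ _ ⟨M, N, rfl, rfl, h⟩ s l v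
    exact ⟨_, _, rfl, rfl, hR.upd h s l v⟩
  · rintro _ _ ⟨M, N, rfl, rfl, h⟩ a l v hM
    exact hR.barb h hM

/-- The relation pairs arbitrary parallel extensions by the same `O`. Communications are matched
because intensional labels show the channel, the value and the location of the partner. The subtle
case is time: it must be shown that the answering network cannot communicate with `O` when `M` could
not. -/
theorem par {M N : Network W} (h : IntBisim M N) (O : Network W) :
    IntBisim (.par M O) (.par N O) := by
  have hR := isIntBisim_intBisim (W := W)
  refine ⟨fun M' N' => ∃ M N O, M' = .par M O ∧ N' = .par N O ∧ IntBisim M N, ⟨?_, ?_, ?_, ?_, ?_⟩,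
    M, N, O, rfl, rfl, h⟩
  · rintro _ _ ⟨M, N, O, rfl, rfl, h⟩
    exact ⟨_, _, _, rfl, rfl, h.symm⟩
  · rintro _ _ ⟨M, N, O, rfl, rfl, h⟩ l M' hM
    cases hM with
    | glbComL hM hO hc =>
      obtain ⟨N', h1, h2⟩ := hR.step h hM
      obtain ⟨h1, -⟩ | ⟨N₁, N₂, h1, h3, h4⟩ := h1
      · cases h1
      · exact ⟨_, .inr ⟨_, _, h1.par_left O, .glbComL h3 hO hc, h4.par_left _⟩, _, _, _, rfl, rfl,
          h2⟩
    | glbComR hM hO hc =>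
      obtain ⟨N', h1, h2⟩ := hR.step h hM
      obtain ⟨h1, -⟩ | ⟨N₁, N₂, h1, h3, h4⟩ := h1
      · cases h1
      · exact ⟨_, .inr ⟨_, _, h1.par_left O, .glbComR h3 hO hc, h4.par_left _⟩, _, _, _, rfl, rfl,
          h2⟩
    | parL _ hM =>
      obtain ⟨N', h1, h2⟩ := hR.step h hM
      refine ⟨.par N' O, ?_, _, _, _, rfl, rfl, h2⟩
      obtain ⟨rfl, h1⟩ | ⟨N₁, N₂, h1, h3, h4⟩ := h1
      · exact .inl ⟨rfl, h1.par_left O⟩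
      · exact .inr ⟨_, _, h1.par_left O, .parL _ h3, h4.par_left _⟩
    | parR _ hO => exact ⟨_, .single (.parR _ hO), _, _, _, rfl, rfl, h⟩
  · rintro _ _ ⟨M, N, O, rfl, rfl, h⟩ M' hM
    cases hM with
    | par hM hO hn =>
      obtain ⟨N₁, N', h1, h2, h3⟩ := hR.time h hM
      -- The τ-steps leading to `N₁` are matched by `M`, which has no τ-step because it lets time
      -- pass. So `M` itself is related to `N₁`.
      obtain ⟨M₁, h4, h5⟩ := hR.taus h.symm h1
      obtain rfl := h4.eq_of_no_tau hM.no_tau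
      -- Every visible action of `N₁` is one that `M` can perform at once, so a communication of
      -- `N₁` with `O` would give one of `M` with `O`, contrary to the premise of the tick.
      have hsend : ∀ {l N''}, l ≠ .tau → NStep N₁ l N'' → ∃ M'', NStep M₁ l M'' := by
        intro l N'' hl hN
        obtain ⟨M'', h6, -⟩ := hR.step h5 hN
        obtain ⟨h6, -⟩ | ⟨M₂, M₃, h6, h7, -⟩ := h6
        · exact (hl h6).elim
        · obtain rfl := h6.eq_of_no_tau hM.no_tau
          exact ⟨_, h7⟩
      refine ⟨_, _, h1.par_left O, .par h2 hO fun O' hO' => ?_, _, _, _, rfl, rfl, h3⟩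
      cases hO' with
      | glbComL hN hO hc =>
        obtain ⟨M'', h6⟩ := hsend (by simp) hN
        exact hn _ (.glbComL h6 hO hc)
      | glbComR hN hO hc =>
        obtain ⟨M'', h6⟩ := hsend (by simp) hN
        exact hn _ (.glbComR h6 hO hc)
      | parL _ hN => exact h2.no_tau _ hN
      | parR _ hO => exact hn _ (.parR _ hO)
  · rintro _ _ ⟨M, N, O, rfl, rfl, h⟩ s l v
    exact ⟨_, _, _, rfl, rfl, hR.upd h s l v⟩
  · rintro _ _ ⟨M, N, O, rfl, rfl, h⟩ a l v ⟨d, hd, hd'⟩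
    rcases List.mem_append.1 hd with hd | hd
    · obtain ⟨e, he, he'⟩ := hR.barb h ⟨d, hd, hd'⟩
      exact ⟨e, List.mem_append_left _ he, he'⟩
    · exact ⟨d, List.mem_append_right _ hd, hd'⟩

end IntBisim

/-! ### From intensional bisimilarity to bisimilarity and barbed congruence -/

theorem NTaus.weakTau {M N : Network W} (h : NTaus M N) : WeakTau M N :=
  Relation.ReflTransGen.mono (fun _ _ h => EStep.tau h) _ _ h

theorem NTaus.reds {M N : Network W} (h : NTaus M N) (hM : M.Ok) : Reds M N := by
  induction h with
  | refl => exact .refl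
  | tail h1 h2 ih =>
    exact ih.tail ⟨h2.ok (NTaus.ok h1 hM), .inl (NStep.redInst (ω := .tau) h2)⟩

theorem WeakNStep.exists_of_ne {M N : Network W} {l : NLabel W} (hl : l ≠ .tau)
    (h : WeakNStep M l N) : ∃ M₁ M₂, NTaus M M₁ ∧ NStep M₁ l M₂ ∧ NTaus M₂ N :=
  h.resolve_left fun h => hl h.1

/-- Intensional bisimilarity of well-formed networks. -/
def OkBisim (M N : Network W) : Prop := IntBisim M N ∧ M.Ok ∧ N.Ok

/-- An observable communication is an intensional one together with a condition on the range, which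
refers only to the label. Hence any answer with the same intensional label satisfies it too. -/
theorem isBisimulation_okBisim : IsBisimulation (W := W) OkBisim := by
  have hR := isIntBisim_intBisim (W := W)
  refine ⟨fun M N h => h.2, fun M N h => ⟨h.1.symm, h.2.2, h.2.1⟩, ?_⟩
  rintro M N ⟨h, hM, hN⟩ α M' hs
  have weak {l : NLabel W} {α : ELabel W} (hl : l ≠ .tau) (hα : α ≠ .tau)
      (hE : ∀ {N₁ N₂}, NStep N₁ l N₂ → EStep N₁ α N₂) (hs : NStep M l M') :
      ∃ N', WeakStep N α N' ∧ OkBisim M' N' := by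
    obtain ⟨N', h1, h2⟩ := hR.step h hs
    obtain ⟨N₁, N₂, h3, h4, h5⟩ := h1.exists_of_ne hl
    exact ⟨N', .inr ⟨hα, N₁, N₂, h3.weakTau, hE h4, h5.weakTau⟩, h2, hs.ok hM,
      h5.ok (h4.ok (h3.ok hN))⟩
  cases hs with
  | tau hs =>
    obtain ⟨N', h1, h2⟩ := hR.step h hs
    rw [WeakNStep.tau_iff] at h1
    exact ⟨N', .inl ⟨rfl, h1.weakTau⟩, h2, hs.ok hM, h1.ok hN⟩
  | sigma hs =>
    obtain ⟨N₁, N', h1, h2, h3⟩ := hR.time h hs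
    exact ⟨N', .inr ⟨by simp, N₁, N', h1.weakTau, .sigma h2, .refl⟩, h3, hs.ok hM,
      h2.ok (h1.ok hN)⟩
  | act hs => exact weak (by simp) (by simp) (fun h => .act h) hs
  | sndObs hs hc => exact weak (by simp) (by simp) (fun h => .sndObs h hc) hs
  | rcvObs hs hc => exact weak (by simp) (by simp) (fun h => .rcvObs h hc) hs
  | sensEnv hv =>
    exact ⟨_, .inr ⟨by simp, _, _, .refl, .sensEnv N hv, .refl⟩, hR.upd h _ _ _, hM.sensUpd _ _ _,
      hN.sensUpd _ _ _⟩
  | actEnv hb =>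
    exact ⟨N, .inr ⟨by simp, _, _, .refl, .actEnv (barb_iff.2 (hR.barb h (barb_iff.1 hb))), .refl⟩,
      h, hM, hN⟩

theorem IntBisim.bisimilar {M N : Network W} (h : IntBisim M N) (hM : M.Ok) (hN : N.Ok) :
    Bisimilar M N := ⟨OkBisim, isBisimulation_okBisim, h, hM, hN⟩

/-- A reduction becomes a transition, is matched there, and the answer is turned back into
reductions. The transition reaches the reduct only up to structural congruence, which is itself an
intensional bisimulation and is absorbed by transitivity. -/
theorem reductionClosed_okBisim : ReductionClosed (W := W) OkBisim := by
  have hR := isIntBisim_intBisim (W := W)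
  rintro M N ⟨h, hM, hN⟩
  refine ⟨?_, ?_⟩
  · rintro M' ⟨hM', hr | hr⟩
    · obtain ⟨M'', h1, h2⟩ := hr.nstep hM.wf.names
      obtain ⟨N', h3, h4⟩ := hR.step h h1
      have h3 : NTaus N N' := WeakNStep.tau_iff.1 h3
      exact ⟨N', h3.reds hN, (IntBisim.of_ncong h2.symm).trans h4, hM', h3.ok hN⟩
    · obtain ⟨M'', h1, h2⟩ := hr.ntime
      obtain ⟨N₁, N', h3, h4, h5⟩ := hR.time h h1
      have hN₁ := h3.ok hN
      exact ⟨N', (h3.reds hN).tail ⟨h4.ok hN₁, .inr (h4.redTime hN₁.wf.names)⟩,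
        (IntBisim.of_ncong h2.symm).trans h5, hM', h4.ok hN₁⟩
  · rintro a M' ⟨hM', hr⟩
    obtain ⟨M'', h1, h2⟩ := hr.nstep hM.wf.names
    obtain ⟨N', h3, h4⟩ := hR.step h h1
    obtain ⟨N₁, N₂, h5, h6, h7⟩ := h3.exists_of_ne (by simp [RLabel.toNLabel])
    have hN₁ := h5.ok hN
    have hN₂ := h6.ok hN₁
    exact ⟨N₁, N₂, N', h5.reds hN, ⟨hN₂, h6.redInst⟩, h7.reds hN₂,
      (IntBisim.of_ncong h2.symm).trans h4, hM', h7.ok hN₂⟩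

theorem IntBisim.barbedCongruent {M N : Network W} (h : IntBisim M N) (hM : M.Ok) (hN : N.Ok) :
    BarbedCongruent M N := by
  refine ⟨OkBisim, isBisimulation_okBisim.1, isBisimulation_okBisim.2.1, reductionClosed_okBisim,
    ?_, ?_, h, hM, hN⟩
  · rintro M N ⟨h, hM, hN⟩ a l v hb
    exact ⟨N, .refl, barb_iff.2 (isIntBisim_intBisim.barb h (barb_iff.1 hb))⟩
  · rintro M N ⟨h, hM, hN⟩
    exact ⟨fun O hMO hNO => ⟨h.par O, hMO, hNO⟩, fun c => ⟨h.res c, hM.res c, hN.res c⟩,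
      fun s l v _ => ⟨isIntBisim_intBisim.upd h s l v, hM.sensUpd s l v, hN.sensUpd s l v⟩⟩

end IoT

/-! ### Transitions of the processes in the smart home -/

namespace IoT

variable {W : World}

/-! ### Transitions of the components of the smart home -/

theorem PStep.fix_iff {P Q : Proc W} {l : PLabel W} : PStep (.fix P) l Q ↔ PStep P.unfold l Q :=
  ⟨fun h => by cases h; assumption, .fix⟩

theorem PTime.fix_iff {P Q : Proc W} : PTime (.fix P) Q ↔ PTime P.unfold Q :=
  ⟨fun h => by cases h; assumption, .fix⟩

/-- Used to replace a recursion inside a node by its unfolding. -/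
theorem NStep.node_mono {n : NodeName} {I : Iface W} {P P' : Proc W} {μ : Mob} {k : W.Loc}
    {l : NLabel W} {M : Network W} (h : NStep (.node ⟨n, I, P, μ, k⟩) l M)
    (hP : ∀ l Q, PStep P l Q → PStep P' l Q) : NStep (.node ⟨n, I, P', μ, k⟩) l M := by
  cases h with
  | pos h => exact .pos (hP _ _ h)
  | sensRead h1 h => exact .sensRead h1 (hP _ _ h)
  | actUnChg h1 h => exact .actUnChg h1 (hP _ _ h)
  | actChg h1 h2 h => exact .actChg h1 h2 (hP _ _ h)
  | locCom h => exact .locCom (hP _ _ h)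
  | snd h h1 => exact .snd (hP _ _ h) h1
  | rcv h h1 => exact .rcv (hP _ _ h) h1

theorem NStep.node_parL {n : NodeName} {I I' : Iface W} {P P' : Proc W} {μ : Mob} {k : W.Loc}
    {l : NLabel W} (h : NStep (.node ⟨n, I, P, μ, k⟩) l (.node ⟨n, I', P', μ, k⟩)) (Q : Proc W) :
    NStep (.node ⟨n, I, .par P Q, μ, k⟩) l (.node ⟨n, I', .par P' Q, μ, k⟩) :=
  h.addPar fun _ => Q

/-- The transitions of a node with two parallel processes that do not communicate. -/
theorem NStep.node_par {n : NodeName} {I : Iface W} {P Q : Proc W} {μ : Mob} {k : W.Loc}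
    {l : NLabel W} {M : Network W} (h : NStep (.node ⟨n, I, .par P Q, μ, k⟩) l M)
    (hQ : ∀ c v R, c.rng = .intra → ¬ PStep Q (.snd c v) R ∧ ¬ PStep Q (.rcv c v) R) :
    (∃ I' P', NStep (.node ⟨n, I, P, μ, k⟩) l (.node ⟨n, I', P', μ, k⟩) ∧
        M = .node ⟨n, I', .par P' Q, μ, k⟩) ∨
      ∃ I' Q', NStep (.node ⟨n, I, Q, μ, k⟩) l (.node ⟨n, I', Q', μ, k⟩) ∧
        M = .node ⟨n, I', .par P Q', μ, k⟩ := by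
  cases h with
  | pos h =>
    cases h with
    | parL _ h => exact .inl ⟨_, _, .pos h, rfl⟩
    | parR _ h => exact .inr ⟨_, _, .pos h, rfl⟩
  | sensRead h1 h =>
    cases h with
    | parL _ h => exact .inl ⟨_, _, .sensRead h1 h, rfl⟩
    | parR _ h => exact .inr ⟨_, _, .sensRead h1 h, rfl⟩
  | actUnChg h1 h =>
    cases h with
    | parL _ h => exact .inl ⟨_, _, .actUnChg h1 h, rfl⟩
    | parR _ h => exact .inr ⟨_, _, .actUnChg h1 h, rfl⟩
  | actChg h1 h2 h =>
    cases h with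
    | parL _ h => exact .inl ⟨_, _, .actChg h1 h2 h, rfl⟩
    | parR _ h => exact .inr ⟨_, _, .actChg h1 h2 h, rfl⟩
  | locCom h =>
    cases h with
    | comL _ h hc => exact ((hQ _ _ _ hc).2 h).elim
    | comR _ h hc => exact ((hQ _ _ _ hc).1 h).elim
    | parL _ h => exact .inl ⟨_, _, .locCom h, rfl⟩
    | parR _ h => exact .inr ⟨_, _, .locCom h, rfl⟩
  | snd h h1 =>
    cases h with
    | parL _ h => exact .inl ⟨_, _, .snd h h1, rfl⟩
    | parR _ h => exact .inr ⟨_, _, .snd h h1, rfl⟩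
  | rcv h h1 =>
    cases h with
    | parL _ h => exact .inl ⟨_, _, .rcv h h1, rfl⟩
    | parR _ h => exact .inr ⟨_, _, .rcv h h1, rfl⟩

theorem NStep.node_com {n : NodeName} {I : Iface W} {P : Proc W} {μ : Mob} {k : W.Loc}
    {l : NLabel W} {M : Network W} (h : NStep (.node ⟨n, I, P, μ, k⟩) l M)
    (hP : ∀ l Q, PStep P l Q → ∃ c v, l = .snd c v ∨ l = .rcv c v) :
    ∃ P', M = .node ⟨n, I, P', μ, k⟩ ∧ ((∃ c v, l = .snd c v k ∧ PStep P (.snd c v) P') ∨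
      ∃ c v, l = .rcv c v k ∧ PStep P (.rcv c v) P') := by
  cases h with
  | pos h => obtain ⟨_, _, h | h⟩ := hP _ _ h <;> cases h
  | sensRead _ h => obtain ⟨_, _, h | h⟩ := hP _ _ h <;> cases h
  | actUnChg _ h => obtain ⟨_, _, h | h⟩ := hP _ _ h <;> cases h
  | actChg _ _ h => obtain ⟨_, _, h | h⟩ := hP _ _ h <;> cases h
  | locCom h => obtain ⟨_, _, h | h⟩ := hP _ _ h <;> cases h
  | snd h _ => exact ⟨_, rfl, .inl ⟨_, _, rfl, h⟩⟩
  | rcv h _ => exact ⟨_, rfl, .inr ⟨_, _, rfl, h⟩⟩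

theorem eqGuard_eval {v w : W.V} {b : Bool} :
    (eqGuard (.val v) w).Eval b ↔ (v = w ↔ b = true) := by
  classical
  constructor
  · rintro ⟨vs, h1, rfl⟩
    match vs, h1 with
    | [u], h1 => simp [eqGuard] at h1; simp [eqGuard, h1]
  · intro h
    exact ⟨[v], rfl, by simp [eqGuard, h]⟩

/-- The states of a light manager: it is about to switch the light off, waits for the phone, is
about to switch the light on, or sleeps. -/
inductive LightState
  | off
  | wait
  | on
  | sleep

/-- The phone has been detected in the current time slot. -/
def LightState.busy : LightState → Bool
  | off => false
  | wait => false
  | on => true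
  | sleep => true

namespace SmartHome

/-- The process of the light manager with channel `c` and actuator `a` in a given state. -/
def light (c : Chan) (a : Act) : LightState → Proc W
  | .off => .act a (.val .off) (lightProc c a)
  | .wait => lightProc c a
  | .on => .act a (.val .on) (.sigma (lightProc c a))
  | .sleep => .sigma (lightProc c a)

/-- The controller of a light, before and after the transmission in a time slot. -/
def ctrl (c : Chan) : Bool → Proc W
  | false => lightCtrlOn c
  | true => .sigma (lightCtrlOn c)

theorem unfold_lightCtrlOn (c : Chan) :
    Proc.unfold (.snd c (.val .unit) (.sigma (.pvar 0)) (.pvar 0)) =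
      (.snd c (.val .unit) (.sigma (lightCtrlOn c)) (lightCtrlOn c) : Proc W) := rfl

theorem unfold_lightProc (c : Chan) (a : Act) :
    Proc.unfold (.rcv c (.act a (.val .on) (.sigma (.pvar 0))) (.act a (.val .off) (.pvar 0))) =
      (.rcv c (.act a (.val .on) (.sigma (lightProc c a)))
        (.act a (.val .off) (lightProc c a)) : Proc W) := rfl

theorem step_ctrl {c : Chan} {b : Bool} {l : PLabel W} {P : Proc W} (h : PStep (ctrl c b) l P) :
    b = false ∧ l = .snd c .unit ∧ P = ctrl c true := by
  cases b with
  | true => cases h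
  | false =>
    rw [ctrl, lightCtrlOn, PStep.fix_iff, unfold_lightCtrlOn] at h
    cases h; exact ⟨rfl, rfl, rfl⟩

theorem ctrl_step (c : Chan) : PStep (ctrl (W := W) c false) (.snd c .unit) (ctrl c true) := by
  rw [ctrl, lightCtrlOn, PStep.fix_iff, unfold_lightCtrlOn]
  exact .snd _ _ _ _

theorem time_ctrl {c : Chan} {b : Bool} {P : Proc W} (h : PTime (ctrl c b) P) :
    P = ctrl c false := by
  cases b with
  | true => cases h; rfl
  | false =>
    rw [ctrl, lightCtrlOn, PTime.fix_iff, unfold_lightCtrlOn] at h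
    cases h; rfl

theorem ctrl_time (c : Chan) (b : Bool) : PTime (ctrl (W := W) c b) (ctrl c false) := by
  cases b with
  | true => exact .delay _
  | false =>
    rw [ctrl, lightCtrlOn, PTime.fix_iff, unfold_lightCtrlOn]
    exact .timeoutSnd _ _ _ _

/-- Switching the light `a`: untimed transitions of a light manager. -/
inductive LightStep (a : Act) : Iface W → LightState → NLabel W → Iface W → LightState → Prop
  | off {I : Iface W} : I.act a = some .off → LightStep a I .off .tau I .wait
  | switchOff {I : Iface W} {w : W.V} : I.act a = some w → w ≠ .off →
      LightStep a I .off (.act a) (I.setAct a .off) .wait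
  | on {I : Iface W} : I.act a = some .on → LightStep a I .on .tau I .sleep
  | switchOn {I : Iface W} {w : W.V} : I.act a = some w → w ≠ .on →
      LightStep a I .on (.act a) (I.setAct a .on) .sleep

theorem LightStep.busy_eq {a : Act} {I I' : Iface W} {s s' : LightState} {l : NLabel W}
    (h : LightStep a I s l I' s') : s'.busy = s.busy := by cases h <;> rfl

theorem LightStep.not_isOn {a : Act} {I I' : Iface W} {s s' : LightState} {l : NLabel W}
    (h : LightStep a I s l I' s') (c : Chan) : ¬ l.IsOn c := by cases h <;> exact id

theorem LightStep.nstep {a : Act} {I I' : Iface W} {s s' : LightState} {l : NLabel W}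
    (h : LightStep a I s l I' s') (n : NodeName) (c : Chan) (μ : Mob) (k : W.Loc) :
    NStep (.node ⟨n, I, light c a s, μ, k⟩) l (.node ⟨n, I', light c a s', μ, k⟩) := by
  cases h with
  | off h => exact .actUnChg h (.act _ _ _)
  | switchOff h h' => exact .actChg h h' (.act _ _ _)
  | on h => exact .actUnChg h (.act _ _ _)
  | switchOn h h' => exact .actChg h h' (.act _ _ _)

theorem light_rcv (c : Chan) (a : Act) (v : W.V) :
    PStep (light c a .wait) (.rcv c v) (light c a .on) := by
  rw [light, lightProc, PStep.fix_iff, unfold_lightProc]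
  exact .rcv c v (.act a (.val .on) (.sigma (lightProc c a))) _

theorem nstep_light {n : NodeName} {I : Iface W} {c : Chan} {a : Act} {s : LightState} {μ : Mob}
    {k : W.Loc} {l : NLabel W} {M : Network W} (h : NStep (.node ⟨n, I, light c a s, μ, k⟩) l M) :
    (∃ I' s', LightStep a I s l I' s' ∧ M = .node ⟨n, I', light c a s', μ, k⟩) ∨
      (s = .wait ∧ (∃ v, l = .rcv c v k) ∧ M = .node ⟨n, I, light c a .on, μ, k⟩) := by
  cases s with
  | off =>
    left
    cases h <;> rename_i h <;> cases h
    · exact ⟨_, _, .off ‹_›, rfl⟩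
    · exact ⟨_, _, .switchOff ‹_› ‹_›, rfl⟩
  | wait =>
    right
    rw [light, lightProc] at h
    replace h := h.node_mono fun _ _ h => PStep.fix_iff.1 h
    rw [unfold_lightProc] at h
    cases h <;> rename_i h <;> cases h
    exact ⟨rfl, ⟨_, rfl⟩, rfl⟩
  | on =>
    left
    cases h <;> rename_i h <;> cases h
    · exact ⟨_, _, .on ‹_›, rfl⟩
    · exact ⟨_, _, .switchOn ‹_› ‹_›, rfl⟩
  | sleep => cases h <;> rename_i h <;> cases h

/-- The effect of the passage of time on a light manager. -/
inductive LightTick : LightState → LightState → Prop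
  | wait : LightTick .wait .off
  | sleep : LightTick .sleep .wait

/-- With a write on the actuator pending, in the states `off` and `on`, time cannot pass. A light
manager therefore ends every slot either waiting or asleep. -/
theorem time_light {c : Chan} {a : Act} {s : LightState} {P : Proc W}
    (h : PTime (light c a s) P) : ∃ s', LightTick s s' ∧ P = light c a s' := by
  cases s with
  | off => cases h
  | wait =>
    rw [light, lightProc, PTime.fix_iff, unfold_lightProc] at h
    cases h; exact ⟨_, .wait, rfl⟩
  | on => cases h
  | sleep => cases h; exact ⟨_, .sleep, rfl⟩

theorem LightTick.ptime {s s' : LightState} (h : LightTick s s') (c : Chan) (a : Act) :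
    PTime (W := W) (light c a s) (light c a s') := by
  cases h with
  | wait =>
    refine PTime.fix ?_
    rw [unfold_lightProc]
    exact .timeoutRcv _ _ _
  | sleep => exact .delay _

theorem LightTick.not_busy {s s' : LightState} (h : LightTick s s') : s'.busy = false := by
  cases h <;> rfl

/-- The state of the interaction between the phone and the centralised light manager in a time
slot: the phone has not yet detected its position, is about to send it, or has sent it. -/
inductive Phase
  | start
  | sent
  | recv

variable (H : SmartHome W)

/-- The position detection of the phone at `k` in a given phase. -/
def gps (k : W.Loc) : Phase → Proc W
  | .start => H.lightCtrlGPS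
  | .sent => .snd H.g (.val (.loc k)) (.sigma H.lightCtrlGPS) H.lightCtrlGPS
  | .recv => .sigma H.lightCtrlGPS

/-- The centralised light manager after the reception of `v`. -/
noncomputable def clmRecv (v : W.V) : Proc W :=
  .cond (eqGuard (.val v) (.loc (H.loc 1)))
    (.snd H.d₁ (.val .unit) (.sigma H.clm) H.clm)
    (.cond (eqGuard (.val v) (.loc (H.loc 4)))
      (.snd H.d₂ (.val .unit) (.sigma H.clm) H.clm)
      (.sigma H.clm))

/-- The centralised light manager in a given phase, with the phone at `k`; the boolean tells
whether a light manager has already been contacted. -/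
noncomputable def clmState (k : W.Loc) : Phase → Bool → Proc W
  | .start, _ => H.clm
  | .sent, _ => H.clm
  | .recv, false => H.clmRecv (.loc k)
  | .recv, true => .sigma H.clm

theorem unfold_lightCtrlGPS :
    Proc.unfold (.pos (.snd H.g (.var 0) (.sigma (.pvar 0)) (.pvar 0))) =
      .pos (.snd H.g (.var 0) (.sigma H.lightCtrlGPS) H.lightCtrlGPS) := rfl

theorem step_gps {k : W.Loc} {p : Phase} {l : PLabel W} {P : Proc W}
    (h : PStep (H.gps k p) l P) :
    (p = .start ∧ ∃ k', l = .pos k' ∧ P = H.gps k' .sent) ∨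
      (p = .sent ∧ l = .snd H.g (.loc k) ∧ P = H.gps k .recv) := by
  cases p with
  | start =>
    rw [gps, lightCtrlGPS, PStep.fix_iff, unfold_lightCtrlGPS] at h
    cases h; exact .inl ⟨rfl, _, rfl, rfl⟩
  | sent => cases h; exact .inr ⟨rfl, rfl, rfl⟩
  | recv => cases h

theorem gps_pos (k : W.Loc) : PStep (H.gps k .start) (.pos k) (H.gps k .sent) := by
  rw [gps, lightCtrlGPS, PStep.fix_iff, unfold_lightCtrlGPS]
  exact .pos k (.snd H.g (.var 0) (.sigma H.lightCtrlGPS) H.lightCtrlGPS)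

theorem unfold_clm :
    Proc.unfold (.rcv H.g
      (.cond (eqGuard (.var 0) (.loc (H.loc 1)))
        (.snd H.d₁ (.val .unit) (.sigma (.pvar 0)) (.pvar 0))
        (.cond (eqGuard (.var 0) (.loc (H.loc 4)))
          (.snd H.d₂ (.val .unit) (.sigma (.pvar 0)) (.pvar 0))
          (.sigma (.pvar 0)))) (.pvar 0)) =
    .rcv H.g
      (.cond (eqGuard (.var 0) (.loc (H.loc 1)))
        (.snd H.d₁ (.val .unit) (.sigma H.clm) H.clm)
        (.cond (eqGuard (.var 0) (.loc (H.loc 4)))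
          (.snd H.d₂ (.val .unit) (.sigma H.clm) H.clm)
          (.sigma H.clm))) H.clm := rfl

theorem step_clm {l : PLabel W} {P : Proc W} (h : PStep H.clm l P) :
    ∃ v, l = .rcv H.g v ∧ P = H.clmRecv v := by
  rw [clm, PStep.fix_iff, unfold_clm] at h
  cases h; exact ⟨_, rfl, rfl⟩

theorem clm_step (v : W.V) : PStep H.clm (.rcv H.g v) (H.clmRecv v) := by
  rw [clm, PStep.fix_iff, unfold_clm]
  exact .rcv H.g v _ _

theorem step_clmRecv {k : W.Loc} {l : PLabel W} {P : Proc W}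
    (h : PStep (H.clmRecv (.loc k)) l P) : P = .sigma H.clm ∧
      ((k = H.loc 1 ∧ l = .snd H.d₁ .unit) ∨ (k = H.loc 4 ∧ l = .snd H.d₂ .unit)) := by
  cases h with
  | condTrue hg h =>
    have hg := (eqGuard_eval.1 hg).2 rfl
    cases hg; cases h; exact ⟨rfl, .inl ⟨rfl, rfl⟩⟩
  | condFalse _ h =>
    cases h with
    | condTrue hg h =>
      have hg := (eqGuard_eval.1 hg).2 rfl
      cases hg; cases h; exact ⟨rfl, .inr ⟨rfl, rfl⟩⟩
    | condFalse _ h => cases h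

theorem loc_one_ne_loc_four : H.loc 1 ≠ H.loc 4 := fun h => by
  have h1 := H.dist_loc 1 (by simp) 4 (by simp)
  rw [h, (W.dist_eq_zero _ _).2 rfl] at h1
  norm_num at h1

theorem clmRecv_step₁ : PStep (H.clmRecv (.loc (H.loc 1))) (.snd H.d₁ .unit) (.sigma H.clm) :=
  .condTrue (eqGuard_eval.2 (by simp)) (.snd _ _ _ _)

theorem clmRecv_step₂ : PStep (H.clmRecv (.loc (H.loc 4))) (.snd H.d₂ .unit) (.sigma H.clm) :=
  .condFalse (eqGuard_eval.2 (by simpa using H.loc_one_ne_loc_four.symm))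
    (.condTrue (eqGuard_eval.2 (by simp)) (.snd _ _ _ _))

/-- Whatever the phase and the location of the phone, one tick brings the central manager back to
its initial state: every branch ends in a timeout or a sleep followed by `clm`. -/
theorem clmState_time (k : W.Loc) (p : Phase) (b : Bool) : PTime (H.clmState k p b) H.clm := by
  have hclm : PTime H.clm H.clm := by
    refine PTime.fix ?_
    rw [unfold_clm]
    exact .timeoutRcv _ _ _
  have hrecv : PTime (H.clmRecv (.loc k)) H.clm := by
    by_cases h1 : k = H.loc 1
    · exact .condTrue (eqGuard_eval.2 (by simpa using h1)) (.timeoutSnd _ _ _ _)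
    · refine .condFalse (eqGuard_eval.2 (by simpa using h1)) ?_
      by_cases h4 : k = H.loc 4
      · exact .condTrue (eqGuard_eval.2 (by simpa using h4)) (.timeoutSnd _ _ _ _)
      · exact .condFalse (eqGuard_eval.2 (by simpa using h4)) (.delay _)
  cases p with
  | start => exact hclm
  | sent => exact hclm
  | recv => cases b with
    | false => exact hrecv
    | true => exact .delay _

/-- At the level of processes the passage of time is deterministic; the only choice is in the
movement of mobile nodes. This identifies the unknown result of a tick of the central manager with
the one given by `clmState_time`. -/
theorem time_unique {P Q R : Proc W} (h : PTime P Q) (h' : PTime P R) : Q = R := by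
  induction h generalizing R with
  | nil => cases h'; rfl
  | delay P => cases h'; rfl
  | timeoutSnd c e P Q => cases h'; rfl
  | timeoutRcv c P Q => cases h'; rfl
  | par _ _ _ ih ih' => cases h' with | par h1 h2 _ => rw [ih h1, ih' h2]
  | fix _ ih => cases h' with | fix h => exact ih h
  | condTrue hg _ ih =>
    cases h' with
    | condTrue _ h => exact ih h
    | condFalse hg' _ => cases hg.unique hg'
  | condFalse hg _ ih =>
    cases h' with
    | condFalse _ h => exact ih h
    | condTrue hg' _ => cases hg.unique hg'

end SmartHome

end IoT

/-! ### The state spaces of the two systems and all their transitions -/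

namespace IoT

variable {W : World}

/-! ### The states of the two systems -/

/-- A state of the smart home without the boiler manager: the process of the phone apart from the
control of the lights, the interfaces of the phone and the light managers, the location of the
phone, and the states of the light managers. -/
structure HomeState (W : World) where
  P : Proc W
  I : Iface W
  I₁ : Iface W
  I₂ : Iface W
  l : W.Loc
  s₁ : LightState
  s₂ : LightState

namespace SmartHome

variable (H : SmartHome W)

def lights (st : HomeState W) (c c' : Chan) : Network W :=
  .par (.node ⟨H.n₁, st.I₁, light c H.light₁ st.s₁, .stat, H.loc 1⟩)
    (.node ⟨H.n₂, st.I₂, light c' H.light₂ st.s₂, .stat, H.loc 4⟩)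

def proxPhone (st : HomeState W) (b b' : Bool) : Network W :=
  .node ⟨H.nP, st.I, .par st.P (.par (ctrl H.c₁ b) (ctrl H.c₂ b')), .mob, st.l⟩

/-- The proximity-based system in a given state. -/
def prox (st : HomeState W) : Network W :=
  -- A controller of the phone has sent in the current slot exactly when its light manager has
  -- received, so its state is determined by `busy` and need not be recorded.
  .res H.c₁ (.res H.c₂ (.par (H.proxPhone st st.s₁.busy st.s₂.busy) (H.lights st H.c₁ H.c₂)))

def gpsPhone (st : HomeState W) (p : Phase) : Network W :=
  .node ⟨H.nP, st.I, .par st.P (H.gps st.l p), .mob, st.l⟩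

noncomputable def gpsClm (P : Proc W) : Network W :=
  .node ⟨H.nLM, ⟨fun _ => none, fun _ => none⟩, P, .stat, H.loc 3⟩

/-- The GPS-based system in a given state. -/
noncomputable def gpsNet (st : HomeState W) (p : Phase) : Network W :=
  -- The central manager has sent its message exactly when one of the two light managers has
  -- received one; the disjunction records this.
  .res H.d₁ (.res H.d₂ (.res H.g (.par (H.gpsPhone st p) (.par (H.lights st H.d₁ H.d₂)
    (H.gpsClm (H.clmState st.l p (st.s₁.busy || st.s₂.busy)))))))

/-- The private channels of the two systems do not occur in the process. -/
structure Fresh (P : Proc W) : Prop where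
  c₁ : ¬ P.HasChan H.c₁
  c₂ : ¬ P.HasChan H.c₂
  d₁ : ¬ P.HasChan H.d₁
  d₂ : ¬ P.HasChan H.d₂
  g : ¬ P.HasChan H.g

variable {H}

theorem Fresh.mono {P Q : Proc W} (h : H.Fresh P) (hPQ : ∀ c, Q.HasChan c → P.HasChan c) :
    H.Fresh Q :=
  ⟨fun a => h.c₁ (hPQ _ a), fun a => h.c₂ (hPQ _ a), fun a => h.d₁ (hPQ _ a),
    fun a => h.d₂ (hPQ _ a), fun a => h.g (hPQ _ a)⟩

variable (H)

/-- The transitions that do not involve the detection of the phone by the light managers. -/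
inductive Common : HomeState W → NLabel W → HomeState W → Prop
  | phone {st : HomeState W} {l : NLabel W} {I' : Iface W} {P' : Proc W} :
      NStep (.node ⟨H.nP, st.I, st.P, .mob, st.l⟩) l (.node ⟨H.nP, I', P', .mob, st.l⟩) →
      Common st l { st with I := I', P := P' }
  | light₁ {st : HomeState W} {l : NLabel W} {I' : Iface W} {s' : LightState} :
      LightStep H.light₁ st.I₁ st.s₁ l I' s' → Common st l { st with I₁ := I', s₁ := s' }
  | light₂ {st : HomeState W} {l : NLabel W} {I' : Iface W} {s' : LightState} :
      LightStep H.light₂ st.I₂ st.s₂ l I' s' → Common st l { st with I₂ := I', s₂ := s' }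

/-- Invariants of the states: only the light manager in the room of the phone has detected it. -/
structure Inv (st : HomeState W) : Prop where
  fresh : H.Fresh st.P
  busy₁ : st.s₁.busy → st.l = H.loc 1
  busy₂ : st.s₂.busy → st.l = H.loc 4

variable {H}

theorem Common.busy {st st' : HomeState W} {l : NLabel W} (h : H.Common st l st') :
    st'.l = st.l ∧ st'.s₁.busy = st.s₁.busy ∧ st'.s₂.busy = st.s₂.busy := by
  cases h with
  | phone h => exact ⟨rfl, rfl, rfl⟩
  | light₁ h => exact ⟨rfl, h.busy_eq, rfl⟩
  | light₂ h => exact ⟨rfl, rfl, h.busy_eq⟩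

theorem Common.fresh {st st' : HomeState W} {l : NLabel W} (h : H.Common st l st')
    (hf : H.Fresh st.P) : H.Fresh st'.P := by
  cases h with
  | phone h => exact hf.mono fun c hc => NStep.hasFreeChan h hc
  | light₁ h => exact hf
  | light₂ h => exact hf

theorem Common.inv {st st' : HomeState W} {l : NLabel W} (h : H.Common st l st')
    (hi : H.Inv st) : H.Inv st' := by
  obtain ⟨h1, h2, h3⟩ := h.busy
  exact ⟨h.fresh hi.fresh, by rw [h1, h2]; exact hi.busy₁, by rw [h1, h3]; exact hi.busy₂⟩

theorem Common.not_isOn {st st' : HomeState W} {l : NLabel W} (h : H.Common st l st')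
    {c : Chan} (hc : ¬ st.P.HasChan c) : ¬ l.IsOn c := by
  cases h with
  | phone h => exact fun hl => hc (h.hasFreeChan_of_isOn hl)
  | light₁ h => exact h.not_isOn c
  | light₂ h => exact h.not_isOn c

/-- Common transitions keep `busy`, so the controllers stay as they are, and the label passes the
restrictions because the process of the phone does not know the private channels.
`Common.nstep_gpsNet` has the same reasons, in every phase. -/
theorem Common.nstep_prox {st st' : HomeState W} {l : NLabel W} (h : H.Common st l st')
    (hf : H.Fresh st.P) : NStep (H.prox st) l (H.prox st') := by
  obtain ⟨h1, h2, h3⟩ := h.busy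
  rw [prox, prox, h2, h3]
  refine .res (.res ?_ (h.not_isOn hf.c₂)) (h.not_isOn hf.c₁)
  cases h with
  | phone h => exact .parL _ (h.node_parL _)
  | light₁ h => exact .parR _ (.parL _ (h.nstep _ _ _ _))
  | light₂ h => exact .parR _ (.parR _ (h.nstep _ _ _ _))

theorem Common.nstep_gpsNet {st st' : HomeState W} {l : NLabel W} (h : H.Common st l st')
    (hf : H.Fresh st.P) (p : Phase) : NStep (H.gpsNet st p) l (H.gpsNet st' p) := by
  obtain ⟨h1, h2, h3⟩ := h.busy
  rw [gpsNet, gpsNet, h1, h2, h3]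
  refine .res (.res (.res ?_ (h.not_isOn hf.g)) (h.not_isOn hf.d₂)) (h.not_isOn hf.d₁)
  cases h with
  | phone h => exact .parL _ (h.node_parL _)
  | light₁ h => exact .parR _ (.parL _ (.parL _ (h.nstep _ _ _ _)))
  | light₂ h => exact .parR _ (.parL _ (.parR _ (h.nstep _ _ _ _)))

theorem d₁_ne_d₂ : H.d₁ ≠ H.d₂ := fun h => by
  have h1 := H.rng_d₁
  rw [h, H.rng_d₂] at h1
  cases h1

theorem g_ne_d₁ : H.g ≠ H.d₁ := fun h => by
  have h1 := H.rng_d₁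
  rw [← h, H.rng_g] at h1
  cases h1

theorem g_ne_d₂ : H.g ≠ H.d₂ := fun h => by
  have h1 := H.rng_d₂
  rw [← h, H.rng_g] at h1
  cases h1

/-! ### The transitions of the proximity-based system -/

/-- The light managers only receive on their channels, so they never communicate with each other:
each transition belongs to one of them. -/
theorem nstep_lights {st : HomeState W} {c c' : Chan} {l : NLabel W} {M : Network W}
    (h : NStep (H.lights st c c') l M) :
    (∃ I' s', LightStep H.light₁ st.I₁ st.s₁ l I' s' ∧
        M = H.lights { st with I₁ := I', s₁ := s' } c c') ∨
      (∃ I' s', LightStep H.light₂ st.I₂ st.s₂ l I' s' ∧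
        M = H.lights { st with I₂ := I', s₂ := s' } c c') ∨
      (st.s₁ = .wait ∧ (∃ v, l = .rcv c v (H.loc 1)) ∧ M = H.lights { st with s₁ := .on } c c') ∨
      (st.s₂ = .wait ∧ (∃ v, l = .rcv c' v (H.loc 4)) ∧
        M = H.lights { st with s₂ := .on } c c') := by
  cases h with
  | glbComL h1 _ _ =>
    rcases nstep_light h1 with ⟨_, _, h, _⟩ | ⟨_, ⟨_, h⟩, _⟩
    · exact (h.not_isOn _ rfl).elim
    · cases h
  | glbComR _ h2 _ =>
    rcases nstep_light h2 with ⟨_, _, h, _⟩ | ⟨_, ⟨_, h⟩, _⟩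
    · exact (h.not_isOn _ rfl).elim
    · cases h
  | parL _ h =>
    replace h := nstep_light h
    rcases h with ⟨_, _, h, rfl⟩ | ⟨hs, ⟨v, h⟩, rfl⟩
    · exact .inl ⟨_, _, h, rfl⟩
    · exact .inr (.inr (.inl ⟨hs, ⟨v, h⟩, rfl⟩))
  | parR _ h =>
    replace h := nstep_light h
    rcases h with ⟨_, _, h, rfl⟩ | ⟨hs, ⟨v, h⟩, rfl⟩
    · exact .inr (.inl ⟨_, _, h, rfl⟩)
    · exact .inr (.inr (.inr ⟨hs, ⟨v, h⟩, rfl⟩))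

theorem lights_rcv₁ {st : HomeState W} {c : Chan} (c' : Chan) (v : W.V) (hs : st.s₁ = .wait)
    (hc : c.rng ≠ .intra) :
    NStep (H.lights st c c') (.rcv c v (H.loc 1)) (H.lights { st with s₁ := .on } c c') := by
  rw [lights, hs]
  exact .parL _ (.rcv (light_rcv _ _ _) hc)

theorem lights_rcv₂ {st : HomeState W} (c : Chan) {c' : Chan} (v : W.V) (hs : st.s₂ = .wait)
    (hc : c'.rng ≠ .intra) :
    NStep (H.lights st c c') (.rcv c' v (H.loc 4)) (H.lights { st with s₂ := .on } c c') := by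
  rw [lights, hs]
  exact .parR _ (.rcv (light_rcv _ _ _) hc)

theorem step_ctrls {b b' : Bool} {l : PLabel W} {P : Proc W}
    (h : PStep (.par (ctrl H.c₁ b) (ctrl H.c₂ b')) l P) :
    (b = false ∧ l = .snd H.c₁ .unit ∧ P = .par (ctrl H.c₁ true) (ctrl H.c₂ b')) ∨
      (b' = false ∧ l = .snd H.c₂ .unit ∧ P = .par (ctrl H.c₁ b) (ctrl H.c₂ true)) := by
  cases h with
  | comL _ h _ => cases (step_ctrl h).2.1
  | comR h _ _ => cases (step_ctrl h).2.1
  | parL _ h =>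
    obtain ⟨h1, h2, rfl⟩ := step_ctrl h
    exact .inl ⟨h1, h2, rfl⟩
  | parR _ h =>
    obtain ⟨h1, h2, rfl⟩ := step_ctrl h
    exact .inr ⟨h1, h2, rfl⟩

theorem nstep_proxPhone {st : HomeState W} {b b' : Bool} {l : NLabel W} {M : Network W}
    (h : NStep (H.proxPhone st b b') l M) :
    (∃ I' P', NStep (.node ⟨H.nP, st.I, st.P, .mob, st.l⟩) l (.node ⟨H.nP, I', P', .mob, st.l⟩) ∧
        M = H.proxPhone { st with I := I', P := P' } b b') ∨
      (b = false ∧ l = .snd H.c₁ .unit st.l ∧ M = H.proxPhone st true b') ∨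
      (b' = false ∧ l = .snd H.c₂ .unit st.l ∧ M = H.proxPhone st b true) := by
  -- The channels `c₁` and `c₂` have range 0, not -1, so the controllers cannot communicate inside
  -- the node.
  have hc (c : Chan) (v : W.V) (R : Proc W) (hc : c.rng = .intra) :
      ¬ PStep (.par (ctrl H.c₁ b) (ctrl H.c₂ b')) (.snd c v) R ∧
      ¬ PStep (.par (ctrl H.c₁ b) (ctrl H.c₂ b')) (.rcv c v) R := by
    constructor <;> intro h <;> rcases step_ctrls h with ⟨-, hl, -⟩ | ⟨-, hl, -⟩ <;> cases hl
    · rw [H.rng_c₁] at hc; cases hc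
    · rw [H.rng_c₂] at hc; cases hc
  rcases h.node_par hc with ⟨_, _, h', rfl⟩ | ⟨_, _, h', rfl⟩
  · exact .inl ⟨_, _, h', rfl⟩
  · right
    cases h' <;> rename_i h' <;>
      rcases step_ctrls h' with ⟨hb, hl, rfl⟩ | ⟨hb, hl, rfl⟩ <;> cases hl
    · exact .inl ⟨hb, rfl, rfl⟩
    · exact .inr ⟨hb, rfl, rfl⟩

/-- The restrictions block every unpaired action on `c₁` and `c₂`, and freshness keeps the rest of
the phone off these channels. What is left besides the common transitions is the detection of the
phone. -/
theorem nstep_prox {st : HomeState W} (hf : H.Fresh st.P) {l : NLabel W} {M : Network W}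
    (h : NStep (H.prox st) l M) :
    (∃ st', H.Common st l st' ∧ M = H.prox st') ∨
      (l = .tau ∧ st.l = H.loc 1 ∧ st.s₁ = .wait ∧ M = H.prox { st with s₁ := .on }) ∨
      (l = .tau ∧ st.l = H.loc 4 ∧ st.s₂ = .wait ∧ M = H.prox { st with s₂ := .on }) := by
  cases h with
  | res h hl₁ =>
  cases h with
  | res h hl₂ =>
  cases h with
  | glbComL h1 h2 hc =>
    right
    rcases nstep_lights h2 with ⟨_, _, h, _⟩ | ⟨_, _, h, _⟩ | ⟨hs, ⟨v, h⟩, rfl⟩ | ⟨hs, ⟨v, h⟩, rfl⟩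
    · exact (h.not_isOn _ rfl).elim
    · exact (h.not_isOn _ rfl).elim
    · cases h
      rcases nstep_proxPhone h1 with ⟨_, _, h, _⟩ | ⟨_, h, rfl⟩ | ⟨_, h, _⟩
      · exact (hf.c₁ (h.hasFreeChan_of_isOn rfl)).elim
      · cases h
        -- Range 0 forces the distance between phone and light manager to vanish: they are in the
        -- same room.
        rw [H.rng_c₁] at hc
        have hl := (W.dist_eq_zero _ _).1 (Nat.le_zero.1 hc)
        exact .inl ⟨rfl, hl.symm, hs, rfl⟩
      · injection h with h; exact (H.c₁_ne_c₂ h).elim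
    · cases h
      rcases nstep_proxPhone h1 with ⟨_, _, h, _⟩ | ⟨_, h, _⟩ | ⟨_, h, rfl⟩
      · exact (hf.c₂ (h.hasFreeChan_of_isOn rfl)).elim
      · injection h with h; exact (H.c₁_ne_c₂ h.symm).elim
      · cases h
        rw [H.rng_c₂] at hc
        have hl := (W.dist_eq_zero _ _).1 (Nat.le_zero.1 hc)
        exact .inr ⟨rfl, hl.symm, hs, rfl⟩
  | glbComR _ h2 _ =>
    rcases nstep_lights h2 with ⟨_, _, h, _⟩ | ⟨_, _, h, _⟩ | ⟨_, ⟨v, h⟩, _⟩ | ⟨_, ⟨v, h⟩, _⟩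
    · exact (h.not_isOn _ rfl).elim
    · exact (h.not_isOn _ rfl).elim
    · cases h
    · cases h
  | parL _ h =>
    replace h := nstep_proxPhone h
    rcases h with ⟨_, _, h, rfl⟩ | ⟨_, rfl, _⟩ | ⟨_, rfl, _⟩
    · exact .inl ⟨_, .phone h, rfl⟩
    · exact (hl₁ rfl).elim
    · exact (hl₂ rfl).elim
  | parR _ h =>
    replace h := nstep_lights h
    rcases h with ⟨_, s', h, rfl⟩ | ⟨_, s', h, rfl⟩ | ⟨_, ⟨v, rfl⟩, _⟩ | ⟨_, ⟨v, rfl⟩, _⟩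
    · refine .inl ⟨_, .light₁ h, ?_⟩
      rw [prox]; dsimp only; rw [h.busy_eq]; rfl
    · refine .inl ⟨_, .light₂ h, ?_⟩
      rw [prox]; dsimp only; rw [h.busy_eq]; rfl
    · exact (hl₁ rfl).elim
    · exact (hl₂ rfl).elim

theorem prox_com₁ {st : HomeState W} (hl : st.l = H.loc 1) (hs : st.s₁ = .wait) :
    NStep (H.prox st) .tau (H.prox { st with s₁ := .on }) := by
  have hr : H.c₁.rng ≠ .intra := by rw [H.rng_c₁]; exact nofun
  have h1 : NStep (H.proxPhone st st.s₁.busy st.s₂.busy) (.snd H.c₁ .unit st.l)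
      (H.proxPhone st true st.s₂.busy) := by
    rw [hs]
    exact .snd (.parR _ (.parL _ (ctrl_step _))) hr
  refine .res (.res (.glbComL h1 (lights_rcv₁ _ _ hs hr) ?_) id) id
  rw [H.rng_c₁, hl, (W.dist_eq_zero _ _).2 rfl]
  exact le_rfl

theorem prox_com₂ {st : HomeState W} (hl : st.l = H.loc 4) (hs : st.s₂ = .wait) :
    NStep (H.prox st) .tau (H.prox { st with s₂ := .on }) := by
  have hr : H.c₂.rng ≠ .intra := by rw [H.rng_c₂]; exact nofun
  have h1 : NStep (H.proxPhone st st.s₁.busy st.s₂.busy) (.snd H.c₂ .unit st.l)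
      (H.proxPhone st st.s₁.busy true) := by
    rw [hs]
    exact .snd (.parR _ (.parR _ (ctrl_step _))) hr
  refine .res (.res (.glbComL h1 (lights_rcv₂ _ _ hs hr) ?_) id) id
  rw [H.rng_c₂, hl, (W.dist_eq_zero _ _).2 rfl]
  exact le_rfl

/-! ### The transitions of the GPS-based system -/

theorem nstep_gpsPhone {st : HomeState W} {p : Phase} {l : NLabel W} {M : Network W}
    (h : NStep (H.gpsPhone st p) l M) :
    (∃ I' P', NStep (.node ⟨H.nP, st.I, st.P, .mob, st.l⟩) l (.node ⟨H.nP, I', P', .mob, st.l⟩) ∧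
        M = H.gpsPhone { st with I := I', P := P' } p) ∨
      (p = .start ∧ l = .tau ∧ M = H.gpsPhone st .sent) ∨
      (p = .sent ∧ l = .snd H.g (.loc st.l) st.l ∧ M = H.gpsPhone st .recv) := by
  have hc (c : Chan) (v : W.V) (R : Proc W) (hc : c.rng = .intra) :
      ¬ PStep (H.gps st.l p) (.snd c v) R ∧
      ¬ PStep (H.gps st.l p) (.rcv c v) R := by
    constructor <;> intro h <;> rcases H.step_gps h with ⟨-, _, hl, -⟩ | ⟨-, hl, -⟩ <;> cases hl
    rw [H.rng_g] at hc; cases hc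
  rcases h.node_par hc with ⟨_, _, h', rfl⟩ | ⟨_, _, h', rfl⟩
  · exact .inl ⟨_, _, h', rfl⟩
  · right
    cases h' <;> rename_i h' <;>
      rcases H.step_gps h' with ⟨hp, _, hl, rfl⟩ | ⟨hp, hl, rfl⟩ <;> cases hl
    · exact .inl ⟨hp, rfl, rfl⟩
    · exact .inr ⟨hp, rfl, rfl⟩

theorem nstep_gpsClm {k : W.Loc} {p : Phase} {b : Bool} {l : NLabel W} {M : Network W}
    (h : NStep (H.gpsClm (H.clmState k p b)) l M) :
    (p ≠ .recv ∧ ∃ v, l = .rcv H.g v (H.loc 3) ∧ M = H.gpsClm (H.clmRecv v)) ∨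
      (p = .recv ∧ b = false ∧ M = H.gpsClm (.sigma H.clm) ∧
        ((k = H.loc 1 ∧ l = .snd H.d₁ .unit (H.loc 3)) ∨
          (k = H.loc 4 ∧ l = .snd H.d₂ .unit (H.loc 3)))) := by
  have hclm {l M} (h : NStep (H.gpsClm H.clm) l M) :
      ∃ v, l = .rcv H.g v (H.loc 3) ∧ M = H.gpsClm (H.clmRecv v) := by
    obtain ⟨P', rfl, ⟨c, v, rfl, h'⟩ | ⟨c, v, rfl, h'⟩⟩ := NStep.node_com h fun l Q h => by
      obtain ⟨v, hl, -⟩ := H.step_clm h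
      exact ⟨_, _, .inr hl⟩
    all_goals obtain ⟨v, hl, rfl⟩ := H.step_clm h'; cases hl
    exact ⟨_, rfl, rfl⟩
  match p, b, h with
  | .start, _, h => exact .inl ⟨by simp, hclm h⟩
  | .sent, _, h => exact .inl ⟨by simp, hclm h⟩
  | .recv, true, h =>
    obtain ⟨P', -, ⟨_, _, -, h⟩ | ⟨_, _, -, h⟩⟩ := NStep.node_com h fun l Q h => by cases h
    all_goals cases h
  | .recv, false, h =>
    right
    obtain ⟨P', rfl, ⟨c, v, rfl, h'⟩ | ⟨c, v, rfl, h'⟩⟩ := NStep.node_com h fun l Q h => by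
      obtain ⟨-, ⟨-, hl⟩ | ⟨-, hl⟩⟩ := H.step_clmRecv h
      exacts [⟨_, _, .inl hl⟩, ⟨_, _, .inl hl⟩]
    all_goals obtain ⟨rfl, ⟨hk, hl⟩ | ⟨hk, hl⟩⟩ := H.step_clmRecv h' <;> cases hl
    · exact ⟨rfl, rfl, rfl, .inl ⟨hk, rfl⟩⟩
    · exact ⟨rfl, rfl, rfl, .inr ⟨hk, rfl⟩⟩

/-- The third alternative is deliberately coarse: an unpaired action on `d₁` or `d₂` is blocked by
the outer restrictions, so its outcome is irrelevant. -/
theorem nstep_house {st : HomeState W} {k : W.Loc} {p : Phase} {b : Bool} {l : NLabel W}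
    {M : Network W}
    (h : NStep (.par (H.lights st H.d₁ H.d₂) (H.gpsClm (H.clmState k p b))) l M) :
    (∃ I' s', LightStep H.light₁ st.I₁ st.s₁ l I' s' ∧ M = .par (H.lights
        { st with I₁ := I', s₁ := s' } H.d₁ H.d₂) (H.gpsClm (H.clmState k p b))) ∨
      (∃ I' s', LightStep H.light₂ st.I₂ st.s₂ l I' s' ∧ M = .par (H.lights
        { st with I₂ := I', s₂ := s' } H.d₁ H.d₂) (H.gpsClm (H.clmState k p b))) ∨
      (∃ c v h, (c = H.d₁ ∨ c = H.d₂) ∧ (l = .snd c v h ∨ l = .rcv c v h)) ∨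
      (p ≠ .recv ∧ ∃ v, l = .rcv H.g v (H.loc 3) ∧
        M = .par (H.lights st H.d₁ H.d₂) (H.gpsClm (H.clmRecv v))) ∨
      (l = .tau ∧ p = .recv ∧ b = false ∧ k = H.loc 1 ∧ st.s₁ = .wait ∧
        M = .par (H.lights { st with s₁ := .on } H.d₁ H.d₂) (H.gpsClm (.sigma H.clm))) ∨
      (l = .tau ∧ p = .recv ∧ b = false ∧ k = H.loc 4 ∧ st.s₂ = .wait ∧
        M = .par (H.lights { st with s₂ := .on } H.d₁ H.d₂) (H.gpsClm (.sigma H.clm))) := by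
  cases h with
  | glbComL h1 _ _ =>
    rcases nstep_lights h1 with ⟨_, _, h, _⟩ | ⟨_, _, h, _⟩ | ⟨_, ⟨v, h⟩, _⟩ | ⟨_, ⟨v, h⟩, _⟩
    · exact (h.not_isOn _ rfl).elim
    · exact (h.not_isOn _ rfl).elim
    · cases h
    · cases h
  | glbComR h1 h2 _ =>
    rcases nstep_gpsClm h2 with ⟨_, _, h, _⟩ | ⟨hp, hb, rfl, h⟩
    · cases h
    rcases nstep_lights h1 with ⟨_, _, h', _⟩ | ⟨_, _, h', _⟩ | ⟨hs, ⟨v, h'⟩, rfl⟩ |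
      ⟨hs, ⟨v, h'⟩, rfl⟩
    · exact (h'.not_isOn _ rfl).elim
    · exact (h'.not_isOn _ rfl).elim
    · cases h'
      rcases h with ⟨hk, h⟩ | ⟨hk, h⟩
      · exact .inr (.inr (.inr (.inr (.inl ⟨rfl, hp, hb, hk, hs, rfl⟩))))
      · injection h with h; exact (d₁_ne_d₂ h).elim
    · cases h'
      rcases h with ⟨hk, h⟩ | ⟨hk, h⟩
      · injection h with h; exact (d₁_ne_d₂ h.symm).elim
      · exact .inr (.inr (.inr (.inr (.inr ⟨rfl, hp, hb, hk, hs, rfl⟩))))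
  | parL _ h =>
    replace h := nstep_lights h
    rcases h with ⟨_, _, h, rfl⟩ | ⟨_, _, h, rfl⟩ | ⟨_, ⟨v, h⟩, _⟩ | ⟨_, ⟨v, h⟩, _⟩
    · exact .inl ⟨_, _, h, rfl⟩
    · exact .inr (.inl ⟨_, _, h, rfl⟩)
    · exact .inr (.inr (.inl ⟨_, _, _, .inl rfl, .inr h⟩))
    · exact .inr (.inr (.inl ⟨_, _, _, .inr rfl, .inr h⟩))
  | parR _ h =>
    replace h := nstep_gpsClm h
    rcases h with ⟨hp, v, h, rfl⟩ | ⟨_, _, _, ⟨_, h⟩ | ⟨_, h⟩⟩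
    · exact .inr (.inr (.inr (.inl ⟨hp, v, h, rfl⟩)))
    · exact .inr (.inr (.inl ⟨_, _, _, .inl rfl, .inl h⟩))
    · exact .inr (.inr (.inl ⟨_, _, _, .inr rfl, .inl h⟩))

/-- Besides the common transitions there are the steps of the detour: detection of the position, its
transmission on `g`, and the message to the manager in the phone's room. The hypothesis `hp` says
that nobody has been contacted before the position was received, which is needed to describe the
central manager afterwards. -/
theorem nstep_gpsNet {st : HomeState W} {p : Phase} (hi : H.Inv st)
    (hp : p ≠ .recv → st.s₁.busy = false ∧ st.s₂.busy = false) {l : NLabel W} {M : Network W}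
    (h : NStep (H.gpsNet st p) l M) :
    (∃ st', H.Common st l st' ∧ M = H.gpsNet st' p) ∨
      (l = .tau ∧ p = .start ∧ M = H.gpsNet st .sent) ∨
      (l = .tau ∧ p = .sent ∧ M = H.gpsNet st .recv) ∨
      (l = .tau ∧ p = .recv ∧ st.l = H.loc 1 ∧ st.s₁ = .wait ∧
        M = H.gpsNet { st with s₁ := .on } .recv) ∨
      (l = .tau ∧ p = .recv ∧ st.l = H.loc 4 ∧ st.s₂ = .wait ∧
        M = H.gpsNet { st with s₂ := .on } .recv) := by
  have hf := hi.fresh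
  cases h with
  | res h hl₁ =>
  cases h with
  | res h hl₂ =>
  cases h with
  | res h hl₃ =>
  cases h with
  | glbComL h1 h2 hc =>
    rcases nstep_house h2 with ⟨_, _, h, _⟩ | ⟨_, _, h, _⟩ | ⟨c, v, k, hcd, h | h⟩ |
      ⟨hp', v, h, rfl⟩ | ⟨h, _⟩ | ⟨h, _⟩ <;>
      first
      | exact (LightStep.not_isOn h _ rfl).elim
      | cases h
    · rcases nstep_gpsPhone h1 with ⟨_, _, h, _⟩ | ⟨_, h, _⟩ | ⟨_, h, _⟩
      · have h := h.hasFreeChan_of_isOn rfl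
        rcases hcd with rfl | rfl
        exacts [(hf.d₁ h).elim, (hf.d₂ h).elim]
      · cases h
      · injection h with h
        subst h
        rcases hcd with h | h
        exacts [(g_ne_d₁ h).elim, (g_ne_d₂ h).elim]
    · rcases nstep_gpsPhone h1 with ⟨_, _, h, _⟩ | ⟨_, h, _⟩ | ⟨rfl, h, rfl⟩
      · exact (hf.g (h.hasFreeChan_of_isOn rfl)).elim
      · cases h
      · cases h
        refine .inr (.inr (.inl ⟨rfl, rfl, ?_⟩))
        -- Having just received the position, the central manager has not yet contacted anybody;
        -- accordingly the disjunction of the two flags must be false.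
        rw [gpsNet, (hp hp').1, (hp hp').2]
        rfl
  | glbComR h1 h2 hc =>
    rcases nstep_house h2 with ⟨_, _, h, _⟩ | ⟨_, _, h, _⟩ | ⟨c, v, k, hcd, h | h⟩ |
      ⟨hp', v, h, rfl⟩ | ⟨h, _⟩ | ⟨h, _⟩ <;>
      first
      | exact (LightStep.not_isOn h _ rfl).elim
      | cases h
    rcases nstep_gpsPhone h1 with ⟨_, _, h, _⟩ | ⟨_, h, _⟩ | ⟨_, h, _⟩
    · have h := h.hasFreeChan_of_isOn rfl
      rcases hcd with rfl | rfl
      exacts [(hf.d₁ h).elim, (hf.d₂ h).elim]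
    · cases h
    · cases h
  | parL _ h =>
    replace h := nstep_gpsPhone h
    rcases h with ⟨_, _, h, rfl⟩ | ⟨rfl, rfl, rfl⟩ | ⟨_, rfl, _⟩
    · exact .inl ⟨_, .phone h, rfl⟩
    · exact .inr (.inl ⟨rfl, rfl, rfl⟩)
    · exact (hl₃ rfl).elim
  | parR _ h =>
    replace h := nstep_house h
    rcases h with ⟨_, _, h, rfl⟩ | ⟨_, _, h, rfl⟩ | ⟨c, v, k, hcd, h⟩ |
      ⟨_, v, rfl, _⟩ | ⟨rfl, rfl, hb, hk, hs, rfl⟩ | ⟨rfl, rfl, hb, hk, hs, rfl⟩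
    · refine .inl ⟨_, .light₁ h, ?_⟩
      rw [gpsNet]; dsimp only; rw [h.busy_eq]; rfl
    · refine .inl ⟨_, .light₂ h, ?_⟩
      rw [gpsNet]; dsimp only; rw [h.busy_eq]; rfl
    · rcases hcd with rfl | rfl <;> rcases h with rfl | rfl
      exacts [(hl₁ rfl).elim, (hl₁ rfl).elim, (hl₂ rfl).elim, (hl₂ rfl).elim]
    · exact (hl₃ rfl).elim
    · exact .inr (.inr (.inr (.inl ⟨rfl, rfl, hk, hs, rfl⟩)))
    · refine .inr (.inr (.inr (.inr ⟨rfl, rfl, hk, hs, ?_⟩)))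
      rw [gpsNet]; dsimp only
      -- Here the flag that has become true is the second argument, so the disjunction does not
      -- reduce by computation alone.
      rw [show (st.s₁.busy || LightState.on.busy) = true by simp [LightState.busy]]
      rfl

theorem gpsNet_detect (st : HomeState W) :
    NStep (H.gpsNet st .start) .tau (H.gpsNet st .sent) :=
  .res (.res (.res (.parL _ (.pos (.parR _ (H.gps_pos _)))) id) id) id

theorem gpsNet_send {st : HomeState W} (h₁ : st.s₁.busy = false) (h₂ : st.s₂.busy = false) :
    NStep (H.gpsNet st .sent) .tau (H.gpsNet st .recv) := by
  have hr : H.g.rng ≠ .intra := by rw [H.rng_g]; exact nofun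
  have h1 : NStep (H.gpsPhone st .sent) (.snd H.g (.loc st.l) st.l) (H.gpsPhone st .recv) :=
    .snd (.parR _ (.snd _ _ _ _)) hr
  have h2 : NStep (H.gpsClm H.clm) (.rcv H.g (.loc st.l) (H.loc 3))
      (H.gpsClm (H.clmRecv (.loc st.l))) := .rcv (H.clm_step _) hr
  rw [gpsNet, gpsNet, h₁, h₂]
  refine .res (.res (.res (.glbComL h1 (.parR _ h2) ?_) id) id) id
  rw [H.rng_g]
  trivial

/-- The flag of the other light manager must be false, for otherwise the state would describe a
central manager that has already sent its message. -/
theorem gpsNet_com₁ {st : HomeState W} (hl : st.l = H.loc 1) (hs : st.s₁ = .wait)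
    (h₂ : st.s₂.busy = false) :
    NStep (H.gpsNet st .recv) .tau (H.gpsNet { st with s₁ := .on } .recv) := by
  have hr : H.d₁.rng ≠ .intra := by rw [H.rng_d₁]; exact nofun
  have h1 : NStep (H.gpsClm (H.clmState st.l .recv (st.s₁.busy || st.s₂.busy)))
      (.snd H.d₁ .unit (H.loc 3)) (H.gpsClm (.sigma H.clm)) := by
    rw [hs, h₂, hl]
    exact .snd H.clmRecv_step₁ hr
  refine .res (.res (.res (.parR _ (.glbComR (lights_rcv₁ _ _ hs hr) h1 ?_)) id) id) id
  -- The central manager at `loc 3` is at distance 2 from the first light manager, which is exactly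
  -- the range of `d₁`.
  have hd := H.dist_loc 1 (by simp) 3 (by simp)
  rw [H.rng_d₁]
  change W.dist (H.loc 1) (H.loc 3) ≤ 2
  zify
  rw [hd]
  norm_num

theorem gpsNet_com₂ {st : HomeState W} (hl : st.l = H.loc 4) (hs : st.s₂ = .wait)
    (h₁ : st.s₁.busy = false) :
    NStep (H.gpsNet st .recv) .tau (H.gpsNet { st with s₂ := .on } .recv) := by
  have hr : H.d₂.rng ≠ .intra := by rw [H.rng_d₂]; exact nofun
  have h1 : NStep (H.gpsClm (H.clmState st.l .recv (st.s₁.busy || st.s₂.busy)))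
      (.snd H.d₂ .unit (H.loc 3)) (H.gpsClm (.sigma H.clm)) := by
    rw [hs, h₁, hl]
    exact .snd H.clmRecv_step₂ hr
  have h2 : NStep (.par (H.lights st H.d₁ H.d₂)
      (H.gpsClm (H.clmState st.l .recv (st.s₁.busy || st.s₂.busy)))) .tau
      (.par (H.lights { st with s₂ := .on } H.d₁ H.d₂) (H.gpsClm (.sigma H.clm))) := by
    refine .glbComR (lights_rcv₂ _ _ hs hr) h1 ?_
    -- Likewise the distance from `loc 3` to `loc 4` is 1, the range of `d₂`.
    have hd := H.dist_loc 4 (by simp) 3 (by simp)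
    rw [H.rng_d₂]
    change W.dist (H.loc 4) (H.loc 3) ≤ 1
    zify
    rw [hd]
    norm_num
  rw [gpsNet, gpsNet]
  dsimp only
  rw [show (st.s₁.busy || LightState.on.busy) = true by simp [LightState.busy]]
  exact .res (.res (.res (.parR _ h2) id) id) id

/-! ### The passage of time -/

/-- The passage of time in the smart home. -/
inductive Tick : HomeState W → HomeState W → Prop
  | mk {st : HomeState W} {P' : Proc W} {l' : W.Loc} {s₁' s₂' : LightState} :
      PTime st.P P' → W.dist st.l l' ≤ W.δ → LightTick st.s₁ s₁' → LightTick st.s₂ s₂' →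
      Tick st { st with P := P', l := l', s₁ := s₁', s₂ := s₂' }

theorem Tick.inv {st st' : HomeState W} (h : Tick st st') (hi : H.Inv st) : H.Inv st' := by
  cases h with
  | mk hP _ h₁ h₂ =>
    exact ⟨hi.fresh.mono fun _ => hP.hasChan, by simp [h₁.not_busy], by simp [h₂.not_busy]⟩

theorem Tick.not_busy {st st' : HomeState W} (h : Tick st st') :
    st'.s₁.busy = false ∧ st'.s₂.busy = false := by
  cases h with | mk _ _ h₁ h₂ => exact ⟨h₁.not_busy, h₂.not_busy⟩

theorem ntime_lights {st : HomeState W} {c c' : Chan} {M : Network W}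
    (h : NTime (H.lights st c c') M) : ∃ s₁' s₂', LightTick st.s₁ s₁' ∧ LightTick st.s₂ s₂' ∧
      M = H.lights { st with s₁ := s₁', s₂ := s₂' } c c' := by
  cases h with
  | par h1 h2 _ =>
    cases h1 with
    | stat h1 _ =>
      cases h2 with
      | stat h2 _ =>
        obtain ⟨s₁', h3, rfl⟩ := time_light h1
        obtain ⟨s₂', h4, rfl⟩ := time_light h2
        exact ⟨_, _, h3, h4, rfl⟩

theorem lights_ntime {st : HomeState W} {c c' : Chan} {s₁' s₂' : LightState}
    (h₁ : LightTick st.s₁ s₁') (h₂ : LightTick st.s₂ s₂')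
    (hn : ∀ M, ¬ NStep (H.lights st c c') .tau M) :
    NTime (H.lights st c c') (H.lights { st with s₁ := s₁', s₂ := s₂' } c c') :=
  .par (.stat (h₁.ptime _ _) fun _ h => hn _ (.parL _ h))
    (.stat (h₂.ptime _ _) fun _ h => hn _ (.parR _ h)) hn

theorem not_nstep_of_res {c : Chan} {M : Network W} (h : ∀ N, ¬ NStep (.res c M) .tau N) :
    ∀ N, ¬ NStep M .tau N := fun _ hN => h _ (.res hN id)

theorem ntime_prox {st : HomeState W} {M : Network W} (h : NTime (H.prox st) M) :
    ∃ st', Tick st st' ∧ M = H.prox st' := by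
  cases h with
  | res _ h =>
  cases h with
  | res _ h =>
  cases h with
  | par h1 h2 _ =>
  obtain ⟨s₁', s₂', h3, h4, rfl⟩ := ntime_lights h2
  cases h1 with
  | mob h1 _ hd =>
  cases h1 with
  | par hP hL _ =>
  cases hL with
  | par hL₁ hL₂ _ =>
  obtain rfl := time_ctrl hL₁
  obtain rfl := time_ctrl hL₂
  refine ⟨_, .mk hP hd h3 h4, ?_⟩
  rw [prox]
  dsimp only
  rw [h3.not_busy, h4.not_busy]
  rfl

theorem Tick.ntime_prox {st st' : HomeState W} (h : Tick st st')
    (hn : ∀ M, ¬ NStep (H.prox st) .tau M) : NTime (H.prox st) (H.prox st') := by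
  cases h with
  | mk hP hd h₁ h₂ =>
  rw [prox, prox]
  dsimp only
  rw [h₁.not_busy, h₂.not_busy]
  have hn := not_nstep_of_res (not_nstep_of_res hn)
  -- The timed rules ask for the absence of τ at every level of the term; each instance is inherited
  -- from the whole system.
  have hn' : ∀ M, ¬ NStep (H.proxPhone st st.s₁.busy st.s₂.busy) .tau M :=
    fun _ h => hn _ (.parL _ h)
  refine .res _ (.res _ (.par (.mob ?_ hn' hd) (lights_ntime h₁ h₂ fun _ h => hn _ (.parR _ h)) hn))
  exact .par hP (.par (ctrl_time _ _) (ctrl_time _ _) fun _ h => hn' _ (.locCom (.parR _ h)))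
    fun _ h => hn' _ (.locCom h)

/-- Only the timed rules of the components are inspected here. The phase `sent` is not excluded,
since the pending output may time out; that it never does so in a synchronised state is the matter
of `Sync.time_gpsNet`. -/
theorem ntime_gpsNet {st : HomeState W} {p : Phase} {M : Network W} (h : NTime (H.gpsNet st p) M) :
    ∃ st', Tick st st' ∧ M = H.gpsNet st' .start := by
  cases h with
  | res _ h =>
  cases h with
  | res _ h =>
  cases h with
  | res _ h =>
  cases h with
  | par h1 h2 _ =>
  cases h2 with
  | par h2 h5 _ =>
  obtain ⟨s₁', s₂', h3, h4, rfl⟩ := ntime_lights h2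
  cases h5 with
  | stat h5 _ =>
  obtain rfl := time_unique (H.clmState_time _ _ _) h5
  cases h1 with
  | mob h1 _ hd =>
  cases h1 with
  | par hP hL _ =>
  cases p with
  -- Position detection is not delayable, so time cannot pass before it.
  | start => cases hL with | fix hL => cases hL
  | sent => cases hL; exact ⟨_, .mk hP hd h3 h4, rfl⟩
  | recv => cases hL; exact ⟨_, .mk hP hd h3 h4, rfl⟩

theorem Tick.ntime_gpsNet {st st' : HomeState W} (h : Tick st st')
    (hn : ∀ M, ¬ NStep (H.gpsNet st .recv) .tau M) :
    NTime (H.gpsNet st .recv) (H.gpsNet st' .start) := by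
  cases h with
  | mk hP hd h₁ h₂ =>
  have hn := not_nstep_of_res (not_nstep_of_res (not_nstep_of_res hn))
  have hn' : ∀ M, ¬ NStep (H.gpsPhone st .recv) .tau M := fun _ h => hn _ (.parL _ h)
  exact .res _ (.res _ (.res _ (.par
    (.mob (.par hP (.delay _) fun _ h => hn' _ (.locCom h)) hn' hd)
    (.par (lights_ntime h₁ h₂ fun _ h => hn _ (.parR _ (.parL _ h)))
      (.stat (H.clmState_time _ _ _) fun _ h => hn _ (.parR _ (.parR _ h)))
      fun _ h => hn _ (.parR _ h)) hn)))

end SmartHome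

end IoT

/-! ### The bisimulation between the two homes, and their initial states -/

namespace IoT

variable {W : World}

/-! ### The two systems are bisimilar -/

open Classical in
/-- The interface of a device at location `l` after an update of the sensor `s` at `h`. -/
noncomputable def Iface.upd (s : Sens) (h : W.Loc) (v : W.V) (l : W.Loc) (I : Iface W) : Iface W :=
  if l = h ∧ I.sens s ≠ none then I.setSens s v else I

theorem sensUpd_node (s : Sens) (h : W.Loc) (v : W.V) (d : Dev W) :
    (Network.node d).sensUpd s h v = .node { d with I := d.I.upd s h v d.h } := by
  rw [Network.sensUpd, Iface.upd]
  split <;> rfl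

namespace SmartHome

variable {H : SmartHome W}

variable (H) in
/-- The state of the home after an update of the sensor `s` at `h`. -/
noncomputable def updState (s : Sens) (h : W.Loc) (v : W.V) (st : HomeState W) : HomeState W :=
  { st with
    I := st.I.upd s h v st.l
    I₁ := st.I₁.upd s h v (H.loc 1)
    I₂ := st.I₂.upd s h v (H.loc 4) }

theorem prox_sensUpd (s : Sens) (h : W.Loc) (v : W.V) (st : HomeState W) :
    (H.prox st).sensUpd s h v = H.prox (H.updState s h v st) := by
  simp only [prox, proxPhone, lights, Network.sensUpd.eq_4, Network.sensUpd.eq_3, sensUpd_node]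
  rfl

theorem gpsNet_sensUpd (s : Sens) (h : W.Loc) (v : W.V) (st : HomeState W) (p : Phase) :
    (H.gpsNet st p).sensUpd s h v = H.gpsNet (H.updState s h v st) p := by
  simp only [gpsNet, gpsPhone, gpsClm, lights, Network.sensUpd.eq_4, Network.sensUpd.eq_3,
    sensUpd_node]
  -- The central manager has no sensors, so the update passes it by.
  simp only [Iface.upd, ne_eq, not_true_eq_false, and_false, if_false]
  rfl

variable (H) in
/-- The invariants of the states of both systems. -/
structure Sync (st : HomeState W) (p : Phase) : Prop extends H.Inv st where
  phase : p ≠ .recv → st.s₁.busy = false ∧ st.s₂.busy = false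

theorem Sync.recv {st : HomeState W} {p : Phase} (h : H.Sync st p) : H.Sync st .recv :=
  ⟨h.toInv, fun h => (h rfl).elim⟩

theorem Sync.common {st st' : HomeState W} {p : Phase} (h : H.Sync st p) {l : NLabel W}
    (hl : H.Common st l st') : H.Sync st' p := by
  refine ⟨hl.inv h.toInv, ?_⟩
  rw [hl.busy.2.1, hl.busy.2.2]
  exact h.phase

theorem Sync.on₁ {st : HomeState W} {p : Phase} (h : H.Sync st p) (hl : st.l = H.loc 1) :
    H.Sync { st with s₁ := .on } .recv :=
  ⟨⟨h.fresh, fun _ => hl, h.busy₂⟩, fun h => (h rfl).elim⟩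

theorem Sync.on₂ {st : HomeState W} {p : Phase} (h : H.Sync st p) (hl : st.l = H.loc 4) :
    H.Sync { st with s₂ := .on } .recv :=
  ⟨⟨h.fresh, h.busy₁, fun _ => hl⟩, fun h => (h rfl).elim⟩

theorem Sync.tick {st st' : HomeState W} {p : Phase} (h : H.Sync st p) (ht : Tick st st') :
    H.Sync st' .start :=
  ⟨ht.inv h.toInv, fun _ => ht.not_busy⟩

theorem Sync.updState {st : HomeState W} {p : Phase} (hs : H.Sync st p) (s : Sens) (h : W.Loc)
    (v : W.V) : H.Sync (H.updState s h v st) p :=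
  ⟨⟨hs.fresh, hs.busy₁, hs.busy₂⟩, hs.phase⟩

theorem Sync.not_busy₂ {st : HomeState W} {p : Phase} (h : H.Sync st p) (hl : st.l = H.loc 1) :
    st.s₂.busy = false :=
  Bool.eq_false_iff.2 fun hb => H.loc_one_ne_loc_four (hl.symm.trans (h.busy₂ hb))

theorem Sync.not_busy₁ {st : HomeState W} {p : Phase} (h : H.Sync st p) (hl : st.l = H.loc 4) :
    st.s₁.busy = false :=
  Bool.eq_false_iff.2 fun hb => H.loc_one_ne_loc_four ((h.busy₁ hb).symm.trans hl)

/-- Detecting and reporting the position is possible at any moment of the slot by private steps that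
change nothing visible. This is how the GPS system catches up before it answers a detection or a
tick. -/
theorem Sync.taus_recv {st : HomeState W} {p : Phase} (h : H.Sync st p) :
    NTaus (H.gpsNet st p) (H.gpsNet st .recv) := by
  cases p with
  | start =>
    obtain ⟨h₁, h₂⟩ := h.phase nofun
    exact (Relation.ReflTransGen.single (gpsNet_detect st)).tail (gpsNet_send h₁ h₂)
  | sent =>
    obtain ⟨h₁, h₂⟩ := h.phase nofun
    exact .single (gpsNet_send h₁ h₂)
  | recv => exact .refl

/-- A common transition is matched in the current phase. When the phone is detected, the GPS system
first catches up and then contacts the manager; by the invariant the other manager is not busy, so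
the central manager still has its message to send. -/
theorem Sync.step_prox {st : HomeState W} {p : Phase} (h : H.Sync st p) {l : NLabel W}
    {M : Network W} (hM : NStep (H.prox st) l M) : ∃ st' p', H.Sync st' p' ∧ M = H.prox st' ∧
      WeakNStep (H.gpsNet st p) l (H.gpsNet st' p') := by
  rcases nstep_prox h.fresh hM with ⟨st', hc, rfl⟩ | ⟨rfl, hl, hs, rfl⟩ | ⟨rfl, hl, hs, rfl⟩
  · exact ⟨st', p, h.common hc, rfl, .single (hc.nstep_gpsNet h.fresh p)⟩
  · exact ⟨_, _, h.on₁ hl, rfl,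
      .inl ⟨rfl, h.taus_recv.tail (gpsNet_com₁ hl hs (h.not_busy₂ hl))⟩⟩
  · exact ⟨_, _, h.on₂ hl, rfl,
      .inl ⟨rfl, h.taus_recv.tail (gpsNet_com₂ hl hs (h.not_busy₁ hl))⟩⟩

/-- Position detection and the message on `g` only advance the phase and are matched by staying put.
The message to a light manager corresponds to the direct contact by the phone. -/
theorem Sync.step_gpsNet {st : HomeState W} {p : Phase} (h : H.Sync st p) {l : NLabel W}
    {M : Network W} (hM : NStep (H.gpsNet st p) l M) : ∃ st' p', H.Sync st' p' ∧
      M = H.gpsNet st' p' ∧ WeakNStep (H.prox st) l (H.prox st') := by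
  rcases nstep_gpsNet h.toInv h.phase hM with ⟨st', hc, rfl⟩ | ⟨rfl, rfl, rfl⟩ | ⟨rfl, rfl, rfl⟩ |
    ⟨rfl, rfl, hl, hs, rfl⟩ | ⟨rfl, rfl, hl, hs, rfl⟩
  · exact ⟨st', p, h.common hc, rfl, .single (hc.nstep_prox h.fresh)⟩
  · exact ⟨st, .sent, ⟨h.toInv, fun _ => h.phase nofun⟩, rfl, .inl ⟨rfl, .refl⟩⟩
  · exact ⟨st, .recv, h.recv, rfl, .inl ⟨rfl, .refl⟩⟩
  · exact ⟨_, _, h.on₁ hl, rfl, .single (prox_com₁ hl hs)⟩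
  · exact ⟨_, _, h.on₂ hl, rfl, .single (prox_com₂ hl hs)⟩

/-- In the last phase the τ-steps of the two systems correspond one to one. Since time waits for
τ-steps, the two systems become ready for a tick in the same states. -/
theorem Sync.no_tau_iff {st : HomeState W} (h : H.Sync st .recv) :
    (∀ M, ¬ NStep (H.gpsNet st .recv) .tau M) ↔ ∀ M, ¬ NStep (H.prox st) .tau M := by
  constructor
  · intro hn M hM
    rcases nstep_prox h.fresh hM with ⟨_, hc, _⟩ | ⟨_, hl, hs, _⟩ | ⟨_, hl, hs, _⟩
    · exact hn _ (hc.nstep_gpsNet h.fresh _)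
    · exact hn _ (gpsNet_com₁ hl hs (h.not_busy₂ hl))
    · exact hn _ (gpsNet_com₂ hl hs (h.not_busy₁ hl))
  · intro hn M hM
    rcases nstep_gpsNet h.toInv h.phase hM with ⟨_, hc, _⟩ | ⟨_, hp, _⟩ | ⟨_, hp, _⟩ |
      ⟨_, _, hl, hs, _⟩ | ⟨_, _, hl, hs, _⟩
    · exact hn _ (hc.nstep_prox h.fresh)
    · cases hp
    · cases hp
    · exact hn _ (prox_com₁ hl hs)
    · exact hn _ (prox_com₂ hl hs)

theorem Sync.time_prox {st : HomeState W} {p : Phase} (h : H.Sync st p) {M : Network W}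
    (hM : NTime (H.prox st) M) : ∃ st' N, H.Sync st' .start ∧ M = H.prox st' ∧
      NTaus (H.gpsNet st p) N ∧ NTime N (H.gpsNet st' .start) := by
  obtain ⟨st', ht, rfl⟩ := ntime_prox hM
  exact ⟨st', _, h.tick ht, rfl, h.taus_recv, ht.ntime_gpsNet (h.recv.no_tau_iff.2 hM.no_tau)⟩

/-- In the two earlier phases a τ-step is available, so a tick can only occur after the position has
been received. The proximity system then ticks at once. -/
theorem Sync.time_gpsNet {st : HomeState W} {p : Phase} (h : H.Sync st p) {M : Network W}
    (hM : NTime (H.gpsNet st p) M) : ∃ st', H.Sync st' .start ∧ M = H.gpsNet st' .start ∧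
      NTime (H.prox st) (H.prox st') := by
  obtain ⟨st', ht, rfl⟩ := ntime_gpsNet hM
  cases p with
  | start => exact (hM.no_tau _ (gpsNet_detect st)).elim
  | sent =>
    obtain ⟨h₁, h₂⟩ := h.phase nofun
    exact (hM.no_tau _ (gpsNet_send h₁ h₂)).elim
  | recv => exact ⟨st', h.tick ht, rfl, ht.ntime_prox (h.no_tau_iff.1 hM.no_tau)⟩

/-- The two networks have the same interfaces at the same locations, except for the central manager,
which has no actuators. -/
theorem barb_iff_prox_gpsNet (st : HomeState W) (p : Phase) (a : Act) (h : W.Loc) (v : W.V) :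
    (∃ d ∈ (H.prox st).devs, d.h = h ∧ d.I.act a = some v) ↔
      ∃ d ∈ (H.gpsNet st p).devs, d.h = h ∧ d.I.act a = some v := by
  simp [prox, gpsNet, proxPhone, gpsPhone, lights, gpsClm, Network.devs]

variable (H) in
/-- The correspondence of the states of the two systems. -/
inductive HomeRel : Network W → Network W → Prop
  | left {st : HomeState W} {p : Phase} : H.Sync st p → HomeRel (H.prox st) (H.gpsNet st p)
  | right {st : HomeState W} {p : Phase} : H.Sync st p → HomeRel (H.gpsNet st p) (H.prox st)

theorem isIntBisim_homeRel : IsIntBisim H.HomeRel where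
  symm h := by cases h with
    | left h => exact .right h
    | right h => exact .left h
  step h _ _ hM := by cases h with
    | left h =>
      obtain ⟨st', p', h', rfl, hN⟩ := h.step_prox hM
      exact ⟨_, hN, .left h'⟩
    | right h =>
      obtain ⟨st', p', h', rfl, hN⟩ := h.step_gpsNet hM
      exact ⟨_, hN, .right h'⟩
  time h _ hM := by cases h with
    | left h =>
      obtain ⟨st', N, h', rfl, hN, hN'⟩ := h.time_prox hM
      exact ⟨_, _, hN, hN', .left h'⟩
    | right h =>
      obtain ⟨st', h', rfl, hN⟩ := h.time_gpsNet hM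
      exact ⟨_, _, .refl, hN, .right h'⟩
  upd h s k v := by cases h with
    | left h => rw [prox_sensUpd, gpsNet_sensUpd]; exact .left (h.updState s k v)
    | right h => rw [prox_sensUpd, gpsNet_sensUpd]; exact .right (h.updState s k v)
  barb h _ _ _ hb := by cases h with
    | left h => exact (barb_iff_prox_gpsNet _ _ _ _ _).1 hb
    | right h => exact (barb_iff_prox_gpsNet _ _ _ _ _).2 hb

/-! ### The initial states -/

variable (H)

/-- The initial state of the home. -/
def init : HomeState W := ⟨H.boilerCtrl, H.IP, H.I₁, H.I₂, H.out, .wait, .wait⟩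

theorem not_hasChan_auto {c : Chan} (hc : H.b ≠ c) : ¬ H.auto.HasChan c := by
  simp [auto, manual, tempCtrl, Proc.input, Proc.HasChan, Proc.liftP, hc]

theorem not_hasChan_boilerCtrl {c : Chan} (hc : H.b ≠ c) : ¬ H.boilerCtrl.HasChan c := by
  simp [boilerCtrl, Proc.HasChan, hc]

theorem b_ne_c₁ : H.b ≠ H.c₁ := fun h => by
  have h1 := H.rng_b; rw [h, H.rng_c₁] at h1; cases h1

theorem b_ne_c₂ : H.b ≠ H.c₂ := fun h => by
  have h1 := H.rng_b; rw [h, H.rng_c₂] at h1; cases h1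

theorem b_ne_d₁ : H.b ≠ H.d₁ := fun h => by
  have h1 := H.rng_b; rw [h, H.rng_d₁] at h1; cases h1

theorem b_ne_d₂ : H.b ≠ H.d₂ := fun h => by
  have h1 := H.rng_b; rw [h, H.rng_d₂] at h1; cases h1

theorem sync_init : H.Sync H.init .start :=
  ⟨⟨⟨H.not_hasChan_boilerCtrl H.b_ne_c₁, H.not_hasChan_boilerCtrl H.b_ne_c₂,
    H.not_hasChan_boilerCtrl H.b_ne_d₁, H.not_hasChan_boilerCtrl H.b_ne_d₂,
    H.not_hasChan_boilerCtrl H.b_ne_g⟩, nofun, nofun⟩, fun _ => ⟨rfl, rfl⟩⟩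

/-- The only channel of the boiler manager is `b`, which is not private, so it can be moved out of
the scope of the restrictions. What stays inside is, by definition, the initial state of the
proximity system. `ncong_sysGPS` does the same for the other system. -/
theorem ncong_sys :
    NCong (.resList [H.c₁, H.c₂] H.sys) (.par (H.prox H.init) H.boilerMng) := by
  have h : NCong H.sys (.par (.par H.phone (.par (H.lightMng₁ H.c₁) (H.lightMng₂ H.c₂)))
      H.boilerMng) := .symm (.parAssoc _ _ _)
  refine .trans (NCong.resList [H.c₁, H.c₂] h) (.symm (NCong.resList_par (cs := [H.c₁, H.c₂])
    (M := .par H.phone (.par (H.lightMng₁ H.c₁) (H.lightMng₂ H.c₂))) ?_))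
  simp only [List.mem_cons, List.not_mem_nil, or_false, forall_eq_or_imp, forall_eq]
  exact ⟨H.not_hasChan_auto H.b_ne_c₁, H.not_hasChan_auto H.b_ne_c₂⟩

theorem ncong_sysGPS : NCong (.resList [H.d₁, H.d₂, H.g] H.sysGPS)
    (.par (H.gpsNet H.init .start) H.boilerMng) := by
  have h : NCong H.sysGPS (.par (.par H.phoneGPS
      (.par (.par (H.lightMng₁ H.d₁) (H.lightMng₂ H.d₂)) H.clightMng)) H.boilerMng) :=
    .trans (.par (.refl _) (.trans (.parAssoc _ _ _) (.trans (.par (.refl _) (.parComm _ _))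
      (.symm (.parAssoc _ _ _))))) (.symm (.parAssoc _ _ _))
  refine .trans (NCong.resList [H.d₁, H.d₂, H.g] h) (.symm (NCong.resList_par
    (cs := [H.d₁, H.d₂, H.g])
    (M := .par H.phoneGPS (.par (.par (H.lightMng₁ H.d₁) (H.lightMng₂ H.d₂)) H.clightMng)) ?_))
  simp only [List.mem_cons, List.not_mem_nil, or_false, forall_eq_or_imp, forall_eq]
  exact ⟨H.not_hasChan_auto H.b_ne_d₁, H.not_hasChan_auto H.b_ne_d₂, H.not_hasChan_auto H.b_ne_g⟩

/-- The bisimulation concerns the homes without the boiler manager. `IntBisim.par` puts it back as a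
context, and the two congruences restore the original shape of the systems. -/
theorem intBisim_sys :
    IntBisim (.resList [H.c₁, H.c₂] H.sys) (.resList [H.d₁, H.d₂, H.g] H.sysGPS) :=
  (IntBisim.of_ncong H.ncong_sys).trans
    ((IntBisim.par ⟨_, isIntBisim_homeRel, .left H.sync_init⟩ _).trans
      (IntBisim.of_ncong H.ncong_sysGPS).symm)

theorem ok_sys : (Network.resList [H.c₁, H.c₂] H.sys).Ok := by
  have hn := H.nodes_distinct
  have ha := H.acts_distinct
  have hm := H.mode_nodeDep
  have ht := H.temp_locDep
  simp only [List.nodup_cons, List.mem_cons, List.not_mem_nil, not_or] at hn ha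
  have hd : (Network.resList [H.c₁, H.c₂] H.sys).devs =
    [⟨H.nP, H.IP, .par H.boilerCtrl H.lightCtrl, .mob, H.out⟩,
      ⟨H.n₁, H.I₁, lightProc H.c₁ H.light₁, .stat, H.loc 1⟩,
      ⟨H.n₂, H.I₂, lightProc H.c₂ H.light₂, .stat, H.loc 4⟩,
      ⟨H.nB, H.IB, H.auto, .stat, H.loc 2⟩] := rfl
  refine ⟨⟨?_, ?_, ?_, ?_, ?_, ?_⟩, ?_, ?_⟩ <;> rw [hd]
  · simp; grind
  · simp [IP, I₁, I₂, IB]; grind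
  · simp [IP, I₁, I₂, IB]; grind
  · simp [IP, I₁, I₂, IB, boilerCtrl, lightCtrl, lightCtrlOn, lightProc, auto, manual, tempCtrl,
      Proc.input, Proc.ReadsSens, Proc.liftP]
  · simp [IP, I₁, I₂, IB, boilerCtrl, lightCtrl, lightCtrlOn, lightProc, auto, manual, tempCtrl,
      Proc.input, Proc.WritesAct, Proc.liftP]
  · simp [IP, I₁, I₂, IB]; grind
  · simp [boilerCtrl, lightCtrl, lightCtrlOn, lightProc, auto, manual, tempCtrl,
      Proc.input, Proc.Scoped, Proc.liftP, Exp.Scoped, Guard.Scoped, eqGuard, ltGuard]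
  · simp [boilerCtrl, lightCtrl, lightCtrlOn, lightProc, auto, manual, tempCtrl,
      Proc.input, Proc.TimeGuarded, Proc.VarGuarded, Proc.liftP]

theorem ok_sysGPS : (Network.resList [H.d₁, H.d₂, H.g] H.sysGPS).Ok := by
  have hn := H.nodes_distinct
  have ha := H.acts_distinct
  have hm := H.mode_nodeDep
  have ht := H.temp_locDep
  simp only [List.nodup_cons, List.mem_cons, List.not_mem_nil, not_or] at hn ha
  have hd : (Network.resList [H.d₁, H.d₂, H.g] H.sysGPS).devs =
    [⟨H.nP, H.IP, .par H.boilerCtrl H.lightCtrlGPS, .mob, H.out⟩,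
      ⟨H.n₁, H.I₁, lightProc H.d₁ H.light₁, .stat, H.loc 1⟩,
      ⟨H.n₂, H.I₂, lightProc H.d₂ H.light₂, .stat, H.loc 4⟩,
      ⟨H.nB, H.IB, H.auto, .stat, H.loc 2⟩,
      ⟨H.nLM, ⟨fun _ => none, fun _ => none⟩, H.clm, .stat, H.loc 3⟩] := rfl
  refine ⟨⟨?_, ?_, ?_, ?_, ?_, ?_⟩, ?_, ?_⟩ <;> rw [hd]
  · simp; grind
  · simp [IP, I₁, I₂, IB]; grind
  · simp [IP, I₁, I₂, IB]; grind
  · simp [IP, I₁, I₂, IB, boilerCtrl, lightCtrlGPS, lightProc, auto, manual, tempCtrl, clm,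
      Proc.input, Proc.ReadsSens, Proc.liftP]
  · simp [IP, I₁, I₂, IB, boilerCtrl, lightCtrlGPS, lightProc, auto, manual, tempCtrl, clm,
      Proc.input, Proc.WritesAct, Proc.liftP]
  · simp [IP, I₁, I₂, IB]; grind
  · simp [boilerCtrl, lightCtrlGPS, lightProc, auto, manual, tempCtrl, clm,
      Proc.input, Proc.Scoped, Proc.liftP, Exp.Scoped, Guard.Scoped, eqGuard, ltGuard]
  · simp [boilerCtrl, lightCtrlGPS, lightProc, auto, manual, tempCtrl, clm,
      Proc.input, Proc.TimeGuarded, Proc.VarGuarded, Proc.liftP]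

end SmartHome

end IoT

theorem mainTheorem6 (W : IoT.World) (hδ : W.δ = 1) (H : IoT.SmartHome W) :
    IoT.Bisimilar (.resList [H.c₁, H.c₂] H.sys) (.resList [H.d₁, H.d₂, H.g] H.sysGPS) ∧
      IoT.BarbedCongruent (.resList [H.c₁, H.c₂] H.sys)
        (.resList [H.d₁, H.d₂, H.g] H.sysGPS) :=
  ⟨H.intBisim_sys.bisimilar H.ok_sys H.ok_sysGPS,
    H.intBisim_sys.barbedCongruent H.ok_sys H.ok_sysGPS⟩
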